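/- **Theorem 1.5 (torsion).** Let $d\ge 1$ and put $c:=\frac14\sqrt{5\left(1+\frac14\ln 2\right)}$; then $c<0.61$. (i) Let $\Omega\subseteq\mathbb R^d$ be Lebesgue measurable, let $L_2(\Omega)$ be the space of complex-valued square-integrable functions, and let $H$ be a selfadjoint operator in $L_2(\Omega)$ with $E_0(H):=\inf\sigma(H)>0$ (in particular $\sigma(H)\neq\emptyset$, i.e. $\Omega$ is not a null set). Assume that the $C_0$-semigroup $(e^{-tH})_{t\ge0}$ generated by $-H$ is dominated by the free heat semigroup on $\mathbb R^d$: for all $t\ge0$ and $f\in L_2(\Omega)$, $$|e^{-tH}f|\le e^{t\Delta}|f|\quad\text{a.e. on }\Omega,$$ where $|f|$ is extended by $0$ to $\mathbb R^d$, $e^{t\Delta}g(x)=(4\pi t)^{-d/2}\int_{\mathbb R^d}e^{-|x-y|^2/(4t)}g(y)\,dy$ for $t>0$, and $e^{0\Delta}g=g$. Let $$q(H):=E_0(H)\cdot\|H^{-1}\|_{\infty\to\infty},\qquad \|H^{-1}\|_{\infty\to\infty}:=\sup\{\|H^{-1}f\|_\infty : f\in L_2(\Omega)\cap L_\infty(\Omega),\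 \|f\|_\infty\le1\}.$$ Then $$1\le q(H)\le \frac d8+c\sqrt d+1 .$$ (ii) In particular, let $D\subseteq\mathbb R^d$ be open and let $-\Delta_D$ be the negative Dirichlet Laplacian in $L_2(D)$, i.e. the operator associated with the form $\int_D\nabla u\cdot\overline{\nabla v}$ on $H_0^1(D)$. Suppose that $E_0:=\inf\sigma(-\Delta_D)>0$. Then the torsion function $u_D=(-\Delta_D)^{-1}1$, that is, the a.e. limit $u_D=\lim_{n\to\infty}(-\Delta_D)^{-1}1_{D\cap B(0,n)}$, exists and $$\|u_D\|_\infty\le\frac{1}{E_0}\left(\frac d8+c\sqrt d+1\right).$$ -/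

import Mathlib

open MeasureTheory Filter Topology
open scoped ENNReal NNReal Distributions

namespace Torsion

/-- Euclidean space `ℝ^d`. -/
abbrev Eucl (d : ℕ) : Type := EuclideanSpace ℝ (Fin d)

/-- The complex Hilbert space `L_2(Ω)` for `Ω ⊆ ℝ^d`, with Lebesgue measure. -/
abbrev L2 {d : ℕ} (Ω : Set (Eucl d)) : Type :=
  Lp ℂ 2 ((volume : Measure (Eucl d)).restrict Ω)

section Operators

variable {E : Type*} [NormedAddCommGroup E] [NormedSpace ℂ E]

/-- `R` is the everywhere defined, bounded, two-sided inverse of the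
unbounded operator `z - A`. -/
def IsResolvent (A : E →ₗ.[ℂ] E) (z : ℂ) (R : E →L[ℂ] E) : Prop :=
  ∀ f u : E, R f = u ↔ ∃ h : u ∈ A.domain, z • u - A ⟨u, h⟩ = f

/-- The spectrum of the unbounded operator `A`: all `z` such that `z - A` has no bounded inverse. -/
def opSpectrum (A : E →ₗ.[ℂ] E) : Set ℂ :=
  {z | ¬ ∃ R : E →L[ℂ] E, IsResolvent A z R}

/-- The bottom of the spectrum, `E_0(H) = inf σ(H)`, of an operator with real spectrum.
(The junk value of the infimum, for an empty spectrum or one that is unbounded below, is `0`; so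
`0 < bottomSpectrum H` includes that the spectrum is nonempty and bounded below.) -/
noncomputable def bottomSpectrum (H : E →ₗ.[ℂ] E) : ℝ :=
  sInf {x : ℝ | (x : ℂ) ∈ opSpectrum H}

/-- `R = A⁻¹` as an everywhere defined, bounded operator: `R f = u` iff `u ∈ dom A`, `A u = f`. -/
def IsBoundedInverse (A : E →ₗ.[ℂ] E) (R : E →L[ℂ] E) : Prop :=
  ∀ f u : E, R f = u ↔ (u, f) ∈ A.graph

open Classical in
/-- The bounded operator `A⁻¹` (with the junk value `0` if `A` has no bounded inverse). -/
noncomputable def boundedInverse (A : E →ₗ.[ℂ] E) : E →L[ℂ] E :=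
  if h : ∃ R : E →L[ℂ] E, IsBoundedInverse A R then h.choose else 0

/-- A `C_0`-semigroup of bounded operators on `E`. -/
structure IsC0Semigroup (T : ℝ≥0 → E →L[ℂ] E) : Prop where
  map_zero : T 0 = ContinuousLinearMap.id ℂ E
  map_add : ∀ s t : ℝ≥0, T (s + t) = (T s).comp (T t)
  continuous : ∀ f : E, Continuous fun t => T t f

/-- `A` is the generator of the semigroup `T`: `u ∈ dom A` and `A u = f` iff
`(T t u - u) / t → f` as `t → 0+`. -/
def IsGenerator (T : ℝ≥0 → E →L[ℂ] E) (A : E →ₗ.[ℂ] E) : Prop :=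
  ∀ u f : E, (u, f) ∈ A.graph ↔
    Tendsto (fun t : ℝ≥0 => ((t : ℝ) : ℂ)⁻¹ • (T t u - u)) (𝓝[>] (0 : ℝ≥0)) (𝓝 f)

end Operators

/-- The free heat semigroup `e^{tΔ}` on `ℝ^d`: the convolution with the Gauss-Weierstrass kernel
for `t > 0`, the identity for `t = 0`. -/
noncomputable def freeHeat {d : ℕ} (t : ℝ≥0) (g : Eucl d → ℝ) (x : Eucl d) : ℝ :=
  if t = 0 then g x
  else ∫ y, (4 * Real.pi * (t : ℝ)) ^ (-(d : ℝ) / 2) *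
    Real.exp (-‖x - y‖ ^ 2 / (4 * (t : ℝ))) * g y

/-- `|T(t) f| ≤ e^{tΔ} |f|` a.e. on `Ω` for all `t ≥ 0` and `f ∈ L_2(Ω)`, where `|f|` is extended
by `0` to `ℝ^d`. -/
def DominatedByFreeHeat {d : ℕ} {Ω : Set (Eucl d)} (T : ℝ≥0 → L2 Ω →L[ℂ] L2 Ω) : Prop :=
  ∀ (t : ℝ≥0) (f : L2 Ω), ∀ᵐ x ∂((volume : Measure (Eucl d)).restrict Ω),
    ‖T t f x‖ ≤ freeHeat t (Ω.indicator fun y => ‖f y‖) x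

/-- The norm `‖B‖_{∞→∞} ∈ [0,∞]` of a bounded operator `B` on `L_2(Ω)`: the supremum of
`‖B f‖_∞` over all `f ∈ L_2(Ω)` with `‖f‖_∞ ≤ 1`. -/
noncomputable def normInfty {d : ℕ} {Ω : Set (Eucl d)} (B : L2 Ω →L[ℂ] L2 Ω) : ℝ≥0∞ :=
  ⨆ (f : L2 Ω) (_ : eLpNorm f ∞ ((volume : Measure (Eucl d)).restrict Ω) ≤ 1),
    eLpNorm (B f) ∞ ((volume : Measure (Eucl d)).restrict Ω)

/-- `q(H) = E_0(H) ‖H⁻¹‖_{∞→∞}`. -/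
noncomputable def q {d : ℕ} {Ω : Set (Eucl d)} (H : L2 Ω →ₗ.[ℂ] L2 Ω) : ℝ≥0∞ :=
  ENNReal.ofReal (bottomSpectrum H) * normInfty (boundedInverse H)

/-- `c = ¼ √(5 (1 + ¼ ln 2))`. -/
noncomputable def cConst : ℝ := 1 / 4 * Real.sqrt (5 * (1 + 1 / 4 * Real.log 2))

/-- `d/8 + c √d + 1`. -/
noncomputable def torsionConst (d : ℕ) : ℝ := (d : ℝ) / 8 + cConst * Real.sqrt d + 1

section Dirichlet

variable {d : ℕ}

/-- The pairs `(u, ∇u)` with `u ∈ H_0^1(D)`, as a subspace of `L_2(D) × L_2(D)^d`: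
the closure of `{(φ, ∇φ) | φ ∈ C_c^∞(D)}`. -/
noncomputable def h10Graph (D : TopologicalSpace.Opens (Eucl d)) :
    Submodule ℂ (L2 (D : Set (Eucl d)) × (Fin d → L2 (D : Set (Eucl d)))) :=
  (Submodule.span ℂ {p | ∃ φ : 𝓓(D, ℂ),
    (p.1 =ᵐ[(volume : Measure (Eucl d)).restrict D] fun x => φ x) ∧
    ∀ i, p.2 i =ᵐ[(volume : Measure (Eucl d)).restrict D]
      fun x => fderiv ℝ (fun y => φ y) x (EuclideanSpace.single i (1 : ℝ))}).topologicalClosure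

/-- The graph of the operator `-Δ_D` associated with the Dirichlet form: the pairs `(u, f)` with
`u ∈ H_0^1(D)`, `f ∈ L_2(D)` and `∫_D ∇u · conj ∇v = ∫_D f conj v` for all `v ∈ H_0^1(D)`. -/
noncomputable def dirichletGraph (D : TopologicalSpace.Opens (Eucl d)) :
    Submodule ℂ (L2 (D : Set (Eucl d)) × L2 (D : Set (Eucl d))) where
  carrier := {p | ∃ G : Fin d → L2 (D : Set (Eucl d)), (p.1, G) ∈ h10Graph D ∧
    ∀ v K, (v, K) ∈ h10Graph D → ∑ i, inner ℂ (K i) (G i) = inner ℂ v p.2}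
  zero_mem' := ⟨0, (h10Graph D).zero_mem, fun v K _ => by simp⟩
  add_mem' := by
    rintro p p' ⟨G, hG, h⟩ ⟨G', hG', h'⟩
    refine ⟨G + G', (h10Graph D).add_mem hG hG', fun v K hv => ?_⟩
    simp only [Pi.add_apply, inner_add_right, Finset.sum_add_distrib, Prod.snd_add,
      h v K hv, h' v K hv]
  smul_mem' := by
    rintro a p ⟨G, hG, h⟩
    refine ⟨a • G, (h10Graph D).smul_mem a hG, fun v K hv => ?_⟩
    simp only [Pi.smul_apply, inner_smul_right, ← Finset.mul_sum, Prod.smul_snd, h v K hv]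

/-- The negative Dirichlet Laplacian `-Δ_D` in `L_2(D)`. -/
noncomputable def negDirichletLaplacian (D : TopologicalSpace.Opens (Eucl d)) :
    L2 (D : Set (Eucl d)) →ₗ.[ℂ] L2 (D : Set (Eucl d)) :=
  (dirichletGraph D).toLinearPMap

/-- The function `1_{D ∩ B(0,n)}` in `L_2(D)`. -/
noncomputable def truncatedOne (D : TopologicalSpace.Opens (Eucl d)) (n : ℕ) :
    L2 (D : Set (Eucl d)) :=
  indicatorConstLp 2 (μ := (volume : Measure (Eucl d)).restrict D)
    (s := Metric.ball (0 : Eucl d) (n : ℝ)) Metric.isOpen_ball.measurableSet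
    measure_ball_lt_top.ne (1 : ℂ)

/-- `u` is (a version of) the torsion function `u_D = (-Δ_D)⁻¹ 1`. Since `1` need not belong to
`L_2(D)`, the inverse is extended by monotone approximation: `u_D` is the a.e. limit
of `(-Δ_D)⁻¹ 1_{D ∩ B(0,n)}`. -/
def IsTorsionFunction (D : TopologicalSpace.Opens (Eucl d)) (u : Eucl d → ℝ) : Prop :=
  ∀ᵐ x ∂((volume : Measure (Eucl d)).restrict D),
    Tendsto (fun n : ℕ => boundedInverse (negDirichletLaplacian D) (truncatedOne D n) x)
      atTop (𝓝 (u x : ℂ))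

end Dirichlet

end Torsion

/-! ### Numerical constants and the optimal splitting parameter. -/

namespace Torsion

/-! Write `R = H⁻¹` and `E₀ = inf σ(H)`. Formally `R = ∫₀^∞ e^{-tH} dt`, so the upper bound follows
from good bounds of `‖e^{-tH}‖_{∞→∞}`. Domination gives the bound `1` (`ae_norm_heat_le`), which
does not decay. Decay comes from `norm_gaussWeight_heat_le`: for `1/b - 1/a = 4t`, `‖e^{-a|·-x₀|²}
e^{-tH} f‖₂ ≤ e^{-E₀t} ‖e^{-b|·-x₀|²} f‖₂`.

This weighted estimate comes from complex analysis. After the substitution `z = 1/w` for the time,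
the form `⟨g, e^{-wα|x-x₀|²} e^{-H/w} e^{wβ|x-x₀|²} f⟩ e^{E₀/w}` is holomorphic on the right half
plane. It is at most `‖f‖‖g‖` near the imaginary axis, where the weights have modulus about one; it
has exponential type once the weights are truncated; and domination gives polynomial growth on the
positive axis. The Phragmén–Lindelöf principle removes all growth.

Split the time as `t = s + τ`. At a point `x`, the Gaussian kernel at time `s` is paired by
Cauchy–Schwarz with the weighted estimate centred at `x` for time `τ`. This is
`ae_norm_heat_le_exp`: a bound `A e^{-γt}` with `A = ((1+r)/2)^{d/2}` and `γ = E₀(1 - r⁻²)`.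
Integrating `min(1, A e^{-γt})` yields `(log A + 1)/γ` (`ae_norm_inverse_le`), and
`exists_torsion_parameter` picks `r`.

For the lower bound, a selfadjoint operator bounded by `C` on `L_∞` is bounded by `C` on `L_2`
(`opNorm_le_of_ae_norm_le`), and a Neumann series shows `E₀ ‖R‖ ≥ 1` (`one_le_bottomSpectrum_mul`).

For the Dirichlet Laplacian domination has to be proved. A smooth form of Kato's inequality
(`kato_inequality`) shows that the Gaussian averages of a convex function of `Re e^{-sH}f` decrease
when the Gaussian runs backwards in time (`re_inner_gaussL2_heat_le`). Rescaling the convex function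
to the positive part, shrinking the Gaussian to a point and rotating the phase give
`isHeatDominated_dirichlet`. Kato's inequality with weight `1` makes `R` positivity preserving, so
the approximants of the torsion function increase and converge. -/

theorem log_le_half_sub_inv {y : ℝ} (hy : 1 ≤ y) : Real.log y ≤ (y - y⁻¹) / 2 := by
  have h0 : 0 < y := by linarith
  have := Real.self_le_sinh_iff.2 (Real.log_nonneg hy)
  rwa [Real.sinh_log h0] at this

theorem cConst_lt : cConst < 0.61 := by
  have h := Real.log_two_lt_d9
  have h2 : Real.sqrt (5 * (1 + 1 / 4 * Real.log 2)) < 2.44 := by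
    rw [Real.sqrt_lt' (by norm_num)]
    linarith
  unfold cConst
  linarith

theorem le_cConst : Real.sqrt 5 / 4 ≤ cConst := by
  have h := Real.log_nonneg (x := 2) (by norm_num)
  have := Real.sqrt_le_sqrt (show (5:ℝ) ≤ 5 * (1 + 1 / 4 * Real.log 2) by linarith)
  unfold cConst
  linarith

theorem exists_torsion_parameter (d : ℕ) (hd : 1 ≤ d) :
    ∃ r : ℝ, 1 < r ∧
      ((d : ℝ) / 2 * Real.log ((1 + r) / 2) + 1) / (1 - (r ^ 2)⁻¹) ≤ torsionConst d := by
  have hd0 : (0 : ℝ) < d := by exact_mod_cast hd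
  have h5 : 0 < Real.sqrt 5 := by positivity
  have hs : 0 < Real.sqrt d := by positivity
  -- With `m = r² - 1` the estimates below lead to `d/8 + 5dm/64 + 1 + 1/m`. This `m` minimises the
  -- expression and gives `2√(5/64)·√d = (√5/4)√d` for the two middle contributions.
  set m : ℝ := 8 / (Real.sqrt 5 * Real.sqrt d) with hm
  have hm0 : 0 < m := by positivity
  refine ⟨Real.sqrt (1 + m), ?_, ?_⟩
  · rw [Real.lt_sqrt (by norm_num)]
    linarith
  set r := Real.sqrt (1 + m) with hr
  have hr2 : r ^ 2 = 1 + m := Real.sq_sqrt (by linarith)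
  have hr1 : 1 < r := by
    rw [hr, Real.lt_sqrt (by norm_num)]
    linarith
  have hlog := log_le_half_sub_inv (y := (1 + r) / 2) (by linarith)
  have hkey : ((1 + r) / 2 - ((1 + r) / 2)⁻¹) / 2 ≤ m * (5 * r ^ 2 + 3) / (32 * r ^ 2) := by
    have e : m = r ^ 2 - 1 := by linarith
    rw [e, inv_div, div_sub_div _ _ (by norm_num) (by positivity), div_div,
      div_le_div_iff₀ (by positivity) (by positivity)]
    -- After clearing denominators the difference of the two sides has the factor `(r-1)³(5r² + 12r
    -- + 3)`.
    have := mul_nonneg (sub_nonneg.2 hr1.le)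
      (mul_nonneg (sq_nonneg (r - 1)) (show 0 ≤ 5 * r ^ 2 + 12 * r + 3 by positivity))
    nlinarith
  have e1 : 1 - (r ^ 2)⁻¹ = m / (1 + m) := by
    rw [hr2]; field_simp; ring
  have hc := le_cConst
  have e2 : m * (Real.sqrt 5 * Real.sqrt d) = 8 := by rw [hm]; field_simp
  have hs2 : Real.sqrt d ^ 2 = d := Real.sq_sqrt hd0.le
  have h52 : Real.sqrt 5 ^ 2 = 5 := Real.sq_sqrt (by norm_num)
  rw [e1, div_le_iff₀ (by positivity)]
  have h3 : (d : ℝ) / 2 * Real.log ((1 + r) / 2) ≤ d / 2 * (m * (8 + 5 * m) / (32 * (1 + m))) := by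
    have : m * (5 * r ^ 2 + 3) / (32 * r ^ 2) = m * (8 + 5 * m) / (32 * (1 + m)) := by
      rw [hr2]; ring
    rw [← this]
    gcongr
    exact hlog.trans hkey
  have h4 : ((d : ℝ) / 8 + Real.sqrt 5 / 4 * Real.sqrt d + 1) * (m / (1 + m)) ≤
      torsionConst d * (m / (1 + m)) := by
    unfold torsionConst
    gcongr
  refine le_trans ?_ h4
  have h5' : (d : ℝ) / 2 * (m * (8 + 5 * m) / (32 * (1 + m))) + 1 =
      ((d : ℝ) / 8 + Real.sqrt 5 / 4 * Real.sqrt d + 1) * (m / (1 + m)) := by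
    have e3 : (d : ℝ) * m ^ 2 * 5 = 64 := by
      calc (d : ℝ) * m ^ 2 * 5 = (m * (Real.sqrt 5 * Real.sqrt d)) ^ 2 := by
            rw [mul_pow, mul_pow, h52, hs2]; ring
        _ = 64 := by rw [e2]; norm_num
    clear_value m
    have e4 : 1 + m ≠ 0 := by positivity
    field_simp
    linear_combination 32 * e3 - 512 * e2
  linarith

end Torsion

/-! ### The semigroup `e^{-zH}` through the functional calculus of the bounded operator `H⁻¹`. -/

namespace Torsion

section Heat

/-- The function `x ↦ e^{-z/x}`, extended by `0` at `x = 0`. -/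
noncomputable def heatFun (z x : ℂ) : ℂ := if x = 0 then 0 else Complex.exp (-z / x)

theorem norm_exp_neg_div (z : ℂ) (x : ℝ) :
    ‖Complex.exp (-z / x)‖ = Real.exp (-(z.re / x)) := by
  rw [Complex.norm_exp, Complex.div_ofReal_re, Complex.neg_re, neg_div]

theorem norm_heatFun_le {e x : ℝ} (he : 0 < e) (hx : x ∈ Set.Icc 0 e⁻¹) {z : ℂ} (hz : 0 ≤ z.re) :
    ‖heatFun z x‖ ≤ Real.exp (-(e * z.re)) := by
  unfold heatFun
  split_ifs with h
  · simp [Real.exp_nonneg]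
  · have hx0 : 0 < x := lt_of_le_of_ne hx.1 fun h' => h (by simp [← h'])
    rw [norm_exp_neg_div]
    gcongr
    rw [le_div_iff₀ hx0]
    have := mul_le_mul_of_nonneg_left hx.2 he.le
    rw [mul_inv_cancel₀ he.ne'] at this
    nlinarith

/-- The singularity at `0` is harmless along the nonnegative real axis, where `|e^{-z/x}| ≤ x / Re
z`. This is what lets the continuous functional calculus apply on a spectrum containing `0`. -/
theorem continuousOn_heatFun {z : ℂ} (hz : 0 < z.re) :
    ContinuousOn (heatFun z) ((fun x : ℝ => (x : ℂ)) '' Set.Ici 0) := by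
  rintro _ ⟨x, hx, rfl⟩
  rcases eq_or_lt_of_le (show 0 ≤ x from hx) with rfl | h0
  · have h1 : heatFun z ((0 : ℝ) : ℂ) = 0 := by simp [heatFun]
    change Tendsto _ _ _
    rw [h1]
    refine squeeze_zero_norm' (a := fun x : ℂ => ‖x‖ / z.re) ?_ ?_
    · filter_upwards [self_mem_nhdsWithin]
      rintro _ ⟨y, hy, rfl⟩
      unfold heatFun
      split_ifs with h
      · simp only [norm_zero]; positivity
      · have hy0 : 0 < y := lt_of_le_of_ne hy fun h' => h (by simp [← h'])
        rw [norm_exp_neg_div, Real.exp_neg, Complex.norm_real, Real.norm_of_nonneg hy0.le]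
        have := Real.add_one_le_exp (z.re / y)
        have h1 : 0 < z.re / y := by positivity
        exact (inv_anti₀ h1 (by linarith)).trans_eq (inv_div _ _)
    · refine Tendsto.mono_left ?_ nhdsWithin_le_nhds
      exact Continuous.tendsto' (by fun_prop) _ _ (by simp)
  · refine ContinuousAt.continuousWithinAt ?_
    have hne : (x : ℂ) ≠ 0 := by exact_mod_cast h0.ne'
    refine ContinuousAt.congr (f := fun x : ℂ => Complex.exp (-z / x)) (by fun_prop (disch := exact hne)) ?_
    filter_upwards [isOpen_ne.mem_nhds hne] with y hy
    simp [heatFun, show y ≠ 0 from hy]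

theorem heatFun_add (z w x : ℂ) : heatFun (z + w) x = heatFun z x * heatFun w x := by
  unfold heatFun
  split_ifs
  · simp
  · rw [← Complex.exp_add]; ring_nf

/-- Second-order Taylor remainder of `z ↦ x e^{-z/x}`, uniform in `x`: the second derivative `x⁻¹
e^{-z/x}` is bounded because the exponential beats `x⁻¹`. The condition on `h` leaves half of `Re z`
for this purpose. -/
theorem norm_heatFun_remainder_le {x : ℝ} (hx : 0 ≤ x) {z h : ℂ} (hz : 0 < z.re)
    (hh : ‖h‖ ≤ z.re / 2) :
    ‖heatFun (z + h) x * x - heatFun z x * x + h * heatFun z x‖ ≤ 2 / z.re * ‖h‖ ^ 2 := by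
  rcases eq_or_lt_of_le hx with rfl | hx0
  · simp only [heatFun, Complex.ofReal_zero, if_true, mul_zero, sub_zero, add_zero, norm_zero]
    positivity
  have hne : (x : ℂ) ≠ 0 := by exact_mod_cast hx0.ne'
  have h1 : heatFun (z + h) x * x - heatFun z x * x + h * heatFun z x =
      heatFun z x * x * (Complex.exp (-h / x) - 1 - -h / x) := by
    simp only [heatFun, if_neg hne, neg_add, add_div, Complex.exp_add]
    field_simp
    ring
  have h2 : ‖Complex.exp (-h / x) - 1 - -h / x‖ ≤ (‖h‖ / x) ^ 2 * Real.exp (z.re / 2 / x) := by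
    have := Complex.norm_exp_sub_sum_le_norm_mul_exp (-h / x) 2
    simp only [Finset.sum_range_succ, Finset.sum_range_zero] at this
    simp only [pow_zero, Nat.factorial, Nat.cast_one, div_one, zero_add, pow_one, mul_one,
      ← sub_sub] at this
    have e : ‖-h / (x : ℂ)‖ = ‖h‖ / x := by
      rw [norm_div, norm_neg, Complex.norm_real, Real.norm_of_nonneg hx0.le]
    rw [e] at this
    refine this.trans ?_
    gcongr
  have h3 : x⁻¹ * Real.exp (-(z.re / 2 / x)) ≤ 2 / z.re := by
    rw [Real.exp_neg, ← mul_inv, ← inv_div z.re 2]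
    gcongr
    have := Real.add_one_le_exp (z.re / 2 / x)
    calc z.re / 2 = x * (z.re / 2 / x) := by field_simp
      _ ≤ _ := by gcongr; linarith
  rw [h1, norm_mul, norm_mul, heatFun, if_neg hne, norm_exp_neg_div, Complex.norm_real,
    Real.norm_of_nonneg hx0.le]
  calc _ ≤ Real.exp (-(z.re / x)) * x * ((‖h‖ / x) ^ 2 * Real.exp (z.re / 2 / x)) := by gcongr
    _ = (x⁻¹ * (Real.exp (-(z.re / x)) * Real.exp (z.re / 2 / x))) * ‖h‖ ^ 2 := by
      field_simp
    _ = (x⁻¹ * Real.exp (-(z.re / 2 / x))) * ‖h‖ ^ 2 := by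
      rw [← Real.exp_add]; congr 3; ring
    _ ≤ _ := by gcongr

theorem norm_heatFun_mul_sub_le {x t : ℝ} (hx : 0 ≤ x) (ht : 0 < t) :
    ‖heatFun t x * x - x‖ ≤ t := by
  rcases eq_or_lt_of_le hx with rfl | hx0
  · simpa using ht.le
  have hne : (x : ℂ) ≠ 0 := by exact_mod_cast hx0.ne'
  have e : heatFun t x * x - x = ((x * (Real.exp (-t / x) - 1) : ℝ) : ℂ) := by
    simp only [heatFun, if_neg hne]
    push_cast
    ring
  rw [e, Complex.norm_real, Real.norm_eq_abs, abs_le]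
  have h1 := Real.add_one_le_exp (-t / x)
  have h2 : Real.exp (-t / x) ≤ 1 := Real.exp_le_one_iff.2 (by
    rw [neg_div]; exact neg_nonpos.2 (by positivity))
  have h3 : x * (-t / x) = -t := by field_simp
  constructor
  · calc -t = x * (-t / x) := h3.symm
      _ ≤ _ := by gcongr; linarith
  · nlinarith

variable {E : Type*} [NormedAddCommGroup E] [InnerProductSpace ℂ E] [CompleteSpace E]

/-- The operator `e^{-zH}`, expressed through the inverse `R = H⁻¹`. -/
noncomputable def heat (R : E →L[ℂ] E) (z : ℂ) : E →L[ℂ] E := cfc (heatFun z) R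

/-- `R` is the inverse of a selfadjoint operator with spectrum in `[e, ∞)`. -/
structure IsInverseAbove (R : E →L[ℂ] E) (e : ℝ) : Prop where
  pos : 0 < e
  selfAdjoint : IsSelfAdjoint R
  spectrum_subset : spectrum ℂ R ⊆ (fun x : ℝ => (x : ℂ)) '' Set.Icc 0 e⁻¹

namespace IsInverseAbove

variable {R : E →L[ℂ] E} {e : ℝ} (hR : IsInverseAbove R e)
include hR

theorem continuousOn_heatFun {z : ℂ} (hz : 0 < z.re) :
    ContinuousOn (heatFun z) (spectrum ℂ R) :=
  (Torsion.continuousOn_heatFun hz).mono (hR.spectrum_subset.trans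
    (Set.image_mono Set.Icc_subset_Ici_self))

theorem isStarNormal : IsStarNormal R := hR.selfAdjoint.isStarNormal

theorem norm_heat_le {z : ℂ} (hz : 0 ≤ z.re) : ‖heat R z‖ ≤ Real.exp (-(e * z.re)) := by
  refine norm_cfc_le (Real.exp_nonneg _) fun x hx => ?_
  obtain ⟨y, hy, rfl⟩ := hR.spectrum_subset hx
  exact norm_heatFun_le hR.pos hy hz

theorem heat_add {z w : ℂ} (hz : 0 < z.re) (hw : 0 < w.re) :
    heat R (z + w) = heat R z * heat R w := by
  unfold heat
  rw [← cfc_mul _ _ R (hR.continuousOn_heatFun hz) (hR.continuousOn_heatFun hw)]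
  congr 1
  ext x
  exact heatFun_add z w x

theorem continuousOn_heatFun_mul {z : ℂ} (hz : 0 < z.re) :
    ContinuousOn (fun x => heatFun z x * x) (spectrum ℂ R) :=
  (hR.continuousOn_heatFun hz).mul continuousOn_id

theorem heat_mul_eq {z : ℂ} (hz : 0 < z.re) :
    heat R z * R = cfc (fun x => heatFun z x * x) R := by
  have := hR.isStarNormal
  rw [cfc_mul _ (fun x => x) R (hR.continuousOn_heatFun hz) continuousOn_id, cfc_id' ℂ R]
  rfl

theorem commute (z : ℂ) : Commute (heat R z) R :=
  Commute.cfc (Commute.refl R) (by rw [hR.selfAdjoint.star_eq]; exact Commute.refl R) _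

theorem norm_heat_mul_sub_le {t : ℝ} (ht : 0 < t) : ‖heat R t * R - R‖ ≤ t := by
  have := hR.isStarNormal
  have hz : 0 < ((t : ℝ) : ℂ).re := by simpa using ht
  have e1 : heat R t * R - R = cfc (fun x => heatFun t x * x - x) R := by
    rw [cfc_sub _ (fun x => x) R (hR.continuousOn_heatFun_mul hz) continuousOn_id,
      ← hR.heat_mul_eq hz, cfc_id' ℂ R]
  rw [e1]
  refine norm_cfc_le ht.le fun x hx => ?_
  obtain ⟨y, hy, rfl⟩ := hR.spectrum_subset hx
  exact norm_heatFun_mul_sub_le hy.1 ht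

/-- The factor `R` cancels the unbounded `H` produced by differentiation, so the derivative exists
in operator norm and `H` itself never appears. -/
theorem hasDerivAt_heat_mul {z : ℂ} (hz : 0 < z.re) :
    HasDerivAt (fun z => heat R z * R) (-heat R z) z := by
  have := hR.isStarNormal
  rw [hasDerivAt_iff_isLittleO_nhds_zero]
  refine Asymptotics.IsBigO.trans_isLittleO (g := fun h : ℂ => ‖h‖ ^ 2) ?_ ?_
  · refine Asymptotics.IsBigO.of_bound (2 / z.re) ?_
    filter_upwards [Metric.ball_mem_nhds (0 : ℂ) (half_pos hz)] with h hh
    rw [mem_ball_zero_iff] at hh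
    have hzh : 0 < (z + h).re := by
      have := (abs_le.1 (Complex.abs_re_le_norm h)).1
      simp only [Complex.add_re]; linarith
    have e1 : heat R (z + h) * R - heat R z * R - h • -heat R z =
        cfc (fun x => heatFun (z + h) x * x - heatFun z x * x + h * heatFun z x) R := by
      rw [cfc_add R (fun x => heatFun (z + h) x * x - heatFun z x * x) (fun x => h * heatFun z x)
          ((hR.continuousOn_heatFun_mul hzh).sub (hR.continuousOn_heatFun_mul hz))
          (continuousOn_const.mul (hR.continuousOn_heatFun hz)),
        cfc_sub _ _ R (hR.continuousOn_heatFun_mul hzh) (hR.continuousOn_heatFun_mul hz),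
        cfc_const_mul _ _ R (hR.continuousOn_heatFun hz), ← hR.heat_mul_eq hz,
        ← hR.heat_mul_eq hzh, smul_neg, sub_neg_eq_add]
      rfl
    rw [e1, Real.norm_of_nonneg (by positivity)]
    refine norm_cfc_le (by positivity) fun x hx => ?_
    obtain ⟨y, hy, rfl⟩ := hR.spectrum_subset hx
    exact norm_heatFun_remainder_le hy.1 hz hh.le
  · simpa using (Asymptotics.isLittleO_norm_pow_id (E' := ℂ) one_lt_two)

/-- Up to sign, `e^{-zH}` is the complex derivative of the holomorphic map `z ↦ e^{-zH}R`, hence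
holomorphic itself. -/
theorem differentiableOn_heat : DifferentiableOn ℂ (heat R) {z | 0 < z.re} := by
  have ho : IsOpen {z : ℂ | 0 < z.re} := isOpen_lt continuous_const Complex.continuous_re
  have h1 : DifferentiableOn ℂ (fun z => heat R z * R) {z | 0 < z.re} := fun z hz =>
    (hR.hasDerivAt_heat_mul hz).differentiableAt.differentiableWithinAt
  refine ((h1.deriv ho).neg).congr fun z hz => ?_
  simp [(hR.hasDerivAt_heat_mul hz).deriv]

theorem hasDerivAt_heat_real {t : ℝ} (ht : 0 < t) (f : E) :
    HasDerivAt (fun t : ℝ => heat R t (R f)) (-heat R t f) t := by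
  have h := (hR.hasDerivAt_heat_mul (z := (t : ℂ)) (by simpa using ht)).scomp t
    Complex.ofRealCLM.hasDerivAt
  have := ((ContinuousLinearMap.apply ℂ E f).restrictScalars ℝ).hasFDerivAt.comp_hasDerivAt t h
  simpa [Function.comp_def] using this

theorem tendsto_heat_zero (f : E) :
    Tendsto (fun t : ℝ => heat R t (R f)) (𝓝[>] 0) (𝓝 (R f)) := by
  rw [tendsto_iff_norm_sub_tendsto_zero]
  refine squeeze_zero' (g := fun t => t * ‖f‖) (Eventually.of_forall fun _ => norm_nonneg _) ?_ ?_
  · filter_upwards [self_mem_nhdsWithin] with t ht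
    exact ((heat R t * R - R).le_opNorm f).trans (by gcongr; exact hR.norm_heat_mul_sub_le ht)
  · exact (Continuous.tendsto' (by fun_prop) _ _ (by simp)).mono_left nhdsWithin_le_nhds

end IsInverseAbove

end Heat
end Torsion

/-! ### Multiplication operators and elementary facts on `L_2`. -/

namespace Torsion

section Multiplication

open scoped BoundedContinuousFunction

variable {X : Type*} [TopologicalSpace X] [MeasurableSpace X] [OpensMeasurableSpace X]
  {μ : Measure X}

theorem memLp_mul_boundedContinuous (ψ : X →ᵇ ℂ) (f : Lp ℂ 2 μ) :
    MemLp (fun x => ψ x * f x) 2 μ :=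
  MemLp.of_le_mul (c := ‖ψ‖) (Lp.memLp f)
    (ψ.continuous.measurable.aestronglyMeasurable.mul (Lp.aestronglyMeasurable f))
    (Eventually.of_forall fun x => by
      rw [norm_mul]; gcongr; exact ψ.norm_coe_le_norm x)

/-- Multiplication by a bounded continuous function, as a bounded operator on `L_2`. -/
noncomputable def mulL2 (μ : Measure X) : (X →ᵇ ℂ) →L[ℂ] Lp ℂ 2 μ →L[ℂ] Lp ℂ 2 μ :=
  LinearMap.mkContinuous₂
    (LinearMap.mk₂ ℂ (fun ψ f => (memLp_mul_boundedContinuous (μ := μ) ψ f).toLp)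
      (fun ψ ψ' f => by
        rw [← MemLp.toLp_add]
        exact MemLp.toLp_congr _ _ (Eventually.of_forall fun x => by simp [add_mul]))
      (fun c ψ f => by
        rw [← MemLp.toLp_const_smul]
        exact MemLp.toLp_congr _ _ (Eventually.of_forall fun x => by simp [mul_assoc]))
      (fun ψ f f' => by
        rw [← MemLp.toLp_add]
        refine MemLp.toLp_congr _ _ ?_
        filter_upwards [Lp.coeFn_add f f'] with x hx
        simp only [hx, Pi.add_apply, mul_add])
      (fun c ψ f => by
        rw [← MemLp.toLp_const_smul]
        refine MemLp.toLp_congr _ _ ?_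
        filter_upwards [Lp.coeFn_smul c f] with x hx
        simp only [hx, Pi.smul_apply, smul_eq_mul]
        ring))
    1 (fun ψ f => by
      rw [one_mul]
      refine Lp.norm_le_mul_norm_of_ae_le_mul ?_
      filter_upwards [(memLp_mul_boundedContinuous (μ := μ) ψ f).coeFn_toLp] with x hx
      rw [LinearMap.mk₂_apply, hx, norm_mul]
      gcongr
      exact ψ.norm_coe_le_norm x)

theorem coeFn_mulL2 (ψ : X →ᵇ ℂ) (f : Lp ℂ 2 μ) :
    mulL2 μ ψ f =ᵐ[μ] fun x => ψ x * f x :=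
  (memLp_mul_boundedContinuous (μ := μ) ψ f).coeFn_toLp

theorem norm_mulL2_le {ψ : X →ᵇ ℂ} {C : ℝ} (h : ∀ x, ‖ψ x‖ ≤ C) (f : Lp ℂ 2 μ) :
    ‖mulL2 μ ψ f‖ ≤ C * ‖f‖ := by
  refine Lp.norm_le_mul_norm_of_ae_le_mul ?_
  filter_upwards [coeFn_mulL2 ψ f] with x hx
  rw [hx, norm_mul]
  gcongr
  exact h x

omit [MeasurableSpace X] [OpensMeasurableSpace X] in
-- Taking the exponential in the Banach algebra of bounded continuous functions makes `w ↦ e^{wφ}`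
-- holomorphic in norm; evaluation is a continuous ring homomorphism, so its values are the
-- pointwise exponentials.
theorem exp_apply_boundedContinuous (ψ : X →ᵇ ℂ) (x : X) :
    NormedSpace.exp ψ x = Complex.exp (ψ x) := by
  let ev : (X →ᵇ ℂ) →+* ℂ :=
    { toFun := fun ψ => ψ x, map_one' := rfl, map_mul' := fun _ _ => rfl, map_zero' := rfl
      map_add' := fun _ _ => rfl }
  have hev : Continuous ev := (BoundedContinuousFunction.evalCLM ℂ x : (X →ᵇ ℂ) →L[ℂ] ℂ).continuous
  have h := NormedSpace.map_exp_of_mem_ball (𝕂 := ℂ) ev hev ψ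
    ((NormedSpace.expSeries_radius_eq_top ℂ (X →ᵇ ℂ)).symm ▸ edist_lt_top _ _)
  rw [Complex.exp_eq_exp_ℂ]
  exact h

omit [TopologicalSpace X] [OpensMeasurableSpace X]

theorem norm_sq_eq_integral {E : Type*} [NormedAddCommGroup E]
    (f : Lp E 2 μ) : ‖f‖ ^ 2 = ∫ x, ‖f x‖ ^ 2 ∂μ := by
  have h0 : 0 ≤ ∫ x, ‖f x‖ ^ 2 ∂μ := integral_nonneg fun x => by positivity
  rw [Lp.norm_def, (Lp.memLp f).eLpNorm_eq_integral_rpow_norm (by norm_num) (by norm_num),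
    ENNReal.toReal_ofReal (by positivity)]
  simp only [ENNReal.toReal_ofNat, Real.rpow_ofNat]
  rw [← Real.rpow_natCast, ← Real.rpow_mul h0]
  norm_num

theorem integral_norm_mul_norm_le {E F : Type*} [NormedAddCommGroup E] [NormedAddCommGroup F]
    (f : Lp E 2 μ) (g : Lp F 2 μ) : ∫ x, ‖f x‖ * ‖g x‖ ∂μ ≤ ‖f‖ * ‖g‖ := by
  have e : ENNReal.ofReal 2 = 2 := by norm_num
  have h := integral_mul_le_Lp_mul_Lq_of_nonneg (μ := μ) (p := 2) (q := 2)
    (Real.HolderConjugate.two_two) (f := fun x => ‖f x‖) (g := fun x => ‖g x‖)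
    (Eventually.of_forall fun x => norm_nonneg _) (Eventually.of_forall fun x => norm_nonneg _)
    (by rw [e]; exact (Lp.memLp f).norm) (by rw [e]; exact (Lp.memLp g).norm)
  simp only [Real.rpow_ofNat, ← norm_sq_eq_integral, ← Real.sqrt_eq_rpow] at h
  rwa [Real.sqrt_sq (norm_nonneg _), Real.sqrt_sq (norm_nonneg _)] at h

theorem norm_sq_le_of_norm_sq_le {f : Lp ℂ 2 μ} {k : X → ℝ} (hk : Integrable k μ)
    (h : ∀ᵐ x ∂μ, ‖f x‖ ^ 2 ≤ k x) : ‖f‖ ^ 2 ≤ ∫ x, k x ∂μ := by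
  rw [norm_sq_eq_integral]
  exact integral_mono_ae ((memLp_two_iff_integrable_sq_norm (Lp.aestronglyMeasurable f)).1
    (Lp.memLp f)) hk h

theorem integrable_norm_sq {E : Type*} [NormedAddCommGroup E] (f : Lp E 2 μ) :
    Integrable (fun x => ‖f x‖ ^ 2) μ :=
  (memLp_two_iff_integrable_sq_norm (Lp.aestronglyMeasurable f)).1 (Lp.memLp f)

theorem tendsto_of_ae_tendsto {F : ℕ → Lp ℂ 2 μ} {f g : Lp ℂ 2 μ}
    (hb : ∀ n, ∀ᵐ x ∂μ, ‖F n x‖ ≤ ‖g x‖) (hfg : ∀ᵐ x ∂μ, ‖f x‖ ≤ ‖g x‖)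
    (h : ∀ᵐ x ∂μ, Tendsto (fun n => F n x) atTop (𝓝 (f x))) :
    Tendsto F atTop (𝓝 f) := by
  have h1 : Tendsto (fun n => ∫ x, ‖(F n - f) x‖ ^ 2 ∂μ) atTop (𝓝 (∫ _, (0 : ℝ) ∂μ)) := by
    refine tendsto_integral_of_dominated_convergence (fun x => 4 * ‖g x‖ ^ 2)
      (fun n => (Lp.aestronglyMeasurable _).norm.pow 2) ((integrable_norm_sq g).const_mul 4) ?_ ?_
    · intro n
      filter_upwards [hb n, hfg, Lp.coeFn_sub (F n) f] with x h1 h2 h3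
      rw [Real.norm_of_nonneg (by positivity), h3]
      have := norm_sub_le (F n x) (f x)
      have h4 : ‖(⇑(F n) - ⇑f) x‖ ≤ 2 * ‖g x‖ := by simp only [Pi.sub_apply]; linarith
      calc _ ≤ (2 * ‖g x‖) ^ 2 := by gcongr
        _ = _ := by ring
    · have h4 : ∀ᵐ x ∂μ, ∀ n, (F n - f) x = F n x - f x := ae_all_iff.2 fun n => Lp.coeFn_sub _ _
      filter_upwards [h, h4] with x h1 h4
      simp only [h4]
      have := ((h1.sub_const (f x)).norm).pow 2
      simpa using this
  simp only [← norm_sq_eq_integral, integral_zero] at h1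
  rw [tendsto_iff_norm_sub_tendsto_zero]
  have := h1.sqrt
  simpa [Real.sqrt_sq] using this

variable [TopologicalSpace X] [OpensMeasurableSpace X]

theorem tendsto_mulL2_one {χ : ℕ → X →ᵇ ℂ} (h1 : ∀ n x, ‖χ n x‖ ≤ 1)
    (h2 : ∀ x, Tendsto (fun n => χ n x) atTop (𝓝 1)) (f : Lp ℂ 2 μ) :
    Tendsto (fun n => mulL2 μ (χ n) f) atTop (𝓝 f) := by
  have h : ∀ᵐ x ∂μ, ∀ n, mulL2 μ (χ n) f x = χ n x * f x :=
    ae_all_iff.2 fun n => coeFn_mulL2 _ _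
  refine tendsto_of_ae_tendsto (g := f) (fun n => ?_) (Eventually.of_forall fun x => le_rfl) ?_
  · filter_upwards [h] with x hx
    rw [hx, norm_mul]
    exact mul_le_of_le_one_left (norm_nonneg _) (h1 n x)
  · filter_upwards [h] with x hx
    simpa [hx] using (h2 x).mul_const (f x)

end Multiplication

end Torsion

/-! ### Gaussian weights and the Phragmén–Lindelöf argument. -/

namespace Torsion

section Weighted

open scoped BoundedContinuousFunction

variable {d : ℕ}

/-- The Gauss–Weierstrass kernel. -/
noncomputable def gaussKernel (t : ℝ) (z : Eucl d) : ℝ :=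
  (4 * Real.pi * t) ^ (-(d : ℝ) / 2) * Real.exp (-‖z‖ ^ 2 / (4 * t))

theorem gaussKernel_nonneg {t : ℝ} (ht : 0 ≤ t) (z : Eucl d) : 0 ≤ gaussKernel t z := by
  unfold gaussKernel; positivity

@[fun_prop]
theorem continuous_gaussKernel (t : ℝ) : Continuous (gaussKernel t : Eucl d → ℝ) := by
  unfold gaussKernel; fun_prop

/-- `|e^{-tH} f| ≤ e^{tΔ} |f|` for all `t > 0`, where `R = H⁻¹`. -/
def IsHeatDominated {Ω : Set (Eucl d)} (R : L2 Ω →L[ℂ] L2 Ω) : Prop :=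
  ∀ t : ℝ, 0 < t → ∀ f : L2 Ω, ∀ᵐ x ∂((volume : Measure (Eucl d)).restrict Ω),
    ‖heat R t f x‖ ≤ ∫ y in Ω, gaussKernel t (x - y) * ‖f y‖

/-- The weight `e^{-a|x-x₀|²}` for `a ≥ 0` as a bounded continuous function. -/
noncomputable def gaussWeight (x₀ : Eucl d) (a : ℝ) : Eucl d →ᵇ ℂ :=
  BoundedContinuousFunction.ofNormedAddCommGroup
    -- Clamping `a` at `0` makes the function bounded for every real `a`.
    (fun x => ((Real.exp (-(max a 0) * ‖x - x₀‖ ^ 2) : ℝ) : ℂ)) (by fun_prop) 1 (fun x => by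
      rw [Complex.norm_real, Real.norm_of_nonneg (Real.exp_nonneg _), Real.exp_le_one_iff]
      exact mul_nonpos_of_nonpos_of_nonneg (by simp) (by positivity))

theorem gaussWeight_apply (x₀ : Eucl d) {a : ℝ} (ha : 0 ≤ a) (x : Eucl d) :
    gaussWeight x₀ a x = (Real.exp (-a * ‖x - x₀‖ ^ 2) : ℝ) := by
  simp [gaussWeight, max_eq_left ha]

/-- The function `min (|x-x₀|²) ρ²`. -/
noncomputable def truncSq (x₀ : Eucl d) (ρ : ℝ) : Eucl d →ᵇ ℂ :=
  BoundedContinuousFunction.ofNormedAddCommGroup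
    (fun x => ((min (‖x - x₀‖ ^ 2) (ρ ^ 2) : ℝ) : ℂ)) (by fun_prop) (ρ ^ 2) (fun x => by
      rw [Complex.norm_real, Real.norm_of_nonneg (le_min (by positivity) (by positivity))]
      exact min_le_right _ _)

theorem truncSq_apply (x₀ : Eucl d) (ρ : ℝ) (x : Eucl d) :
    truncSq x₀ ρ x = (min (‖x - x₀‖ ^ 2) (ρ ^ 2) : ℝ) := rfl

/-- A continuous cutoff function supported in the ball of radius `n + 1`. -/
noncomputable def cutoff (x₀ : Eucl d) (n : ℕ) : Eucl d →ᵇ ℂ :=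
  BoundedContinuousFunction.ofNormedAddCommGroup
    (fun x => ((max 0 (min 1 (n + 1 - ‖x - x₀‖)) : ℝ) : ℂ)) (by fun_prop) 1 (fun x => by
      rw [Complex.norm_real, Real.norm_of_nonneg (le_max_left _ _)]
      exact max_le zero_le_one (min_le_left _ _))

theorem cutoff_apply (x₀ : Eucl d) (n : ℕ) (x : Eucl d) :
    cutoff x₀ n x = (max 0 (min 1 (n + 1 - ‖x - x₀‖)) : ℝ) := rfl

theorem norm_cutoff_le (x₀ : Eucl d) (n : ℕ) (x : Eucl d) : ‖cutoff x₀ n x‖ ≤ 1 := by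
  rw [cutoff_apply, Complex.norm_real, Real.norm_of_nonneg (le_max_left _ _)]
  exact max_le zero_le_one (min_le_left _ _)

theorem cutoff_eq_zero {x₀ : Eucl d} {n : ℕ} {x : Eucl d} (h : n + 1 ≤ ‖x - x₀‖) :
    cutoff x₀ n x = 0 := by
  rw [cutoff_apply, max_eq_left]
  · simp
  · exact (min_le_right _ _).trans (by linarith)

theorem tendsto_cutoff (x₀ x : Eucl d) : Tendsto (fun n => cutoff x₀ n x) atTop (𝓝 1) := by
  refine tendsto_const_nhds.congr' ?_
  filter_upwards [eventually_ge_atTop ⌈‖x - x₀‖⌉₊] with n hn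
  have : ‖x - x₀‖ ≤ n := (Nat.le_ceil _).trans (by exact_mod_cast hn)
  rw [cutoff_apply, min_eq_left (by linarith)]
  simp

/-- The right side, minimised over `u`, equals `α/(1+4α) · ‖v‖²`, and the relation between `α` and
`β` says exactly `β = α/(1+4α)`. Thus the heat kernel absorbs the ratio of the two weights. -/
theorem gaussian_exponent_le {α β : ℝ} (hα : 0 < α) (hβ : 0 < β) (h : β⁻¹ - α⁻¹ = 4)
    (u v : Eucl d) : β * ‖v‖ ^ 2 ≤ α * ‖u‖ ^ 2 + ‖u - v‖ ^ 2 / 4 := by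
  have h1 : ‖v‖ ≤ ‖u‖ + ‖u - v‖ := by
    have := norm_sub_le u (u - v)
    simpa using this
  have e : β = α / (1 + 4 * α) := by
    field_simp at h ⊢
    linarith
  have h2 : ‖v‖ ^ 2 ≤ (‖u‖ + ‖u - v‖) ^ 2 := by gcongr
  rw [e, div_mul_eq_mul_div, div_le_iff₀ (by positivity)]
  have h3 := mul_le_mul_of_nonneg_left h2 hα.le
  nlinarith [sq_nonneg (4 * α * ‖u‖ - ‖u - v‖)]

variable {Ω : Set (Eucl d)} {R : L2 Ω →L[ℂ] L2 Ω} {e : ℝ}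

/-- The holomorphic function to which the Phragmén–Lindelöf principle is applied. -/
noncomputable def weightedForm (R : L2 Ω →L[ℂ] L2 Ω) (e α β : ℝ) (φ : Eucl d →ᵇ ℂ) (f g : L2 Ω)
    (w : ℂ) : ℂ :=
  inner ℂ g (mulL2 _ (NormedSpace.exp (w • ((-α : ℂ) • φ))) (heat R w⁻¹
    (mulL2 _ (NormedSpace.exp (w • ((β : ℂ) • φ))) f))) * Complex.exp (e * w⁻¹)

theorem inv_re_pos {w : ℂ} (hw : 0 < w.re) : 0 < (w⁻¹).re := by
  rw [Complex.inv_re]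
  have : w ≠ 0 := fun h => by simp [h] at hw
  exact div_pos hw (Complex.normSq_pos.2 this)

theorem differentiableOn_weightedForm (hR : IsInverseAbove R e) (α β : ℝ) (φ : Eucl d →ᵇ ℂ)
    (f g : L2 Ω) : DifferentiableOn ℂ (weightedForm R e α β φ f g) {w | 0 < w.re} := by
  intro w hw
  have hw0 : w ≠ 0 := fun h => by simp [h] at hw
  have hinv : DifferentiableAt ℂ (fun w : ℂ => w⁻¹) w := differentiableAt_inv hw0
  have ho : IsOpen {z : ℂ | 0 < z.re} := isOpen_lt continuous_const Complex.continuous_re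
  have h1 : DifferentiableAt ℂ (fun w : ℂ => heat R w⁻¹) w :=
    DifferentiableAt.comp w (hR.differentiableOn_heat.differentiableAt
      (ho.mem_nhds (inv_re_pos hw))) hinv
  have h2 : ∀ c : ℂ, DifferentiableAt ℂ (fun w : ℂ =>
      mulL2 ((volume : Measure (Eucl d)).restrict Ω) (NormedSpace.exp (w • (c • φ)))) w := fun c =>
    (mulL2 _).differentiableAt.comp w (hasDerivAt_exp_smul_const (c • φ) w).differentiableAt
  refine DifferentiableAt.differentiableWithinAt ?_
  refine DifferentiableAt.mul ?_ (by fun_prop)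
  exact (innerSL ℂ g).differentiableAt.comp w ((h2 _).clm_apply (h1.clm_apply
    ((h2 _).clm_apply (differentiableAt_const f))))

theorem norm_exp_smul_apply_le {c : ℝ} {φ : Eucl d →ᵇ ℂ} {r : Eucl d → ℝ} (hr : ∀ x, φ x = r x)
    (w : ℂ) (x : Eucl d) :
    ‖NormedSpace.exp (w • ((c : ℂ) • φ)) x‖ = Real.exp (w.re * c * r x) := by
  rw [exp_apply_boundedContinuous, Complex.norm_exp]
  simp [hr, mul_assoc]

/-- The spectral bound `e^{-e Re(1/w)}` cancels the factor `e^{e/w}`, and the truncation bounds the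
growing weight. What remains has exponential type and tends to `‖f‖‖g‖` as `Re w → 0`. -/
theorem norm_weightedForm_le (hR : IsInverseAbove R e) {α β : ℝ} (hα : 0 ≤ α) (hβ : 0 ≤ β)
    (x₀ : Eucl d) (ρ : ℝ) (f g : L2 Ω) {w : ℂ} (hw : 0 < w.re) :
    ‖weightedForm R e α β (truncSq x₀ ρ) f g w‖ ≤
      ‖f‖ * ‖g‖ * Real.exp (β * ρ ^ 2 * w.re) := by
  have h1 : ∀ h : L2 Ω, ‖mulL2 _ (NormedSpace.exp (w • ((-α : ℂ) • truncSq x₀ ρ))) h‖ ≤ 1 * ‖h‖ :=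
    norm_mulL2_le fun x => by
      rw [← Complex.ofReal_neg, norm_exp_smul_apply_le (truncSq_apply x₀ ρ), Real.exp_le_one_iff]
      refine mul_nonpos_of_nonpos_of_nonneg ?_ (le_min (by positivity) (by positivity))
      nlinarith
  have h2 : ‖mulL2 _ (NormedSpace.exp (w • ((β : ℂ) • truncSq x₀ ρ))) f‖ ≤
      Real.exp (β * ρ ^ 2 * w.re) * ‖f‖ :=
    norm_mulL2_le (fun x => by
      rw [norm_exp_smul_apply_le (truncSq_apply x₀ ρ)]
      have : min (‖x - x₀‖ ^ 2) (ρ ^ 2) ≤ ρ ^ 2 := min_le_right _ _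
      have h3 := mul_le_mul_of_nonneg_left this (mul_nonneg hw.le hβ)
      exact Real.exp_le_exp.2 (by linarith)) f
  have h3 := hR.norm_heat_le (inv_re_pos hw).le
  have h4 : ‖Complex.exp (e * w⁻¹)‖ = Real.exp (e * (w⁻¹).re) := by
    rw [Complex.norm_exp, Complex.re_ofReal_mul]
  unfold weightedForm
  rw [norm_mul, h4]
  calc _ ≤ ‖g‖ * (1 * (Real.exp (-(e * (w⁻¹).re)) * (Real.exp (β * ρ ^ 2 * w.re) * ‖f‖))) *
        Real.exp (e * (w⁻¹).re) := by
        gcongr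
        refine (norm_inner_le_norm _ _).trans ?_
        gcongr
        refine (h1 _).trans ?_
        gcongr
        refine (ContinuousLinearMap.le_opNorm _ _).trans ?_
        gcongr
    _ = ‖f‖ * ‖g‖ * Real.exp (β * ρ ^ 2 * w.re) *
        (Real.exp (-(e * (w⁻¹).re)) * Real.exp (e * (w⁻¹).re)) := by ring
    _ = _ := by rw [← Real.exp_add]; simp

theorem integrable_mulL2_cutoff (x₀ : Eucl d) (n : ℕ) (f : L2 Ω) :
    Integrable (fun y => ‖mulL2 _ (cutoff x₀ n) f y‖) (volume.restrict Ω) := by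
  have hc : HasCompactSupport (cutoff x₀ n) := by
    refine HasCompactSupport.intro (isCompact_closedBall x₀ (n + 1)) fun x hx => ?_
    rw [Metric.mem_closedBall, dist_eq_norm, not_le] at hx
    exact cutoff_eq_zero hx.le
  have h1 : MemLp (cutoff x₀ n) 2 (volume.restrict Ω) :=
    ((cutoff x₀ n).continuous.memLp_of_hasCompactSupport hc (μ := volume)).restrict Ω
  have h2 : Integrable (fun y => cutoff x₀ n y * f y) (volume.restrict Ω) :=
    MemLp.integrable_mul h1 (Lp.memLp f)
  exact (h2.congr (coeFn_mulL2 _ _).symm).norm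

/-- On the real axis, the domination by the free heat semigroup gives a polynomial bound. -/
theorem norm_weightedForm_real_le (hdom : IsHeatDominated R) {α β : ℝ} (hα : 0 < α)
    (hβ : 0 < β) (hαβ : β⁻¹ - α⁻¹ = 4) (x₀ : Eucl d) (n : ℕ) (f g : L2 Ω) {w : ℝ} (hw : 0 < w) :
    ‖weightedForm R e α β (truncSq x₀ (n + 1)) (mulL2 _ (cutoff x₀ n) f)
      (mulL2 _ (cutoff x₀ n) g) w‖ ≤
      (w / (4 * Real.pi)) ^ ((d : ℝ) / 2) * ((∫ y in Ω, ‖mulL2 _ (cutoff x₀ n) f y‖) *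
        ∫ y in Ω, ‖mulL2 _ (cutoff x₀ n) g y‖) * Real.exp (e * w⁻¹) := by
  set φ := truncSq x₀ ((n : ℝ) + 1) with hφ
  set F : L2 Ω := mulL2 _ (cutoff x₀ n) f with hF
  set G : L2 Ω := mulL2 _ (cutoff x₀ n) g with hG
  set A : L2 Ω := mulL2 _ (NormedSpace.exp ((w : ℂ) • ((β : ℂ) • φ))) F with hA
  set B : L2 Ω := heat R (w : ℂ)⁻¹ A with hB
  have hFi := integrable_mulL2_cutoff x₀ n f
  have hGi := integrable_mulL2_cutoff x₀ n g
  rw [← hF] at hFi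
  rw [← hG] at hGi
  -- The truncation of `|y - x₀|²` acts only where `‖y - x₀‖ > n + 1`, and there the cutoff
  -- vanishes; so the weights are true Gaussians on the supports.
  have hF0 : ∀ᵐ y ∂(volume.restrict Ω), ‖A y‖ = Real.exp (w * β * ‖y - x₀‖ ^ 2) * ‖F y‖ := by
    filter_upwards [coeFn_mulL2 (NormedSpace.exp ((w : ℂ) • ((β : ℂ) • φ))) F,
      coeFn_mulL2 (cutoff x₀ n) f] with y h1 h2
    rw [hA, h1, norm_mul, norm_exp_smul_apply_le (truncSq_apply x₀ _), Complex.ofReal_re]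
    rcases le_or_gt ((n : ℝ) + 1) ‖y - x₀‖ with h | h
    · rw [hF, h2, cutoff_eq_zero h]; simp
    · rw [min_eq_left (by gcongr)]
  have hBx := hdom w⁻¹ (inv_pos.2 hw) A
  set Q := (w / (4 * Real.pi)) ^ ((d : ℝ) / 2) * ∫ y in Ω, ‖F y‖ with hQ
  have hx : ∀ᵐ x ∂(volume.restrict Ω),
      ‖G x‖ * ‖mulL2 _ (NormedSpace.exp ((w : ℂ) • ((-α : ℂ) • φ))) B x‖ ≤ ‖G x‖ * Q := by
    filter_upwards [coeFn_mulL2 (NormedSpace.exp ((w : ℂ) • ((-α : ℂ) • φ))) B,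
      coeFn_mulL2 (cutoff x₀ n) g, hBx] with x h1 h2 h3
    rcases le_or_gt ((n : ℝ) + 1) ‖x - x₀‖ with h | h
    · rw [hG, h2, cutoff_eq_zero h]; simp
    refine mul_le_mul_of_nonneg_left ?_ (norm_nonneg _)
    rw [Complex.ofReal_inv] at h3
    rw [h1, norm_mul, ← Complex.ofReal_neg, norm_exp_smul_apply_le (truncSq_apply x₀ _),
      Complex.ofReal_re, min_eq_left (by gcongr)]
    refine (mul_le_mul_of_nonneg_left h3 (Real.exp_nonneg _)).trans ?_
    rw [hQ, ← integral_const_mul, ← integral_const_mul]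
    refine integral_mono_of_nonneg (Eventually.of_forall fun y => ?_) (hFi.const_mul _) ?_
    · have := gaussKernel_nonneg (inv_pos.2 hw).le (x - y)
      positivity
    filter_upwards [hF0] with y hy
    rw [hy, ← mul_assoc, ← mul_assoc]
    refine mul_le_mul_of_nonneg_right ?_ (norm_nonneg _)
    have hexp := gaussian_exponent_le hα hβ hαβ (x - x₀) (y - x₀)
    rw [sub_sub_sub_cancel_right] at hexp
    have e1 : (4 * Real.pi * w⁻¹) ^ (-(d : ℝ) / 2) = (w / (4 * Real.pi)) ^ ((d : ℝ) / 2) := by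
      rw [neg_div, Real.rpow_neg (by positivity), ← Real.inv_rpow (by positivity)]
      congr 1
      field_simp
    unfold gaussKernel
    rw [e1]
    calc _ = (w / (4 * Real.pi)) ^ ((d : ℝ) / 2) * (Real.exp (w * -α * ‖x - x₀‖ ^ 2) *
          Real.exp (-‖x - y‖ ^ 2 / (4 * w⁻¹)) * Real.exp (w * β * ‖y - x₀‖ ^ 2)) := by ring
      _ ≤ (w / (4 * Real.pi)) ^ ((d : ℝ) / 2) * 1 := by
        gcongr
        rw [← Real.exp_add, ← Real.exp_add, Real.exp_le_one_iff]
        have e2 : -‖x - y‖ ^ 2 / (4 * w⁻¹) = -(w * (‖x - y‖ ^ 2 / 4)) := by field_simp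
        rw [e2]
        have := mul_le_mul_of_nonneg_left hexp hw.le
        linarith
      _ = _ := mul_one _
  have hmain : ‖inner ℂ G (mulL2 _ (NormedSpace.exp ((w : ℂ) • ((-α : ℂ) • φ))) B)‖ ≤
      (∫ y in Ω, ‖G y‖) * Q := by
    rw [L2.inner_def, ← integral_mul_const]
    refine norm_integral_le_of_norm_le (hGi.mul_const Q) ?_
    filter_upwards [hx] with x h
    exact (norm_inner_le_norm _ _).trans h
  unfold weightedForm
  rw [norm_mul, Complex.norm_exp, ← Complex.ofReal_inv, ← Complex.ofReal_mul, Complex.ofReal_re]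
  gcongr
  rw [Complex.ofReal_inv]
  refine hmain.trans_eq ?_
  rw [hQ]
  ring

/-- Phragmén–Lindelöf in the right half plane: with exponential type, boundedness on the positive
axis and a bound on the imaginary axis, the latter bound holds throughout. The constant on the
positive axis may depend on `f`, `g` and the cutoff, since it does not enter the conclusion. -/
theorem norm_weightedForm_le_of_real (hR : IsInverseAbove R e) (hdom : IsHeatDominated R)
    {α β : ℝ} (hα : 0 < α) (hβ : 0 < β) (hαβ : β⁻¹ - α⁻¹ = 4) (x₀ : Eucl d) (n : ℕ)
    (f g : L2 Ω) {w : ℝ} (hw : 0 < w) :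
    ‖weightedForm R e α β (truncSq x₀ (n + 1)) (mulL2 _ (cutoff x₀ n) f)
      (mulL2 _ (cutoff x₀ n) g) w‖ ≤ ‖mulL2 _ (cutoff x₀ n) f‖ * ‖mulL2 _ (cutoff x₀ n) g‖ := by
  set M := (∫ y in Ω, ‖mulL2 _ (cutoff x₀ n) f y‖) *
        ∫ y in Ω, ‖mulL2 _ (cutoff x₀ n) g y‖ with hM
  have hreal := fun {w : ℝ} (hw : 0 < w) => norm_weightedForm_real_le (e := e) hdom hα hβ hαβ
    x₀ n f g hw
  rw [← hM] at hreal
  set F : L2 Ω := mulL2 _ (cutoff x₀ n) f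
  set G : L2 Ω := mulL2 _ (cutoff x₀ n) g
  have hbd := fun {w : ℂ} (hw : 0 < w.re) => norm_weightedForm_le hR hα.le hβ.le x₀ (n + 1) F G hw
  set Φ := weightedForm R e α β (truncSq x₀ (n + 1)) F G with hΦ
  have hdiff : DifferentiableOn ℂ Φ {w | 0 < w.re} := differentiableOn_weightedForm hR _ _ _ _ _
  set b := β * ((n : ℝ) + 1) ^ 2 with hb
  have hb0 : 0 < b := by positivity
  have key : ∀ η : ℝ, 0 < η → η < w →
      ‖Φ w‖ * Real.exp (-(η * w)) ≤ ‖F‖ * ‖G‖ * Real.exp (b * η) := by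
    intro η hη hηw
    -- The shift by `η` moves the closed half plane into the open one, where the form is controlled;
    -- the factor `e^{-ηw}` kills the polynomial growth on the real axis. Both disappear as `η → 0`.
    let Ψ : ℂ → ℂ := fun z => Φ (z + η) * Complex.exp (-η * (z + η))
    have hnorm : ∀ z : ℂ, ‖Ψ z‖ = ‖Φ (z + η)‖ * Real.exp (-(η * (z.re + η))) := fun z => by
      simp only [Ψ]
      rw [norm_mul, Complex.norm_exp]
      congr 2
      simp
    have hle : ∀ z : ℂ, 0 ≤ z.re → ‖Ψ z‖ ≤ ‖F‖ * ‖G‖ * Real.exp (b * (z.re + η)) := by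
      intro z hz
      rw [hnorm]
      have h1 : 0 < (z + η).re := by simp; linarith
      have h2 : Real.exp (-(η * (z.re + η))) ≤ 1 := Real.exp_le_one_iff.2 (by
        have : 0 ≤ η * (z.re + η) := by positivity
        linarith)
      refine (mul_le_of_le_one_right (norm_nonneg _) h2).trans ?_
      simpa using hbd h1
    have hPL := PhragmenLindelof.right_half_plane_of_bounded_on_real (f := Ψ)
      (C := ‖F‖ * ‖G‖ * Real.exp (b * η)) (z := ((w - η : ℝ) : ℂ)) ?_ ?_ ?_ ?_ ?_
    · rw [hnorm] at hPL
      simpa using hPL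
    · have h1 : DifferentiableOn ℂ Ψ {z | 0 ≤ z.re} := by
        refine DifferentiableOn.mul ?_ (by fun_prop)
        refine hdiff.comp (by fun_prop) fun z hz => ?_
        have : 0 ≤ z.re := hz
        simp; linarith
      refine DifferentiableOn.diffContOnCl (h1.mono ?_)
      exact closure_minimal (fun z (hz : 0 < z.re) => hz.le)
        (isClosed_le continuous_const Complex.continuous_re)
    · refine ⟨1, by norm_num, b, ?_⟩
      refine Asymptotics.IsBigO.of_bound (‖F‖ * ‖G‖ * Real.exp (b * η)) ?_
      refine Filter.mem_inf_of_right ?_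
      intro z hz
      have hz' : 0 < z.re := hz
      refine (hle z hz'.le).trans ?_
      rw [Real.norm_of_nonneg (Real.exp_nonneg _), Real.rpow_one, mul_assoc (‖F‖ * ‖G‖),
        ← Real.exp_add]
      gcongr
      have := Complex.re_le_norm z
      have := mul_le_mul_of_nonneg_left this hb0.le
      linarith
    · have ht : Tendsto (fun x : ℝ => ((4 * Real.pi)⁻¹ ^ ((d : ℝ) / 2) * M * Real.exp (e * η⁻¹)) *
          ((x + η) ^ ((d : ℝ) / 2) * Real.exp (-η * (x + η)))) atTop (𝓝 _) :=
        ((tendsto_rpow_mul_exp_neg_mul_atTop_nhds_zero ((d : ℝ) / 2) η hη).comp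
          (tendsto_atTop_add_const_right atTop η tendsto_id)).const_mul _
      refine ht.isBoundedUnder_le.mono_le ?_
      filter_upwards [eventually_ge_atTop 0] with x hx
      rw [hnorm, Complex.ofReal_re]
      have hxη : 0 < x + η := by linarith
      have h1 := hreal hxη
      rw [Complex.ofReal_add] at h1
      have hM0 : 0 ≤ M := by
        rw [hM]
        exact mul_nonneg (integral_nonneg fun _ => norm_nonneg _)
          (integral_nonneg fun _ => norm_nonneg _)
      have h2 : Real.exp (e * (x + η)⁻¹) ≤ Real.exp (e * η⁻¹) := by
        have := hR.pos
        gcongr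
        linarith
      calc _ ≤ ((x + η) / (4 * Real.pi)) ^ ((d : ℝ) / 2) * M * Real.exp (e * η⁻¹) *
            Real.exp (-(η * (x + η))) := by
            gcongr
            exact h1.trans (by gcongr)
        _ = _ := by
          rw [div_eq_mul_inv, Real.mul_rpow hxη.le (by positivity), neg_mul]
          ring
    · intro y
      refine (hle _ (by simp)).trans_eq ?_
      simp
    · simp only [Complex.ofReal_re]; linarith
  have h1 : Tendsto (fun η : ℝ => ‖Φ w‖ * Real.exp (-(η * w))) (𝓝[>] 0) (𝓝 ‖Φ w‖) :=
    (Continuous.tendsto' (by fun_prop) _ _ (by simp)).mono_left nhdsWithin_le_nhds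
  have h2 : Tendsto (fun η : ℝ => ‖F‖ * ‖G‖ * Real.exp (b * η)) (𝓝[>] 0) (𝓝 (‖F‖ * ‖G‖)) :=
    (Continuous.tendsto' (by fun_prop) _ _ (by simp)).mono_left nhdsWithin_le_nhds
  refine le_of_tendsto_of_tendsto h1 h2 ?_
  filter_upwards [Ioo_mem_nhdsGT hw] with η hη
  exact key η hη.1 hη.2

end Weighted

end Torsion

/-! ### The weighted `L_2` estimate with exponential decay. -/

namespace Torsion

section WeightedBound

open scoped BoundedContinuousFunction

variable {d : ℕ} {Ω : Set (Eucl d)} {R : L2 Ω →L[ℂ] L2 Ω} {e : ℝ}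

/-- At real `w` the growing weight undoes the Gaussian on the support of the cutoff. Hence a bound
with the growing weight next to `f` becomes a bound by the norm of `f` times a decaying Gaussian. -/
theorem mulL2_exp_truncSq_eq (x₀ : Eucl d) {b c : ℝ} (hb : 0 ≤ b) (w : ℝ) (hw : w * c = b) (n : ℕ)
    (f : L2 Ω) :
    mulL2 _ (NormedSpace.exp ((w : ℂ) • ((c : ℂ) • truncSq x₀ (n + 1))))
      (mulL2 _ (cutoff x₀ n) (mulL2 _ (gaussWeight x₀ b) f)) = mulL2 _ (cutoff x₀ n) f := by
  refine Lp.ext ?_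
  filter_upwards [coeFn_mulL2 (NormedSpace.exp ((w : ℂ) • ((c : ℂ) • truncSq x₀ (n + 1))))
      (mulL2 _ (cutoff x₀ n) (mulL2 _ (gaussWeight x₀ b) f)),
    coeFn_mulL2 (cutoff x₀ n) (mulL2 _ (gaussWeight x₀ b) f),
    coeFn_mulL2 (gaussWeight x₀ b) f, coeFn_mulL2 (cutoff x₀ n) f] with x h1 h2 h3 h4
  rw [h1, h2, h3, h4]
  rcases le_or_gt ((n : ℝ) + 1) ‖x - x₀‖ with hx | hx
  · rw [cutoff_eq_zero hx]; simp
  · have e2 : NormedSpace.exp ((w : ℂ) • ((c : ℂ) • truncSq x₀ (n + 1))) x *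
        gaussWeight x₀ b x = 1 := by
      rw [exp_apply_boundedContinuous, gaussWeight_apply x₀ hb, Complex.ofReal_exp,
        ← Complex.exp_add]
      simp only [BoundedContinuousFunction.coe_smul, smul_eq_mul, truncSq_apply,
        ← Complex.ofReal_mul, ← Complex.ofReal_add]
      rw [min_eq_left (by gcongr), ← mul_assoc, hw]
      simp
    linear_combination (cutoff x₀ n x * f x) * e2

theorem inner_cutoff_exp_truncSq_eq (x₀ : Eucl d) {a c : ℝ} (ha : 0 ≤ a) (w : ℝ) (hw : w * c = a)
    (n : ℕ) (g B : L2 Ω) :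
    inner ℂ (mulL2 _ (cutoff x₀ n) g)
      (mulL2 _ (NormedSpace.exp ((w : ℂ) • ((-c : ℂ) • truncSq x₀ (n + 1)))) B) =
      inner ℂ (mulL2 _ (cutoff x₀ n) g) (mulL2 _ (gaussWeight x₀ a) B) := by
  rw [L2.inner_def, L2.inner_def]
  refine integral_congr_ae ?_
  filter_upwards [coeFn_mulL2 (NormedSpace.exp ((w : ℂ) • ((-c : ℂ) • truncSq x₀ (n + 1)))) B,
    coeFn_mulL2 (gaussWeight x₀ a) B, coeFn_mulL2 (cutoff x₀ n) g] with x h1 h2 h3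
  rw [h1, h2, h3]
  rcases le_or_gt ((n : ℝ) + 1) ‖x - x₀‖ with hx | hx
  · rw [cutoff_eq_zero hx]; simp
  · congr 2
    rw [exp_apply_boundedContinuous, gaussWeight_apply x₀ ha, Complex.ofReal_exp]
    congr 1
    simp only [BoundedContinuousFunction.coe_smul, smul_eq_mul, truncSq_apply,
      ← Complex.ofReal_mul, ← Complex.ofReal_neg]
    rw [min_eq_left (by gcongr), ← hw]
    congr 1
    ring

theorem norm_inner_cutoff_heat_le (hR : IsInverseAbove R e) (hdom : IsHeatDominated R)
    (x₀ : Eucl d) {t a b : ℝ} (ht : 0 < t) (ha : 0 < a) (hb : 0 < b) (hab : b⁻¹ - a⁻¹ = 4 * t)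
    (n : ℕ) (f g : L2 Ω) :
    ‖inner ℂ (mulL2 _ (cutoff x₀ n) g)
      (mulL2 _ (gaussWeight x₀ a) (heat R t (mulL2 _ (cutoff x₀ n) f)))‖ ≤
      Real.exp (-(e * t)) * (‖mulL2 _ (gaussWeight x₀ b) f‖ * ‖g‖) := by
  -- The previous estimate is used at `w = 1/t` with `α = at`, `β = bt`; this scaling turns `b⁻¹ -
  -- a⁻¹ = 4t` into the time-free relation.
  have hα : 0 < a * t := by positivity
  have hβ : 0 < b * t := by positivity
  have hαβ : (b * t)⁻¹ - (a * t)⁻¹ = 4 := by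
    rw [mul_inv, mul_inv, ← sub_mul, hab, mul_assoc, mul_inv_cancel₀ ht.ne', mul_one]
  have h := norm_weightedForm_le_of_real hR hdom hα hβ hαβ x₀ n (mulL2 _ (gaussWeight x₀ b) f) g
    (inv_pos.2 ht)
  have hn1 : ∀ h : L2 Ω, ‖mulL2 _ (cutoff x₀ n) h‖ ≤ ‖h‖ := fun h => by
    simpa using norm_mulL2_le (norm_cutoff_le x₀ n) h
  have h3 : ‖mulL2 _ (cutoff x₀ n) (mulL2 _ (gaussWeight x₀ b) f)‖ * ‖mulL2 _ (cutoff x₀ n) g‖ ≤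
      ‖mulL2 _ (gaussWeight x₀ b) f‖ * ‖g‖ :=
    mul_le_mul (hn1 _) (hn1 _) (norm_nonneg _) (norm_nonneg _)
  rw [weightedForm, mulL2_exp_truncSq_eq x₀ hb.le t⁻¹ (by field_simp),
    inner_cutoff_exp_truncSq_eq x₀ ha.le t⁻¹ (by field_simp), norm_mul,
    ← Complex.ofReal_inv, inv_inv, Complex.norm_exp, ← Complex.ofReal_mul,
    Complex.ofReal_re] at h
  rw [Real.exp_neg, ← div_eq_inv_mul, le_div_iff₀ (Real.exp_pos _)]
  exact h.trans h3

/-- The Gaussian weighted `L_2` estimate with the decay rate `e`. -/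
theorem norm_gaussWeight_heat_le (hR : IsInverseAbove R e) (hdom : IsHeatDominated R)
    (x₀ : Eucl d) {t a b : ℝ} (ht : 0 < t) (ha : 0 < a) (hb : 0 < b) (hab : b⁻¹ - a⁻¹ = 4 * t)
    (f : L2 Ω) :
    ‖mulL2 _ (gaussWeight x₀ a) (heat R t f)‖ ≤
      Real.exp (-(e * t)) * ‖mulL2 _ (gaussWeight x₀ b) f‖ := by
  have hlim := fun h : L2 Ω => tendsto_mulL2_one (norm_cutoff_le x₀) (tendsto_cutoff x₀) h
  set h : L2 Ω := mulL2 _ (gaussWeight x₀ a) (heat R t f) with hh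
  -- The form is tested with `g = h` itself, so in the limit it becomes `‖h‖²` and one factor `‖h‖`
  -- cancels.
  have h1 : Tendsto (fun n => ‖inner ℂ (mulL2 _ (cutoff x₀ n) h)
      (mulL2 _ (gaussWeight x₀ a) (heat R t (mulL2 _ (cutoff x₀ n) f)))‖) atTop
      (𝓝 ‖inner ℂ h h‖) := by
    refine (Tendsto.inner (hlim h) ?_).norm
    exact ((mulL2 _ (gaussWeight x₀ a) ∘L heat R t).continuous.tendsto f).comp (hlim f)
  have h2 := le_of_tendsto' h1 fun n =>
    norm_inner_cutoff_heat_le hR hdom x₀ ht ha hb hab n f h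
  rw [inner_self_eq_norm_sq_to_K] at h2
  simp only [Complex.coe_algebraMap, norm_pow, Complex.norm_real, norm_norm] at h2
  rcases eq_or_lt_of_le (norm_nonneg h) with h0 | h0
  · rw [← h0]; positivity
  · rw [sq, ← mul_assoc] at h2
    exact le_of_mul_le_mul_right h2 h0

end WeightedBound

/-! ### From weighted `L_2` bounds to decay of `‖e^{-tH}‖_{∞→∞}`. -/

section Smoothing

variable {d : ℕ} {Ω : Set (Eucl d)} {R : L2 Ω →L[ℂ] L2 Ω} {e : ℝ}

theorem integral_gaussian (x₀ : Eucl d) {b : ℝ} (hb : 0 < b) :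
    ∫ y : Eucl d, Real.exp (-b * ‖y - x₀‖ ^ 2) = (Real.pi / b) ^ ((d : ℝ) / 2) := by
  rw [integral_sub_right_eq_self (fun y : Eucl d => Real.exp (-b * ‖y‖ ^ 2)) x₀,
    GaussianFourier.integral_rexp_neg_mul_sq_norm hb]
  simp

theorem integrable_gaussian (x₀ : Eucl d) {b : ℝ} (hb : 0 < b) :
    Integrable fun y : Eucl d => Real.exp (-b * ‖y - x₀‖ ^ 2) := by
  refine Integrable.comp_sub_right (f := fun y : Eucl d => Real.exp (-b * ‖y‖ ^ 2)) ?_ x₀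
  refine Integrable.of_integral_ne_zero ?_
  rw [GaussianFourier.integral_rexp_neg_mul_sq_norm hb]
  positivity

theorem gaussKernel_eq (t : ℝ) (x y : Eucl d) :
    gaussKernel t (x - y) = (4 * Real.pi * t) ^ (-(d : ℝ) / 2) *
      Real.exp (-(4 * t)⁻¹ * ‖y - x‖ ^ 2) := by
  unfold gaussKernel
  rw [norm_sub_rev]
  congr 2
  ring

theorem integrable_gaussKernel {t : ℝ} (ht : 0 < t) (x : Eucl d) :
    Integrable fun y => gaussKernel t (x - y) := by
  simp only [gaussKernel_eq]
  exact (integrable_gaussian x (by positivity)).const_mul _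

theorem integral_gaussKernel {t : ℝ} (ht : 0 < t) (x : Eucl d) :
    ∫ y, gaussKernel t (x - y) = 1 := by
  simp only [gaussKernel_eq]
  rw [integral_const_mul, integral_gaussian x (by positivity), neg_div,
    Real.rpow_neg (by positivity)]
  have : Real.pi / (4 * t)⁻¹ = 4 * Real.pi * t := by field_simp
  rw [this]
  exact inv_mul_cancel₀ (by positivity)

/-- `e^{-tH}` is a contraction for the `L_∞`-norm. -/
theorem ae_norm_heat_le (hdom : IsHeatDominated R) {t : ℝ} (ht : 0 < t) {f : L2 Ω} {C : ℝ}
    (hf : ∀ᵐ y ∂(volume.restrict Ω), ‖f y‖ ≤ C) :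
    ∀ᵐ x ∂(volume.restrict Ω), ‖heat R t f x‖ ≤ C := by
  rcases eq_or_ne (volume.restrict Ω) 0 with h0 | h0
  · simp [h0]
  have hC : 0 ≤ C := by
    have := ae_neBot.2 h0
    obtain ⟨y, hy⟩ := hf.exists
    exact (norm_nonneg _).trans hy
  filter_upwards [hdom t ht f] with x hx
  refine hx.trans ?_
  have hk := integrable_gaussKernel ht x
  calc _ ≤ ∫ y in Ω, gaussKernel t (x - y) * C := by
        refine integral_mono_of_nonneg (Eventually.of_forall fun y => ?_)
          (hk.restrict.mul_const C) ?_
        · exact mul_nonneg (gaussKernel_nonneg ht.le _) (norm_nonneg _)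
        · filter_upwards [hf] with y hy
          exact mul_le_mul_of_nonneg_left hy (gaussKernel_nonneg ht.le _)
    _ = (∫ y in Ω, gaussKernel t (x - y)) * C := integral_mul_const _ _
    _ ≤ (∫ y, gaussKernel t (x - y)) * C := by
        gcongr
        · exact Eventually.of_forall fun y => gaussKernel_nonneg ht.le (x - y)
        · exact Measure.restrict_le_self
    _ = C := by rw [integral_gaussKernel ht x, one_mul]

theorem norm_gaussWeight_le (x₀ : Eucl d) {b : ℝ} (hb : 0 < b) {f : L2 Ω}
    (hf : ∀ᵐ y ∂(volume.restrict Ω), ‖f y‖ ≤ 1) :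
    ‖mulL2 _ (gaussWeight x₀ b) f‖ ^ 2 ≤ (Real.pi / (2 * b)) ^ ((d : ℝ) / 2) := by
  have hi := integrable_gaussian x₀ (b := 2 * b) (by positivity)
  rw [← integral_gaussian x₀ (by positivity)]
  refine (norm_sq_le_of_norm_sq_le hi.restrict ?_).trans
    (setIntegral_le_integral hi (Eventually.of_forall fun y => Real.exp_nonneg _))
  filter_upwards [coeFn_mulL2 (gaussWeight x₀ b) f, hf] with y h1 h2
  rw [h1, norm_mul, gaussWeight_apply x₀ hb.le, Complex.norm_real,
    Real.norm_of_nonneg (Real.exp_nonneg _)]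
  calc _ ≤ (Real.exp (-b * ‖y - x₀‖ ^ 2) * 1) ^ 2 := by gcongr
    _ = _ := by rw [mul_one, ← Real.exp_nat_mul]; congr 1; push_cast; ring

/-- Cauchy–Schwarz for the free heat kernel against a Gaussian weight. -/
theorem integral_gaussKernel_mul_le (x : Eucl d) {s a c : ℝ} (hs : 0 < s) (ha : 0 < a) (hc : 0 < c)
    (hac : a + c = (4 * s)⁻¹) (h : L2 Ω) :
    ∫ y in Ω, gaussKernel s (x - y) * ‖h y‖ ≤
      Real.sqrt (((4 * Real.pi * s) ^ (-(d : ℝ) / 2)) ^ 2 * (Real.pi / (2 * c)) ^ ((d : ℝ) / 2)) *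
        ‖mulL2 _ (gaussWeight x a) h‖ := by
  set A := (4 * Real.pi * s) ^ (-(d : ℝ) / 2) with hA
  -- The exponent `1/(4s)` of the kernel is shared out: the part `c` stays in `P`, the part `a`
  -- becomes the weight on `h`.
  let P : Eucl d → ℝ := fun y => A * Real.exp (-c * ‖y - x‖ ^ 2)
  have hi := integrable_gaussian x (b := 2 * c) (by positivity)
  have hP2 : ∀ y, ‖P y‖ ^ 2 = A ^ 2 * Real.exp (-(2 * c) * ‖y - x‖ ^ 2) := fun y => by
    simp only [P]
    rw [norm_mul, mul_pow, Real.norm_eq_abs, Real.norm_eq_abs, sq_abs, sq_abs, ← Real.exp_nat_mul]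
    congr 2
    push_cast
    ring
  have hPL : MemLp P 2 (volume.restrict Ω) := by
    have hm : AEStronglyMeasurable P (volume.restrict Ω) :=
      Continuous.aestronglyMeasurable (by fun_prop)
    rw [memLp_two_iff_integrable_sq_norm hm]
    simp only [hP2]
    exact (hi.const_mul _).restrict
  have hPn : ‖hPL.toLp P‖ ≤ Real.sqrt (A ^ 2 * (Real.pi / (2 * c)) ^ ((d : ℝ) / 2)) := by
    refine Real.le_sqrt_of_sq_le ?_
    rw [norm_sq_eq_integral, ← integral_gaussian x (by positivity), ← integral_const_mul]
    refine (integral_congr_ae ?_).trans_le (setIntegral_le_integral (hi.const_mul (A ^ 2))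
      (Eventually.of_forall fun y => by positivity))
    filter_upwards [hPL.coeFn_toLp] with y hy
    rw [hy, hP2]
  calc ∫ y in Ω, gaussKernel s (x - y) * ‖h y‖
      = ∫ y in Ω, ‖hPL.toLp P y‖ * ‖mulL2 _ (gaussWeight x a) h y‖ := by
        refine integral_congr_ae ?_
        filter_upwards [hPL.coeFn_toLp, coeFn_mulL2 (gaussWeight x a) h] with y h1 h2
        rw [h1, h2, norm_mul (gaussWeight x a y), gaussWeight_apply x ha.le, Complex.norm_real,
          Real.norm_of_nonneg (Real.exp_nonneg _), gaussKernel_eq,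
          Real.norm_of_nonneg (show 0 ≤ P y by positivity), ← hac]
        simp only [P]
        rw [show -(a + c) * ‖y - x‖ ^ 2 = -c * ‖y - x‖ ^ 2 + -a * ‖y - x‖ ^ 2 by ring,
          Real.exp_add]
        ring
    _ ≤ ‖hPL.toLp P‖ * ‖mulL2 _ (gaussWeight x a) h‖ := integral_norm_mul_norm_le _ _
    _ ≤ _ := by gcongr

/-- The bound of `‖e^{-tH}‖_{∞→∞}` with exponential decay. -/
theorem ae_norm_heat_le_exp (hR : IsInverseAbove R e) (hdom : IsHeatDominated R) {r t : ℝ}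
    (hr : 1 < r) (ht : 0 < t) {f : L2 Ω} (hf : ∀ᵐ y ∂(volume.restrict Ω), ‖f y‖ ≤ 1) :
    ∀ᵐ x ∂(volume.restrict Ω), ‖heat R t f x‖ ≤
      ((1 + r) / 2) ^ ((d : ℝ) / 2) * Real.exp (-(e * (t * (1 - (r ^ 2)⁻¹)))) := by
  have hr0 : 0 < r := by linarith
  -- Time `s` is spent on the pointwise bound by the free kernel, the remaining `τ = s(r² - 1)` on
  -- the decay.
  obtain ⟨s, hs, rfl⟩ : ∃ s, 0 < s ∧ t = s * r ^ 2 := ⟨t / r ^ 2, by positivity, by field_simp⟩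
  set τ := s * (r ^ 2 - 1) with hτ
  have hr2 : 0 < r ^ 2 - 1 := by nlinarith
  have hτ0 : 0 < τ := by positivity
  have e1 : s * r ^ 2 * (1 - (r ^ 2)⁻¹) = τ := by rw [hτ]; field_simp
  have e2 : ((s * r ^ 2 : ℝ) : ℂ) = (s : ℂ) + (τ : ℂ) := by rw [hτ]; push_cast; ring
  rw [e1, e2, hR.heat_add (by simpa using hs) (by simpa using hτ0)]
  -- Subject to `a + c = 1/(4s)` and `b⁻¹ - a⁻¹ = 4τ`, this `a` minimises `1/(bc)`, on which the
  -- final prefactor depends.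
  set a := (4 * s * (1 + r))⁻¹ with ha
  set b := (4 * s * r * (r + 1))⁻¹ with hb
  set c := r / (4 * s * (1 + r)) with hc
  have ha0 : 0 < a := by positivity
  have hb0 : 0 < b := by positivity
  have hc0 : 0 < c := by positivity
  have hab : b⁻¹ - a⁻¹ = 4 * τ := by rw [hb, ha, inv_inv, inv_inv, hτ]; ring
  have hac : a + c = (4 * s)⁻¹ := by rw [ha, hc]; field_simp
  filter_upwards [hdom s hs (heat R τ f)] with x hx
  refine hx.trans ((integral_gaussKernel_mul_le x hs ha0 hc0 hac _).trans ?_)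
  have h1 := norm_gaussWeight_heat_le hR hdom x hτ0 ha0 hb0 hab f
  have h2 := Real.le_sqrt_of_sq_le (norm_gaussWeight_le x hb0 hf)
  refine (mul_le_mul_of_nonneg_left (h1.trans (mul_le_mul_of_nonneg_left h2
    (Real.exp_nonneg _))) (Real.sqrt_nonneg _)).trans_eq ?_
  rw [mul_left_comm, mul_comm, ← Real.sqrt_mul (by positivity)]
  congr 1
  rw [Real.sqrt_eq_iff_mul_self_eq (by positivity) (by positivity), ← Real.rpow_natCast,
    ← Real.rpow_mul (by positivity), mul_assoc, ← Real.mul_rpow (by positivity) (by positivity)]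
  have e3 : Real.pi / (2 * c) * (Real.pi / (2 * b)) = (2 * Real.pi * s * (1 + r)) ^ (2 : ℝ) := by
    rw [hc, hb, Real.rpow_two]; field_simp; ring
  have e4 : (2 : ℝ) * ((d : ℝ) / 2) = d := by ring
  have e5 : -(d : ℝ) / 2 * ((2 : ℕ) : ℝ) = -d := by push_cast; ring
  rw [e3, ← Real.rpow_mul (by positivity), e4, e5, ← Real.mul_rpow (by positivity) (by positivity),
    Real.rpow_neg (by positivity), ← Real.inv_rpow (by positivity),
    ← Real.mul_rpow (by positivity) (by positivity),
    show (1 + r) / 2 * ((1 + r) / 2) = ((1 + r) / 2) ^ (2 : ℝ) by rw [Real.rpow_two]; ring,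
    ← Real.rpow_mul (by positivity), e4]
  congr 1
  field_simp
  norm_num

end Smoothing

end Torsion

/-! ### `L_1`–`L_∞` duality and the bound of `H⁻¹` on `L_∞`. -/

namespace Torsion

section Duality

/-- Testing with `h` cut down to `A = {‖h‖ > C}` gives `∫_A ‖h‖(‖h‖ - C) ≤ 0`, so `A` is null. The
test function is integrable because `‖h‖ ≤ ‖h‖²/C` on `A`. -/
theorem ae_norm_le_of_norm_inner_le {X : Type*} [MeasurableSpace X] {μ : Measure X}
    {h : Lp ℂ 2 μ} {C : ℝ} (hC : 0 < C)
    (H : ∀ g : Lp ℂ 2 μ, Integrable (fun x => ‖g x‖) μ →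
      ‖inner ℂ g h‖ ≤ C * ∫ x, ‖g x‖ ∂μ) : ∀ᵐ x ∂μ, ‖h x‖ ≤ C := by
  set A : Set X := {x | C < ‖h x‖} with hA
  have hAm : MeasurableSet A :=
    measurableSet_lt measurable_const (Lp.stronglyMeasurable h).norm.measurable
  have hgL : MemLp (A.indicator h) 2 μ := (Lp.memLp h).indicator hAm
  have hh2 := integrable_norm_sq h
  have hh1 : Integrable (A.indicator fun x => ‖h x‖) μ := by
    refine Integrable.mono' (hh2.const_mul C⁻¹)
      ((Lp.aestronglyMeasurable h).norm.indicator hAm) (Eventually.of_forall fun x => ?_)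
    by_cases hx : x ∈ A
    · have hx' : C < ‖h x‖ := hx
      rw [Set.indicator_of_mem hx, norm_norm, ← div_eq_inv_mul, le_div_iff₀ hC]
      nlinarith
    · rw [Set.indicator_of_notMem hx, norm_zero]; positivity
  have hgn : (fun x => ‖hgL.toLp _ x‖) =ᵐ[μ] A.indicator fun x => ‖h x‖ := by
    filter_upwards [hgL.coeFn_toLp] with x hx
    rw [hx, norm_indicator_eq_indicator_norm]
  have h1 := H (hgL.toLp _) (hh1.congr hgn.symm)
  have h2 : inner ℂ (hgL.toLp _) h = ((∫ x, A.indicator (fun x => ‖h x‖ ^ 2) x ∂μ : ℝ) : ℂ) := by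
    rw [L2.inner_def, ← integral_complex_ofReal]
    refine integral_congr_ae ?_
    filter_upwards [hgL.coeFn_toLp] with x hx
    rw [hx]
    by_cases hxA : x ∈ A
    · rw [Set.indicator_of_mem hxA, Set.indicator_of_mem hxA, inner_self_eq_norm_sq_to_K]
      simp
    · rw [Set.indicator_of_notMem hxA, Set.indicator_of_notMem hxA]
      simp
  rw [h2, Complex.norm_real, integral_congr_ae hgn] at h1
  have h3 : ∫ x, (A.indicator (fun x => ‖h x‖ ^ 2) x - C * A.indicator (fun x => ‖h x‖) x) ∂μ
      ≤ 0 := by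
    rw [integral_sub (hh2.indicator hAm) (hh1.const_mul C), integral_const_mul]
    linarith [Real.le_norm_self (∫ x, A.indicator (fun x => ‖h x‖ ^ 2) x ∂μ)]
  have h4 : ∀ x, 0 ≤ A.indicator (fun x => ‖h x‖ ^ 2) x - C * A.indicator (fun x => ‖h x‖) x := by
    intro x
    by_cases hxA : x ∈ A
    · have hx' : C < ‖h x‖ := hxA
      rw [Set.indicator_of_mem hxA, Set.indicator_of_mem hxA]
      nlinarith
    · rw [Set.indicator_of_notMem hxA, Set.indicator_of_notMem hxA]
      simp
  have h5 := (integral_eq_zero_iff_of_nonneg h4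
    ((hh2.indicator hAm).sub (hh1.const_mul C))).1 (le_antisymm h3 (integral_nonneg h4))
  filter_upwards [h5] with x hx
  by_contra hxA
  have hx' : C < ‖h x‖ := not_le.1 hxA
  rw [Set.indicator_of_mem (show x ∈ A from hx'), Set.indicator_of_mem (show x ∈ A from hx')] at hx
  simp only [Pi.zero_apply] at hx
  nlinarith

theorem norm_inner_le_of_ae_norm_le {X : Type*} [MeasurableSpace X] {μ : Measure X}
    {g h : Lp ℂ 2 μ} {C : ℝ} (hg : Integrable (fun x => ‖g x‖) μ) (hh : ∀ᵐ x ∂μ, ‖h x‖ ≤ C) :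
    ‖inner ℂ g h‖ ≤ C * ∫ x, ‖g x‖ ∂μ := by
  rw [L2.inner_def, mul_comm, ← integral_mul_const]
  refine norm_integral_le_of_norm_le (hg.mul_const C) ?_
  filter_upwards [hh] with x hx
  exact (norm_inner_le_norm _ _).trans (by gcongr)

end Duality

section ResolventBound

variable {d : ℕ} {Ω : Set (Eucl d)} {R : L2 Ω →L[ℂ] L2 Ω} {e : ℝ}

/-- The upper bound for `‖H⁻¹‖_{∞→∞}`. -/
theorem ae_norm_inverse_le (hd : 1 ≤ d) (hR : IsInverseAbove R e) (hdom : IsHeatDominated R)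
    {f : L2 Ω} (hf : ∀ᵐ y ∂(volume.restrict Ω), ‖f y‖ ≤ 1) :
    ∀ᵐ x ∂(volume.restrict Ω), ‖R f x‖ ≤ torsionConst d / e := by
  obtain ⟨r, hr, hle⟩ := exists_torsion_parameter d hd
  have he := hR.pos
  set A := ((1 + r) / 2) ^ ((d : ℝ) / 2) with hA
  have hr2 : 0 < 1 - (r ^ 2)⁻¹ := by
    have : (r ^ 2)⁻¹ < 1 := inv_lt_one_of_one_lt₀ (by nlinarith)
    linarith
  set γ := e * (1 - (r ^ 2)⁻¹) with hγ
  have hγ0 : 0 < γ := by positivity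
  have hA1 : 1 < A := Real.one_lt_rpow (by linarith) (by
    have : (0 : ℝ) < d := by exact_mod_cast hd
    positivity)
  have hA0 : 0 < A := by linarith
  -- The crossing point of the two bounds: `A e^{-γτ} = 1`.
  set τ := Real.log A / γ with hτ
  have hτ0 : 0 < τ := div_pos (Real.log_pos hA1) hγ0
  -- The tail `∫_t^∞ A e^{-γs} ds`, equal to `1/γ` at `t = τ`.
  let B : ℝ → ℝ := fun t => A * Real.exp (-(γ * t)) / γ
  have hBτ : τ + B τ ≤ torsionConst d / e := by
    have h1 : γ * τ = Real.log A := by rw [hτ]; field_simp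
    have h2 : B τ = 1 / γ := by
      simp only [B]
      rw [h1, Real.exp_neg, Real.exp_log hA0, mul_inv_cancel₀ hA0.ne']
    rw [h2, hτ, ← add_div, hγ, hA, Real.log_rpow (by linarith), le_div_iff₀ he]
    refine le_trans (le_of_eq ?_) hle
    field_simp
  have hτB : 0 < τ + B τ := by positivity
  suffices h : ∀ᵐ x ∂(volume.restrict Ω), ‖R f x‖ ≤ τ + B τ by
    filter_upwards [h] with x hx using hx.trans hBτ
  refine ae_norm_le_of_norm_inner_le hτB fun g hg => ?_
  set M := ∫ y in Ω, ‖g y‖ with hM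
  have hM0 : 0 ≤ M := integral_nonneg fun _ => norm_nonneg _
  -- `φ` runs from `⟨g, Rf⟩` at `0` to `0` at infinity with derivative `-⟨g, e^{-tH}f⟩`. Mean value
  -- inequalities on both sides of `τ` therefore replace the integral `∫₀^∞ e^{-tH}f dt`.
  let φ : ℝ → ℂ := fun t => inner ℂ g (heat R t (R f))
  have hφ : ∀ t : ℝ, 0 < t → HasDerivAt φ (inner ℂ g (-heat R t f)) t := fun t ht =>
    ((innerSL ℂ g).restrictScalars ℝ).hasFDerivAt.comp_hasDerivAt t (hR.hasDerivAt_heat_real ht f)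
  have hd1 : ∀ t : ℝ, 0 < t → ‖inner ℂ g (-heat R t f)‖ ≤ M := fun t ht => by
    rw [inner_neg_right, norm_neg]
    simpa using norm_inner_le_of_ae_norm_le hg (ae_norm_heat_le hdom ht hf)
  have hd2 : ∀ t : ℝ, 0 < t → ‖inner ℂ g (-heat R t f)‖ ≤ A * Real.exp (-(γ * t)) * M := fun t ht => by
    rw [inner_neg_right, norm_neg]
    refine norm_inner_le_of_ae_norm_le hg ?_
    filter_upwards [ae_norm_heat_le_exp hR hdom hr ht hf] with x hx
    refine hx.trans_eq ?_
    rw [hγ]; congr 3; ring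
  have hsmall : ∀ s, 0 < s → s < τ → ‖φ s‖ ≤ M * τ + ‖φ τ‖ := by
    intro s hs hsτ
    have h := (convex_Icc s τ).norm_image_sub_le_of_norm_hasDerivWithin_le (f := φ)
      (fun t ht => (hφ t (hs.trans_le ht.1)).hasDerivWithinAt)
      (fun t ht => hd1 t (hs.trans_le ht.1)) (Set.left_mem_Icc.2 hsτ.le)
      (Set.right_mem_Icc.2 hsτ.le)
    have h2 : ‖τ - s‖ ≤ τ := by rw [Real.norm_of_nonneg (by linarith)]; linarith
    have h3 := norm_sub_norm_le (φ s) (φ τ)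
    rw [norm_sub_rev] at h3
    have h4 := mul_le_mul_of_nonneg_left h2 hM0
    linarith
  have hlarge : ∀ t, τ < t → ‖φ τ‖ ≤ M * B τ + ‖φ t‖ := by
    intro t ht
    have hBd : ∀ x, HasDerivAt (fun x => M * (B τ - B x)) (A * Real.exp (-(γ * x)) * M) x := by
      intro x
      have h1 : HasDerivAt (fun x => Real.exp (-(γ * x))) (Real.exp (-(γ * x)) * -(γ * 1)) x :=
        (((hasDerivAt_id x).const_mul γ).neg).exp
      refine ((((h1.const_mul A).div_const γ).const_sub (B τ)).const_mul M).congr_deriv ?_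
      field_simp
    have h := image_norm_le_of_norm_deriv_right_le_deriv_boundary (f := fun x => φ x - φ τ)
      (f' := fun x => inner ℂ g (-heat R x f)) (a := τ) (b := t)
      (fun x hx => ((hφ x (hτ0.trans_le hx.1)).sub_const _).continuousAt.continuousWithinAt)
      (fun x hx => ((hφ x (hτ0.trans_le hx.1)).sub_const _).hasDerivWithinAt)
      (by simp) hBd (fun x hx => hd2 x (hτ0.trans_le hx.1)) (Set.right_mem_Icc.2 ht.le)
    have h3 := norm_sub_norm_le (φ τ) (φ t)
    rw [norm_sub_rev] at h3
    have h4 : 0 ≤ M * B t := by positivity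
    simp only [mul_sub] at h
    linarith
  have hlim0 : Tendsto (fun s => ‖φ s‖) (𝓝[>] 0) (𝓝 ‖inner ℂ g (R f)‖) :=
    (((innerSL ℂ g).continuous.tendsto _).comp (hR.tendsto_heat_zero f)).norm
  have hliminf : Tendsto (fun t => ‖φ t‖) atTop (𝓝 0) := by
    refine squeeze_zero' (Eventually.of_forall fun t => norm_nonneg _)
      (g := fun t => ‖g‖ * (Real.exp (-(e * t)) * ‖R f‖)) ?_ ?_
    · filter_upwards [eventually_gt_atTop 0] with t ht
      refine (norm_inner_le_norm _ _).trans ?_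
      gcongr
      refine (ContinuousLinearMap.le_opNorm _ _).trans ?_
      gcongr
      simpa using hR.norm_heat_le (z := t) (by simpa using ht.le)
    · have : Tendsto (fun t : ℝ => Real.exp (-(e * t))) atTop (𝓝 0) :=
        Real.tendsto_exp_neg_atTop_nhds_zero.comp (tendsto_id.const_mul_atTop he)
      simpa using (this.mul_const ‖R f‖).const_mul ‖g‖
  have h1 : ‖φ τ‖ ≤ M * B τ := by
    have := ge_of_tendsto (hliminf.const_add (M * B τ))
      ((eventually_gt_atTop τ).mono fun t ht => hlarge t ht)
    simpa using this
  have h2 : ‖inner ℂ g (R f)‖ ≤ M * τ + ‖φ τ‖ :=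
    le_of_tendsto hlim0 (by
      filter_upwards [Ioo_mem_nhdsGT hτ0] with s hs using hsmall s hs.1 hs.2)
  calc _ ≤ M * τ + M * B τ := by linarith
    _ = _ := by ring

end ResolventBound

end Torsion

/-! ### Resolvents, the inverse, and the spectrum. -/

namespace Torsion

section Resolvents

variable {E : Type*} [NormedAddCommGroup E] [NormedSpace ℂ E] {H : E →ₗ.[ℂ] E}

theorem nonempty_of_bottomSpectrum_pos (h0 : 0 < bottomSpectrum H) :
    {x : ℝ | (x : ℂ) ∈ opSpectrum H}.Nonempty := by
  by_contra h
  rw [bottomSpectrum, Set.not_nonempty_iff_eq_empty.1 h, Real.sInf_empty] at h0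
  exact h0.false

theorem bottomSpectrum_le (h0 : 0 < bottomSpectrum H) {x : ℝ} (hx : (x : ℂ) ∈ opSpectrum H) :
    bottomSpectrum H ≤ x := by
  have hb : BddBelow {x : ℝ | (x : ℂ) ∈ opSpectrum H} := by
    by_contra h
    rw [bottomSpectrum, Real.sInf_of_not_bddBelow h] at h0
    exact h0.false
  exact csInf_le hb hx

theorem exists_isResolvent (h0 : 0 < bottomSpectrum H) {x : ℝ} (hx : x < bottomSpectrum H) :
    ∃ Q : E →L[ℂ] E, IsResolvent H x Q := by
  by_contra h
  exact hx.not_ge (bottomSpectrum_le h0 h)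

theorem boundedInverse_spec (h0 : 0 < bottomSpectrum H) :
    IsBoundedInverse H (boundedInverse H) := by
  have hex : ∃ R : E →L[ℂ] E, IsBoundedInverse H R := by
    obtain ⟨Q, hQ⟩ := exists_isResolvent h0 (x := 0) h0
    refine ⟨-Q, fun f u => ?_⟩
    have h1 := hQ f (-u)
    rw [neg_apply, neg_eq_iff_eq_neg, h1, LinearPMap.mem_graph_iff]
    constructor
    · rintro ⟨h, hf⟩
      refine ⟨⟨u, by simpa using H.domain.neg_mem h⟩, rfl, ?_⟩
      rw [← hf]
      have : (⟨-u, h⟩ : H.domain) = -⟨u, by simpa using H.domain.neg_mem h⟩ := rfl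
      rw [this, LinearPMap.map_neg]
      simp
    · rintro ⟨y, hy, hf⟩
      subst hy
      refine ⟨H.domain.neg_mem y.2, ?_⟩
      have : (⟨-(y : E), H.domain.neg_mem y.2⟩ : H.domain) = -y := rfl
      rw [this, LinearPMap.map_neg]
      simpa using hf
  rw [boundedInverse, dif_pos hex]
  exact hex.choose_spec

theorem IsBoundedInverse.mem_graph {R : E →L[ℂ] E} (hR : IsBoundedInverse H R) (f : E) :
    (R f, f) ∈ H.graph := (hR f (R f)).1 rfl

theorem IsBoundedInverse.apply_mem_domain {R : E →L[ℂ] E} (hR : IsBoundedInverse H R) (f : E) :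
    ∃ h : R f ∈ H.domain, H ⟨R f, h⟩ = f := by
  obtain ⟨y, hy, hf⟩ := LinearPMap.mem_graph_iff _ |>.1 (hR.mem_graph f)
  obtain ⟨y, hyd⟩ := y
  obtain rfl : y = R f := hy
  exact ⟨hyd, hf⟩

theorem IsBoundedInverse.apply_map {R : E →L[ℂ] E} (hR : IsBoundedInverse H R) {u : E}
    (hu : u ∈ H.domain) : R (H ⟨u, hu⟩) = u :=
  (hR _ _).2 (LinearPMap.mem_graph H ⟨u, hu⟩)

theorem IsResolvent.inverse_apply {R Q : E →L[ℂ] E} {x : ℂ} (hQ : IsResolvent H x Q)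
    (hR : IsBoundedInverse H R) (f : E) : R (x • Q f - f) = Q f := by
  obtain ⟨hd, hf⟩ := (hQ f (Q f)).1 rfl
  have h1 : x • Q f - f = H ⟨Q f, hd⟩ := by rw [sub_eq_iff_eq_add, ← sub_eq_iff_eq_add', hf]
  rw [h1, hR.apply_map hd]

theorem IsResolvent.apply_inverse {R Q : E →L[ℂ] E} {x : ℂ} (hQ : IsResolvent H x Q)
    (hR : IsBoundedInverse H R) (f : E) : Q (x • R f - f) = R f := by
  obtain ⟨hd, hf⟩ := hR.apply_mem_domain f
  exact (hQ _ _).2 ⟨hd, by rw [hf]⟩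

theorem inv_notMem_spectrum_of_isResolvent {R Q : E →L[ℂ] E} (hR : IsBoundedInverse H R) {x : ℂ}
    (hx : x ≠ 0) (hQ : IsResolvent H x Q) : x⁻¹ ∉ spectrum ℂ R := by
  rw [spectrum.notMem_iff]
  -- With `Q = (x - H)⁻¹`, formally `(1/x - H⁻¹)⁻¹ = xH(H - x)⁻¹ = x(1 - xQ)`.
  let V : E →L[ℂ] E := x • (1 - x • Q)
  refine ⟨⟨algebraMap ℂ _ x⁻¹ - R, V, ?_, ?_⟩, rfl⟩
  · ext f
    have h1 := hQ.inverse_apply hR f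
    rw [map_sub, map_smul, sub_eq_iff_eq_add] at h1
    simp [V, Algebra.algebraMap_eq_smul_one, h1, hx, smul_sub]
  · ext f
    have h1 := hQ.apply_inverse hR f
    rw [map_sub, map_smul, sub_eq_iff_eq_add] at h1
    simp [V, Algebra.algebraMap_eq_smul_one, h1, hx, smul_sub]

/-- If `0 < x` and `xC < 1`, a Neumann series inverts `1 - xR`, and `-R(1 - xR)⁻¹` is the resolvent
of `H` at `x`. Hence every real spectral point satisfies `xC ≥ 1`. -/
theorem one_le_bottomSpectrum_mul [CompleteSpace E] (h0 : 0 < bottomSpectrum H) {R : E →L[ℂ] E}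
    (hR : IsBoundedInverse H R) {C : ℝ} (h : ‖R‖ ≤ C) : 1 ≤ bottomSpectrum H * C := by
  have hC : 0 ≤ C := (norm_nonneg R).trans h
  by_contra hlt
  rw [not_le] at hlt
  obtain ⟨x, hx, hxC⟩ : ∃ x : ℝ, (x : ℂ) ∈ opSpectrum H ∧ x * C < 1 := by
    by_contra! hno
    -- For `C = 0` no division is possible; the contradiction is that some spectral point exists.
    rcases eq_or_lt_of_le hC with hC0 | hC0
    · obtain ⟨x, hx⟩ := nonempty_of_bottomSpectrum_pos h0
      have := hno x hx
      rw [← hC0, mul_zero] at this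
      linarith
    · have : C⁻¹ ≤ bottomSpectrum H := le_csInf (nonempty_of_bottomSpectrum_pos h0) fun x hx => by
        rw [inv_le_iff_one_le_mul₀ hC0]
        exact hno x hx
      rw [inv_le_iff_one_le_mul₀ hC0] at this
      linarith
  have hx0 : 0 < x := h0.trans_le (bottomSpectrum_le h0 hx)
  have hu : IsUnit (1 - (x : ℂ) • R) := by
    refine isUnit_one_sub_of_norm_lt_one ?_
    rw [norm_smul, Complex.norm_real, Real.norm_of_nonneg hx0.le]
    exact (mul_le_mul_of_nonneg_left h hx0.le).trans_lt hxC
  obtain ⟨U, hU⟩ := hu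
  have hU1 : ∀ v, (U⁻¹ : (E →L[ℂ] E)ˣ).1 (v - (x : ℂ) • R v) = v := fun v => by
    have := congrArg (fun A : E →L[ℂ] E => A v) U.inv_mul
    rw [hU] at this
    simpa using this
  have hU2 : ∀ f, (U⁻¹ : (E →L[ℂ] E)ˣ).1 f - (x : ℂ) • R ((U⁻¹ : (E →L[ℂ] E)ˣ).1 f) = f := fun f => by
    have := congrArg (fun A : E →L[ℂ] E => A f) U.mul_inv
    rw [hU] at this
    simpa using this
  refine hx ⟨-(R ∘L (U⁻¹ : (E →L[ℂ] E)ˣ).1), fun f u => ?_⟩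
  constructor
  · rintro rfl
    obtain ⟨hd, hf⟩ := hR.apply_mem_domain (-(U⁻¹ : (E →L[ℂ] E)ˣ).1 f)
    have e1 : R (-(U⁻¹ : (E →L[ℂ] E)ˣ).1 f) = (-(R ∘L (U⁻¹ : (E →L[ℂ] E)ˣ).1)) f := by simp
    simp only [e1] at hd hf
    refine ⟨hd, ?_⟩
    rw [hf]
    conv_rhs => rw [← hU2 f]
    simp [sub_eq_add_neg, add_comm]
  · rintro ⟨hd, rfl⟩
    have h1 := hU1 (H ⟨u, hd⟩)
    rw [hR.apply_map hd] at h1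
    have h2 : (x : ℂ) • u - H ⟨u, hd⟩ = -(H ⟨u, hd⟩ - (x : ℂ) • u) := by abel
    rw [h2, map_neg, neg_apply, neg_neg, ContinuousLinearMap.comp_apply, h1, hR.apply_map hd]

end Resolvents

section SelfAdjoint

variable {E : Type*} [NormedAddCommGroup E] [InnerProductSpace ℂ E] [CompleteSpace E]
  {H : E →ₗ.[ℂ] E}

theorem IsBoundedInverse.isSelfAdjoint {R : E →L[ℂ] E} (hR : IsBoundedInverse H R)
    (hs : ∀ u f v g : E, (u, f) ∈ H.graph → (v, g) ∈ H.graph → inner ℂ f v = inner ℂ u g) :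
    IsSelfAdjoint R := by
  rw [ContinuousLinearMap.isSelfAdjoint_iff_isSymmetric]
  intro f g
  exact (hs _ _ _ _ (hR.mem_graph f) (hR.mem_graph g)).symm

theorem symmetric_of_isSelfAdjoint (hH : IsSelfAdjoint H) (u f v g : E)
    (hu : (u, f) ∈ H.graph) (hv : (v, g) ∈ H.graph) : inner ℂ f v = inner ℂ u g := by
  have h := H.adjoint_isFormalAdjoint hH.dense_domain
  rw [LinearPMap.isSelfAdjoint_def.1 hH] at h
  obtain ⟨y, rfl, rfl⟩ := (LinearPMap.mem_graph_iff _).1 hu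
  obtain ⟨z, rfl, rfl⟩ := (LinearPMap.mem_graph_iff _).1 hv
  exact h y z

/-- Selfadjointness of `R` excludes nonreal points. A real `z ≠ 0` outside the interval has `1/z`
below the bottom of the spectrum of `H`, so `H` has a resolvent there, and this makes `z - R`
invertible. Only symmetry of `H` enters. -/
theorem IsBoundedInverse.isInverseAbove {R : E →L[ℂ] E} (hR : IsBoundedInverse H R)
    (h0 : 0 < bottomSpectrum H)
    (hs : ∀ u f v g : E, (u, f) ∈ H.graph → (v, g) ∈ H.graph → inner ℂ f v = inner ℂ u g) :
    IsInverseAbove R (bottomSpectrum H) where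
  pos := h0
  selfAdjoint := hR.isSelfAdjoint hs
  spectrum_subset := by
    intro z hz
    have hzr : z = z.re := (hR.isSelfAdjoint hs).mem_spectrum_eq_re hz
    refine ⟨z.re, ?_, hzr.symm⟩
    by_contra hmem
    have hz0 : z.re ≠ 0 := fun h => hmem (by rw [h]; exact ⟨le_rfl, inv_nonneg.2 h0.le⟩)
    have hlt : (z.re)⁻¹ < bottomSpectrum H := by
      rcases lt_or_gt_of_ne hz0 with h | h
      · exact (inv_lt_zero.2 h).trans h0
      · by_contra hge
        exact hmem ⟨h.le, (le_inv_comm₀ h h0).2 (not_lt.1 hge)⟩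
    obtain ⟨Q, hQ⟩ := exists_isResolvent h0 hlt
    have := inv_notMem_spectrum_of_isResolvent hR (by exact_mod_cast inv_ne_zero hz0) hQ
    rw [← Complex.ofReal_inv, inv_inv, ← hzr] at this
    exact this hz

end SelfAdjoint

end Torsion

/-! ### From `L_∞` bounds to `L_2` bounds for selfadjoint operators. -/

namespace Torsion

section Interpolation

variable {X : Type*} [MeasurableSpace X] {μ : Measure X}

/-- Restricting `f` to `{1/(n+1) ≤ |f| ≤ n+1}`: the upper cut gives boundedness, the lower one
integrability even when the measure is infinite. -/
theorem exists_tendsto_bounded_integrable (f : Lp ℂ 2 μ) :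
    ∃ F : ℕ → Lp ℂ 2 μ, Tendsto F atTop (𝓝 f) ∧ (∀ n, ∃ B : ℝ, ∀ᵐ x ∂μ, ‖F n x‖ ≤ B) ∧
      ∀ n, Integrable (fun x => ‖F n x‖) μ := by
  let A : ℕ → Set X := fun n => {x | 1 ≤ (n + 1) * ‖f x‖ ∧ ‖f x‖ ≤ n + 1}
  have hm := (Lp.stronglyMeasurable f).norm.measurable
  have hA : ∀ n, MeasurableSet (A n) := fun n =>
    (measurableSet_le measurable_const (hm.const_mul _)).inter
      (measurableSet_le hm measurable_const)
  have hL : ∀ n, MemLp ((A n).indicator f) 2 μ := fun n => (Lp.memLp f).indicator (hA n)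
  have hF : ∀ᵐ x ∂μ, ∀ n, (hL n).toLp _ x = (A n).indicator f x :=
    ae_all_iff.2 fun n => (hL n).coeFn_toLp
  refine ⟨fun n => (hL n).toLp _, ?_, fun n => ⟨n + 1, ?_⟩, fun n => ?_⟩
  · refine tendsto_of_ae_tendsto (g := f) (fun n => ?_) (Eventually.of_forall fun x => le_rfl) ?_
    · filter_upwards [hF] with x hx
      rw [hx]
      exact norm_indicator_le_norm_self _ _
    · filter_upwards [hF] with x hx
      simp only [hx]
      rcases eq_or_ne (f x) 0 with h0 | h0
      · have : ∀ n, (A n).indicator f x = 0 := fun n => by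
          by_cases h : x ∈ A n
          · rw [Set.indicator_of_mem h, h0]
          · exact Set.indicator_of_notMem h _
        simp [this, h0]
      · have hpos := norm_pos_iff.2 h0
        refine tendsto_const_nhds.congr' ?_
        filter_upwards [eventually_ge_atTop ⌈‖f x‖⌉₊, eventually_ge_atTop ⌈‖f x‖⁻¹⌉₊] with n h1 h2
        have h1' : ‖f x‖ ≤ n := (Nat.le_ceil _).trans (by exact_mod_cast h1)
        have h2' : ‖f x‖⁻¹ ≤ n := (Nat.le_ceil _).trans (by exact_mod_cast h2)
        refine (Set.indicator_of_mem (show x ∈ A n from ⟨?_, by linarith⟩) _).symm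
        rw [inv_le_iff_one_le_mul₀ hpos] at h2'
        nlinarith
  · filter_upwards [hF] with x hx
    rw [hx]
    by_cases h : x ∈ A n
    · rw [Set.indicator_of_mem h]; exact h.2
    · rw [Set.indicator_of_notMem h, norm_zero]; positivity
  · refine Integrable.mono' ((integrable_norm_sq f).const_mul ((n : ℝ) + 1))
      (Lp.aestronglyMeasurable _).norm ?_
    filter_upwards [hF] with x hx
    rw [hx, norm_norm]
    by_cases h : x ∈ A n
    · rw [Set.indicator_of_mem h]
      nlinarith [norm_nonneg (f x), h.1]
    · rw [Set.indicator_of_notMem h, norm_zero]; positivity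

/-- A constant factor is invisible after taking `2^{k+1}`-th roots and letting `k → ∞`. -/
theorem le_of_pow_le_pow_mul {q C K : ℝ} (hC : 0 ≤ C)
    (h : ∀ k : ℕ, q ^ (2 ^ k * 2) ≤ C ^ (2 ^ k * 2) * K) : q ≤ C := by
  by_contra hlt
  rw [not_le] at hlt
  have hq0 : 0 < q := hC.trans_lt hlt
  have ht : Tendsto (fun k : ℕ => 2 ^ k * 2) atTop atTop :=
    tendsto_atTop_mono (fun k => (Nat.lt_two_pow_self (n := k)).le.trans (by omega)) tendsto_id
  have h1 : Tendsto (fun k : ℕ => (C / q) ^ (2 ^ k * 2) * K) atTop (𝓝 0) := by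
    have := ((tendsto_pow_atTop_nhds_zero_of_lt_one (r := C / q) (by positivity)
      ((div_lt_one hq0).2 hlt)).comp ht).mul_const K
    simpa using this
  have h2 : (1 : ℝ) ≤ 0 := ge_of_tendsto' h1 fun k => by
    rw [div_pow, div_mul_eq_mul_div, le_div_iff₀ (by positivity), one_mul]
    exact h k
  linarith

/-- A selfadjoint operator that is bounded by `C` in `L_∞` is bounded by `C` in `L_2`. -/
theorem opNorm_le_of_ae_norm_le {R : Lp ℂ 2 μ →L[ℂ] Lp ℂ 2 μ} (hR : IsSelfAdjoint R) {C : ℝ}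
    (hC : 0 ≤ C) (h : ∀ (f : Lp ℂ 2 μ) (B : ℝ), (∀ᵐ x ∂μ, ‖f x‖ ≤ B) → ∀ᵐ x ∂μ, ‖R f x‖ ≤ C * B) :
    ‖R‖ ≤ C := by
  refine ContinuousLinearMap.opNorm_le_bound _ hC fun f => ?_
  obtain ⟨F, hF, hFB, hFi⟩ := exists_tendsto_bounded_integrable f
  refine le_of_tendsto_of_tendsto' ((R.continuous.tendsto f).comp hF).norm (hF.norm.const_mul C)
    fun n => ?_
  obtain ⟨B, hB⟩ := hFB n
  have hi := hFi n
  simp only [Function.comp_apply]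
  generalize F n = f at hB hi
  rcases eq_or_ne f 0 with rfl | hf0
  · simp
  have hfpos := norm_pos_iff.2 hf0
  have hpow : ∀ m, ∀ᵐ x ∂μ, ‖(R ^ m) f x‖ ≤ C ^ m * B := by
    intro m
    induction m with
    | zero => simpa using hB
    | succ m ih =>
      rw [pow_succ', pow_succ', mul_assoc]
      exact h _ _ ih
  have hsym : ∀ m (u v : Lp ℂ 2 μ), inner ℂ ((R ^ m) u) v = inner ℂ u ((R ^ m) v) := fun m u v =>
    (ContinuousLinearMap.isSelfAdjoint_iff_isSymmetric.1 (hR.pow m)) u v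
  have hsq : ∀ m, ‖(R ^ m) f‖ ^ 2 = ‖inner ℂ f ((R ^ (2 * m)) f)‖ := fun m => by
    rw [two_mul, pow_add, mul_apply_eq_comp, ← hsym, inner_self_eq_norm_sq_to_K]
    simp
  -- Symmetry gives `‖R^m f‖² = ⟨f, R^{2m} f⟩ ≤ ‖f‖ ‖R^{2m} f‖`, iterated along `m = 2^k`. The last
  -- power is then bounded by pairing the `L_∞` bound with the `L_1` norm of `f`.
  have h1 : ∀ k : ℕ, (‖R f‖ / ‖f‖) ^ 2 ^ k ≤ ‖(R ^ 2 ^ k) f‖ / ‖f‖ := by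
    intro k
    induction k with
    | zero => simp
    | succ k ih =>
      rw [pow_succ 2 k, pow_mul]
      calc _ ≤ (‖(R ^ 2 ^ k) f‖ / ‖f‖) ^ 2 := by gcongr
        _ = ‖inner ℂ f ((R ^ (2 ^ k * 2)) f)‖ / ‖f‖ ^ 2 := by rw [div_pow, hsq, mul_comm 2]
        _ ≤ ‖f‖ * ‖(R ^ (2 ^ k * 2)) f‖ / ‖f‖ ^ 2 := by
            gcongr
            exact norm_inner_le_norm _ _
        _ = _ := by field_simp
  have h2 : ∀ k : ℕ, ‖(R ^ 2 ^ k) f‖ ^ 2 ≤ (C ^ 2 ^ k) ^ 2 * (B * ∫ x, ‖f x‖ ∂μ) := fun k => by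
    rw [hsq]
    refine (norm_inner_le_of_ae_norm_le hi (hpow _)).trans_eq ?_
    rw [← pow_mul, mul_comm 2]
    ring
  rw [← div_le_iff₀ hfpos]
  refine le_of_pow_le_pow_mul (K := B * (∫ x, ‖f x‖ ∂μ) / ‖f‖ ^ 2) hC fun k => ?_
  rw [pow_mul, pow_mul]
  calc _ ≤ (‖(R ^ 2 ^ k) f‖ / ‖f‖) ^ 2 := by gcongr; exact h1 k
    _ ≤ (C ^ 2 ^ k) ^ 2 * (B * (∫ x, ‖f x‖ ∂μ) / ‖f‖ ^ 2) := by
      rw [div_pow, ← mul_div_assoc]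
      gcongr
      exact h2 k

end Interpolation

/-! ### The generated semigroup agrees with the functional calculus. -/

section SemigroupIdentification

variable {E : Type*} [NormedAddCommGroup E] [InnerProductSpace ℂ E] [CompleteSpace E]
  {H : E →ₗ.[ℂ] E} {R : E →L[ℂ] E} {e : ℝ} {T : ℝ≥0 → E →L[ℂ] E}

omit [CompleteSpace E] in
theorem IsBoundedInverse.tendsto_semigroup (hR : IsBoundedInverse H R) (hG : IsGenerator T (-H))
    (f : E) : Tendsto (fun t : ℝ≥0 => ((t : ℝ) : ℂ)⁻¹ • (T t (R f) - R f)) (𝓝[>] (0 : ℝ≥0))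
      (𝓝 (-f)) := by
  refine (hG (R f) (-f)).1 ?_
  obtain ⟨hd, hf⟩ := hR.apply_mem_domain f
  rw [LinearPMap.mem_graph_iff]
  exact ⟨⟨R f, hd⟩, rfl, by rw [LinearPMap.neg_apply, hf]⟩

omit [CompleteSpace E] in
-- The difference quotients of the semigroup at `T s (R f)` are `T s` applied to those at `R f`, so
-- they converge to `-T s f`. Hence `H (T s (R f)) = T s f`.
theorem IsBoundedInverse.semigroup_comm (hR : IsBoundedInverse H R) (hT : IsC0Semigroup T)
    (hG : IsGenerator T (-H)) (s : ℝ≥0) (f : E) : R (T s f) = T s (R f) := by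
  have h1 : Tendsto (fun t : ℝ≥0 => ((t : ℝ) : ℂ)⁻¹ • (T t (T s (R f)) - T s (R f)))
      (𝓝[>] (0 : ℝ≥0)) (𝓝 (T s (-f))) := by
    refine (((T s).continuous.tendsto _).comp (hR.tendsto_semigroup hG f)).congr fun t => ?_
    simp only [Function.comp_apply]
    rw [map_smul, map_sub]
    have h2 : T t (T s (R f)) = T s (T t (R f)) := by
      have h3 := hT.map_add t s
      rw [add_comm, hT.map_add s t] at h3
      exact (congrArg (fun A : E →L[ℂ] E => A (R f)) h3).symm
    rw [h2]
  have h2 := (hG _ _).2 h1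
  refine (hR _ _).2 ?_
  rw [LinearPMap.mem_graph_iff] at h2 ⊢
  obtain ⟨y, hy, hf⟩ := h2
  refine ⟨y, hy, ?_⟩
  rw [LinearPMap.neg_apply, map_neg] at hf
  exact neg_injective hf

omit [CompleteSpace E] in
theorem IsBoundedInverse.hasDerivWithinAt_semigroup (hR : IsBoundedInverse H R)
    (hT : IsC0Semigroup T) (hG : IsGenerator T (-H)) {t : ℝ} (ht : 0 ≤ t) (f : E) :
    HasDerivWithinAt (fun t : ℝ => T t.toNNReal (R f)) (-T t.toNNReal f) (Set.Ici t) t := by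
  rw [← hasDerivWithinAt_Ioi_iff_Ici, hasDerivWithinAt_iff_tendsto_slope' (by simp)]
  have h1 := ((T t.toNNReal).continuous.tendsto _).comp (hR.tendsto_semigroup hG f)
  have h2 : Tendsto (fun s : ℝ => (s - t).toNNReal) (𝓝[>] t) (𝓝[>] (0 : ℝ≥0)) := by
    refine tendsto_nhdsWithin_iff.2 ⟨?_, ?_⟩
    · refine Tendsto.mono_left (Continuous.tendsto' (by fun_prop) _ _ (by simp)) nhdsWithin_le_nhds
    · filter_upwards [self_mem_nhdsWithin] with s hs
      exact Real.toNNReal_pos.2 (sub_pos.2 hs)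
  rw [map_neg] at h1
  refine (h1.comp h2).congr' ?_
  filter_upwards [self_mem_nhdsWithin] with s hs
  have hs' : t < s := hs
  simp only [Function.comp_apply, slope, vsub_eq_sub]
  rw [map_smul, map_sub, Real.coe_toNNReal _ (by linarith), ← Complex.ofReal_inv]
  have h3 : T s.toNNReal = (T t.toNNReal).comp (T (s - t).toNNReal) := by
    rw [← hT.map_add, ← Real.toNNReal_add ht (by linarith)]
    congr 2; ring
  rw [h3]
  rfl

open scoped ComplexOrder in
/-- The semigroup generated by `-H` is given by the functional calculus of `H⁻¹`. -/
theorem IsBoundedInverse.semigroup_eq_heat (hR : IsBoundedInverse H R) (hA : IsInverseAbove R e)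
    (hd : Dense (H.domain : Set E)) (hT : IsC0Semigroup T) (hG : IsGenerator T (-H)) {t : ℝ}
    (ht : 0 < t) : T t.toNNReal = heat R t := by
  have hrange : ∀ f, T t.toNNReal (R f) = heat R t (R f) := by
    intro f
    -- The difference `w` of the two evolutions satisfies `w = Rp` and `w' = -p`. As `R ≥ 0`, the
    -- right derivative of `‖w‖²` is `-2 Re⟨Rp, p⟩ ≤ 0`, and `w` vanishes at `0+`; so `w = 0`.
    let p : ℝ → E := fun s => T s.toNNReal f - heat R s f
    let w : ℝ → E := fun s => T s.toNNReal (R f) - heat R s (R f)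
    have hw : ∀ s, w s = R (p s) := fun s => by
      simp only [w, p, map_sub]
      rw [hR.semigroup_comm hT hG]
      congr 1
      exact congrArg (fun A : E →L[ℂ] E => A f) (hA.commute s).eq
    have hwd : ∀ s : ℝ, 0 < s → HasDerivWithinAt w (-p s) (Set.Ici s) s := fun s hs => by
      refine ((hR.hasDerivWithinAt_semigroup hT hG hs.le f).sub
        (hA.hasDerivAt_heat_real hs f).hasDerivWithinAt).congr_deriv ?_
      simp only [p]; abel
    have hpos : ∀ v : E, 0 ≤ RCLike.re (inner ℂ (R v) v) := by
      intro v
      have := hA.isStarNormal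
      have h1 : 0 ≤ R := by
        refine (StarOrderedRing.nonneg_iff_spectrum_nonneg (R := ℂ) R).2 fun x hx => ?_
        obtain ⟨y, hy, rfl⟩ := hA.spectrum_subset hx
        exact Complex.zero_le_real.2 hy.1
      exact ((ContinuousLinearMap.nonneg_iff_isPositive R).1 h1).re_inner_nonneg_left v
    have hcont : ∀ s : ℝ, 0 < s → ContinuousAt w s := fun s hs =>
      ((hT.continuous (R f)).comp continuous_real_toNNReal).continuousAt.sub
        (hA.hasDerivAt_heat_real hs f).continuousAt
    have hanti : ∀ s, 0 < s → s ≤ t → ‖w t‖ ^ 2 ≤ ‖w s‖ ^ 2 := by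
      intro s hs hst
      refine image_le_of_deriv_right_le_deriv_boundary (f := fun x => ‖w x‖ ^ 2)
        (f' := fun x => 2 * RCLike.re (inner ℂ (w x) (-p x))) (a := s) (b := t)
        (B := fun _ => ‖w s‖ ^ 2) (B' := fun _ => 0)
        (fun x hx => ((hcont x (hs.trans_le hx.1)).norm.pow 2).continuousWithinAt) ?_ le_rfl
        continuousOn_const (fun x _ => hasDerivWithinAt_const _ _ _) ?_ (Set.right_mem_Icc.2 hst)
      · intro x hx
        have h1 := (hwd x (hs.trans_le hx.1))
        have h2 := Complex.reCLM.hasFDerivAt.comp_hasDerivWithinAt x (h1.inner ℂ h1)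
        refine (h2.congr_deriv ?_).congr_of_eventuallyEq (Eventually.of_forall fun y => ?_) ?_
        · simp only [Complex.reCLM_apply, Complex.add_re]
          rw [← inner_conj_symm (w x) (-p x), Complex.conj_re]
          simp only [RCLike.re_to_complex, Complex.conj_re]
          ring
        · simp only [Function.comp_apply, Complex.reCLM_apply]
          exact (inner_self_eq_norm_sq (𝕜 := ℂ) (w y)).symm
        · simp only [Function.comp_apply, Complex.reCLM_apply]
          exact (inner_self_eq_norm_sq (𝕜 := ℂ) (w x)).symm
      · intro x hx
        have := hpos (p x)
        rw [hw, inner_neg_right, map_neg]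
        linarith
    have hlim : Tendsto (fun s => ‖w s‖ ^ 2) (𝓝[>] 0) (𝓝 0) := by
      have h1 : Tendsto (fun s : ℝ => T s.toNNReal (R f)) (𝓝[>] 0) (𝓝 (R f)) := by
        refine Tendsto.mono_left (Continuous.tendsto'
          ((hT.continuous (R f)).comp continuous_real_toNNReal) _ _ ?_) nhdsWithin_le_nhds
        simp [hT.map_zero]
      have h2 := ((h1.sub (hA.tendsto_heat_zero f)).norm).pow 2
      simpa using h2
    have h0 : ‖w t‖ ^ 2 ≤ 0 := ge_of_tendsto hlim (by
      filter_upwards [Ioo_mem_nhdsGT ht] with s hs using hanti s hs.1 hs.2.le)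
    have h1 : w t = 0 := by
      rw [← norm_eq_zero]
      exact pow_eq_zero_iff two_ne_zero |>.1 (le_antisymm h0 (by positivity))
    exact sub_eq_zero.1 h1
  refine ContinuousLinearMap.ext fun u => ?_
  refine congrFun (Continuous.ext_on hd (T t.toNNReal).continuous (heat R t).continuous ?_) u
  intro v hv
  have := hrange (H ⟨v, hv⟩)
  rwa [hR.apply_map hv] at this

end SemigroupIdentification
end Torsion

/-! ### The bounds for `q(H)`. -/

namespace Torsion

section TorsionBounds

variable {d : ℕ} {Ω : Set (Eucl d)}

theorem freeHeat_indicator {Ω : Set (Eucl d)} (hΩ : NullMeasurableSet Ω volume) {t : ℝ}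
    (ht : 0 < t) (g : Eucl d → ℝ) (x : Eucl d) :
    freeHeat t.toNNReal (Ω.indicator g) x = ∫ y in Ω, gaussKernel t (x - y) * g y := by
  have h0 : t.toNNReal ≠ 0 := (Real.toNNReal_pos.2 ht).ne'
  rw [freeHeat, if_neg h0, Real.coe_toNNReal _ ht.le, ← integral_indicator₀ hΩ]
  refine integral_congr_ae (Eventually.of_forall fun y => ?_)
  by_cases hy : y ∈ Ω
  · simp [Set.indicator_of_mem hy, gaussKernel]
  · simp [Set.indicator_of_notMem hy]

theorem isHeatDominated_of_semigroup {H : L2 Ω →ₗ.[ℂ] L2 Ω} {R : L2 Ω →L[ℂ] L2 Ω} {e : ℝ}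
    {T : ℝ≥0 → L2 Ω →L[ℂ] L2 Ω} (hΩ : NullMeasurableSet Ω volume) (hR : IsBoundedInverse H R)
    (hA : IsInverseAbove R e) (hd : Dense (H.domain : Set (L2 Ω))) (hT : IsC0Semigroup T)
    (hG : IsGenerator T (-H)) (hdom : DominatedByFreeHeat T) : IsHeatDominated R := by
  intro t ht f
  rw [← hR.semigroup_eq_heat hA hd hT hG ht]
  filter_upwards [hdom t.toNNReal f] with x hx
  rwa [freeHeat_indicator hΩ ht] at hx

theorem ae_norm_le_of_eLpNorm_top_le {f : L2 Ω} {C : ℝ} (hC : 0 ≤ C)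
    (hf : eLpNorm f ∞ (volume.restrict Ω) ≤ ENNReal.ofReal C) :
    ∀ᵐ x ∂(volume.restrict Ω), ‖f x‖ ≤ C := by
  rw [eLpNorm_exponent_top] at hf
  filter_upwards [enorm_ae_le_eLpNormEssSup f (volume.restrict Ω)] with x hx
  have := hx.trans hf
  rwa [← ofReal_norm, ENNReal.ofReal_le_ofReal_iff hC] at this

theorem normInfty_le {R : L2 Ω →L[ℂ] L2 Ω} {C : ℝ}
    (h : ∀ f : L2 Ω, (∀ᵐ x ∂(volume.restrict Ω), ‖f x‖ ≤ 1) →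
      ∀ᵐ x ∂(volume.restrict Ω), ‖R f x‖ ≤ C) : normInfty R ≤ ENNReal.ofReal C := by
  refine iSup₂_le fun f hf => ?_
  rw [eLpNorm_exponent_top]
  exact eLpNormEssSup_le_of_ae_bound
    (h f (ae_norm_le_of_eLpNorm_top_le zero_le_one (by simpa using hf)))

theorem ae_norm_le_normInfty_mul {R : L2 Ω →L[ℂ] L2 Ω} (hR : normInfty R ≠ ∞) (f : L2 Ω) (B : ℝ)
    (hf : ∀ᵐ x ∂(volume.restrict Ω), ‖f x‖ ≤ B) :
    ∀ᵐ x ∂(volume.restrict Ω), ‖R f x‖ ≤ (normInfty R).toReal * B := by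
  rcases eq_or_ne (volume.restrict Ω) 0 with h0 | h0
  · simp [h0]
  have hB : 0 ≤ B := by
    have := ae_neBot.2 h0
    obtain ⟨y, hy⟩ := hf.exists
    exact (norm_nonneg _).trans hy
  rcases eq_or_lt_of_le hB with rfl | hB0
  · have hf0 : f = 0 := by
      refine Lp.ext ?_
      filter_upwards [hf, Lp.coeFn_zero ℂ 2 (volume.restrict Ω)] with x h1 h2
      rw [h2, Pi.zero_apply, ← norm_le_zero_iff]
      exact h1
    rw [hf0, map_zero]
    filter_upwards [Lp.coeFn_zero ℂ 2 (volume.restrict Ω)] with x h2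
    rw [h2, Pi.zero_apply, norm_zero, mul_zero]
  set g : L2 Ω := ((B⁻¹ : ℝ) : ℂ) • f with hg
  have hg1 : eLpNorm g ∞ (volume.restrict Ω) ≤ 1 := by
    rw [eLpNorm_exponent_top, ← ENNReal.ofReal_one]
    refine eLpNormEssSup_le_of_ae_bound ?_
    filter_upwards [hf, Lp.coeFn_smul ((B⁻¹ : ℝ) : ℂ) f] with x h1 h2
    rw [hg, h2, Pi.smul_apply, norm_smul, Complex.norm_real, Real.norm_of_nonneg (by positivity),
      ← div_eq_inv_mul, div_le_one hB0]
    exact h1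
  have h2 : eLpNorm (R g) ∞ (volume.restrict Ω) ≤ normInfty R :=
    le_iSup₂ (f := fun (f : L2 Ω) (_ : eLpNorm f ∞ (volume.restrict Ω) ≤ 1) =>
      eLpNorm (R f) ∞ (volume.restrict Ω)) g hg1
  rw [← ENNReal.ofReal_toReal hR] at h2
  filter_upwards [ae_norm_le_of_eLpNorm_top_le ENNReal.toReal_nonneg h2,
    Lp.coeFn_smul ((B⁻¹ : ℝ) : ℂ) (R f)] with x h3 h4
  rw [hg, map_smul, h4, Pi.smul_apply, norm_smul, Complex.norm_real,
    Real.norm_of_nonneg (by positivity), ← div_eq_inv_mul, div_le_iff₀ hB0] at h3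
  exact h3

theorem one_le_q {H : L2 Ω →ₗ.[ℂ] L2 Ω} (h0 : 0 < bottomSpectrum H)
    (hA : IsInverseAbove (boundedInverse H) (bottomSpectrum H)) : 1 ≤ q H := by
  rw [q]
  rcases eq_or_ne (normInfty (boundedInverse H)) ∞ with h | h
  · rw [h, ENNReal.mul_top (by simpa using h0)]
    exact le_top
  have h1 := opNorm_le_of_ae_norm_le hA.selfAdjoint ENNReal.toReal_nonneg
    (ae_norm_le_normInfty_mul h)
  have h2 := one_le_bottomSpectrum_mul h0 (boundedInverse_spec h0) h1
  rw [← ENNReal.ofReal_toReal h, ← ENNReal.ofReal_mul h0.le, ← ENNReal.ofReal_one]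
  exact ENNReal.ofReal_le_ofReal h2

theorem q_le (hd : 1 ≤ d) {H : L2 Ω →ₗ.[ℂ] L2 Ω} (h0 : 0 < bottomSpectrum H)
    (hA : IsInverseAbove (boundedInverse H) (bottomSpectrum H))
    (hdom : IsHeatDominated (boundedInverse H)) : q H ≤ ENNReal.ofReal (torsionConst d) := by
  calc q H ≤ ENNReal.ofReal (bottomSpectrum H) *
        ENNReal.ofReal (torsionConst d / bottomSpectrum H) := by
        rw [q]
        gcongr
        exact normInfty_le fun f hf => ae_norm_inverse_le hd hA hdom hf
    _ = _ := by
        rw [← ENNReal.ofReal_mul h0.le, mul_div_cancel₀ _ h0.ne']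

theorem q_bounds (hd : 1 ≤ d) (hΩ : NullMeasurableSet Ω volume) {H : L2 Ω →ₗ.[ℂ] L2 Ω}
    {T : ℝ≥0 → L2 Ω →L[ℂ] L2 Ω} (hH : IsSelfAdjoint H) (h0 : 0 < bottomSpectrum H)
    (hT : IsC0Semigroup T) (hG : IsGenerator T (-H)) (hdom : DominatedByFreeHeat T) :
    1 ≤ q H ∧ q H ≤ ENNReal.ofReal (torsionConst d) := by
  have hR := boundedInverse_spec h0
  have hA := hR.isInverseAbove h0 (symmetric_of_isSelfAdjoint hH)
  exact ⟨one_le_q h0 hA, q_le hd h0 hA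
    (isHeatDominated_of_semigroup hΩ hR hA hH.dense_domain hT hG hdom)⟩

end TorsionBounds
end Torsion

/-! ### The Dirichlet Laplacian: test functions, graph and symmetry. -/

namespace Torsion

section DirichletForm

variable {d : ℕ}

theorem memLp_restrict_of_hasCompactSupport {g : Eucl d → ℂ} (hg : Continuous g)
    (hc : HasCompactSupport g) (Ω : Set (Eucl d)) : MemLp g 2 (volume.restrict Ω) :=
  (hg.memLp_of_hasCompactSupport hc (μ := volume)).restrict Ω

/-- The partial derivative `∂_i g`. -/
noncomputable def partialDeriv {F : Type*} [NormedAddCommGroup F] [NormedSpace ℝ F] (i : Fin d)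
    (g : Eucl d → F) (x : Eucl d) : F :=
  fderiv ℝ g x (EuclideanSpace.single i (1 : ℝ))

section PartialDeriv

variable {F : Type*} [NormedAddCommGroup F] [NormedSpace ℝ F]

theorem _root_.ContDiff.partialDeriv {g : Eucl d → F} (hg : ContDiff ℝ (⊤ : ℕ∞) g) (i : Fin d) :
    ContDiff ℝ (⊤ : ℕ∞) (partialDeriv i g) :=
  (hg.fderiv_right (m := (⊤ : ℕ∞)) (by norm_cast)).clm_apply contDiff_const

theorem _root_.HasCompactSupport.partialDeriv {g : Eucl d → F} (hc : HasCompactSupport g)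
    (i : Fin d) : HasCompactSupport (partialDeriv i g) :=
  hc.fderiv_apply (𝕜 := ℝ) _

theorem norm_single_one (i : Fin d) : ‖(EuclideanSpace.single i (1 : ℝ) : Eucl d)‖ = 1 := by simp

end PartialDeriv

variable {D : TopologicalSpace.Opens (Eucl d)}

theorem contDiff_testFunction (φ : 𝓓(D, ℂ)) : ContDiff ℝ (⊤ : ℕ∞) φ := φ.contDiff

/-- The pair `(φ, ∇φ)` in `L_2(D) × L_2(D)^d`, for a test function `φ`. -/
noncomputable def testPair (D : TopologicalSpace.Opens (Eucl d)) :
    𝓓(D, ℂ) →ₗ[ℂ] L2 (D : Set (Eucl d)) × (Fin d → L2 (D : Set (Eucl d))) where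
  toFun φ := ((memLp_restrict_of_hasCompactSupport φ.continuous φ.hasCompactSupport D).toLp,
    fun i => (memLp_restrict_of_hasCompactSupport
      ((contDiff_testFunction φ).partialDeriv i).continuous
      (φ.hasCompactSupport.partialDeriv i) D).toLp)
  map_add' φ ψ := by
    refine Prod.ext ?_ (funext fun i => ?_)
    · simp only [Prod.mk_add_mk, ← MemLp.toLp_add]
      exact MemLp.toLp_congr _ _ (Eventually.of_forall fun x => by simp)
    · simp only [Prod.mk_add_mk, Pi.add_apply, ← MemLp.toLp_add]
      refine MemLp.toLp_congr _ _ (Eventually.of_forall fun x => ?_)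
      simp only [partialDeriv, Pi.add_apply, FunLike.coe_add]
      rw [fderiv_add ((contDiff_testFunction φ).differentiable (by simp) x)
        ((contDiff_testFunction ψ).differentiable (by simp) x)]
      simp
  map_smul' c φ := by
    refine Prod.ext ?_ (funext fun i => ?_)
    · simp only [Prod.smul_mk, RingHom.id_apply, ← MemLp.toLp_const_smul]
      exact MemLp.toLp_congr _ _ (Eventually.of_forall fun x => by simp)
    · simp only [Prod.smul_mk, Pi.smul_apply, RingHom.id_apply, ← MemLp.toLp_const_smul]
      refine MemLp.toLp_congr _ _ (Eventually.of_forall fun x => ?_)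
      simp only [partialDeriv, Pi.smul_apply, FunLike.coe_smul]
      rw [fderiv_const_smul ((contDiff_testFunction φ).differentiable (by simp) x)]
      simp

theorem coeFn_testPair_fst (φ : 𝓓(D, ℂ)) :
    (testPair D φ).1 =ᵐ[volume.restrict (D : Set (Eucl d))] φ :=
  (memLp_restrict_of_hasCompactSupport φ.continuous φ.hasCompactSupport D).coeFn_toLp

theorem coeFn_testPair_snd (φ : 𝓓(D, ℂ)) (i : Fin d) :
    (testPair D φ).2 i =ᵐ[volume.restrict (D : Set (Eucl d))] partialDeriv i φ :=
  (memLp_restrict_of_hasCompactSupport ((contDiff_testFunction φ).partialDeriv i).continuous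
    (φ.hasCompactSupport.partialDeriv i) D).coeFn_toLp

/-- The pairs from test functions already form a subspace, so the span adds nothing and every
element is a limit of such pairs, not merely of linear combinations. -/
theorem h10Graph_eq : h10Graph D = (LinearMap.range (testPair D)).topologicalClosure := by
  rw [h10Graph]
  congr 1
  have h : {p : L2 (D : Set (Eucl d)) × (Fin d → L2 (D : Set (Eucl d))) | ∃ φ : 𝓓(D, ℂ),
    (p.1 =ᵐ[(volume : Measure (Eucl d)).restrict D] fun x => φ x) ∧
    ∀ i, p.2 i =ᵐ[(volume : Measure (Eucl d)).restrict D]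
      fun x => fderiv ℝ (fun y => φ y) x (EuclideanSpace.single i (1 : ℝ))} =
      (LinearMap.range (testPair D) : Set _) := by
    ext p
    constructor
    · rintro ⟨φ, h1, h2⟩
      refine ⟨φ, Prod.ext (Lp.ext ((coeFn_testPair_fst φ).trans h1.symm)) (funext fun i => ?_)⟩
      exact Lp.ext ((coeFn_testPair_snd φ i).trans (h2 i).symm)
    · rintro ⟨φ, rfl⟩
      exact ⟨φ, coeFn_testPair_fst φ, coeFn_testPair_snd φ⟩
  rw [h, Submodule.span_eq]

theorem testPair_mem (φ : 𝓓(D, ℂ)) : testPair D φ ∈ h10Graph D := by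
  rw [h10Graph_eq]
  exact Submodule.le_topologicalClosure _ ⟨φ, rfl⟩

theorem exists_tendsto_testPair {p : L2 (D : Set (Eucl d)) × (Fin d → L2 (D : Set (Eucl d)))}
    (hp : p ∈ h10Graph D) :
    ∃ φ : ℕ → 𝓓(D, ℂ), Tendsto (fun n => testPair D (φ n)) atTop (𝓝 p) := by
  rw [h10Graph_eq, ← SetLike.mem_coe, Submodule.topologicalClosure_coe,
    mem_closure_iff_seq_limit] at hp
  obtain ⟨x, hx, hlim⟩ := hp
  choose φ hφ using hx
  exact ⟨φ, by simpa only [hφ] using hlim⟩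

/-- The fundamental lemma of the calculus of variations; real-valued test functions suffice. -/
theorem eq_zero_of_inner_testPair {f : L2 (D : Set (Eucl d))}
    (h : ∀ φ : 𝓓(D, ℂ), inner ℂ (testPair D φ).1 f = 0) : f = 0 := by
  refine Lp.ext ?_
  have hloc : LocallyIntegrableOn (f : Eucl d → ℂ) (D : Set (Eucl d)) volume := by
    refine (locallyIntegrableOn_iff D.isOpen.isLocallyClosed).2 fun K hK hKc => ?_
    have h1 : MemLp f 2 (volume.restrict K) :=
      (Lp.memLp f).mono_measure (Measure.restrict_mono hK le_rfl)
    have : IsFiniteMeasure ((volume : Measure (Eucl d)).restrict K) :=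
      ⟨by rw [Measure.restrict_apply_univ]; exact hKc.measure_lt_top⟩
    exact h1.integrable (by norm_num)
  have key := D.isOpen.ae_eq_zero_of_integral_contDiff_smul_eq_zero hloc fun g hg hc hs => ?_
  · filter_upwards [(ae_restrict_iff' D.isOpen.measurableSet).2 key,
      Lp.coeFn_zero ℂ 2 (volume.restrict (D : Set (Eucl d)))] with x h1 h2
    rw [h1, h2, Pi.zero_apply]
  · have hs' : Function.support (fun x => (g x : ℂ)) = Function.support g := by
      ext x; simp
    let φ : 𝓓(D, ℂ) := ⟨fun x => (g x : ℂ), Complex.ofRealCLM.contDiff.comp hg,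
      by rw [HasCompactSupport, tsupport, hs']; exact hc, by rw [tsupport, hs']; exact hs⟩
    have h1 := h φ
    rw [L2.inner_def] at h1
    have h0 : ∀ x, x ∉ (D : Set (Eucl d)) → g x • f x = 0 := fun x hx => by
      rw [image_eq_zero_of_notMem_tsupport fun hx' => hx (hs hx'), zero_smul]
    rw [← setIntegral_eq_integral_of_forall_compl_eq_zero h0, ← h1]
    refine integral_congr_ae ?_
    filter_upwards [coeFn_testPair_fst φ] with x hx
    rw [hx]
    have hφ : φ x = (g x : ℂ) := rfl
    simp [hφ, RCLike.inner_apply, mul_comm]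

/-- The pair `(0, G)` is itself admissible as a test pair, which gives `∑ ‖G i‖² = 0`. Closability
of the gradient is thus not needed; afterwards test functions show `f = 0`. -/
theorem dirichletGraph_functional (f : L2 (D : Set (Eucl d)))
    (h : ((0 : L2 (D : Set (Eucl d))), f) ∈ dirichletGraph D) : f = 0 := by
  obtain ⟨G, hG, h⟩ := h
  have h1 := h _ _ hG
  rw [inner_zero_left, Finset.sum_congr rfl fun i _ => inner_self_eq_norm_sq_to_K (G i)] at h1
  have h2 : ∑ i, ‖G i‖ ^ 2 = 0 := by
    have := congrArg Complex.re h1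
    simpa [← Complex.ofReal_pow] using this
  have hG0 : ∀ i, G i = 0 := fun i => by
    have := (Finset.sum_eq_zero_iff_of_nonneg fun i _ => by positivity).1 h2 i (Finset.mem_univ i)
    simpa using this
  refine eq_zero_of_inner_testPair fun φ => ?_
  exact (h _ _ (testPair_mem φ)).symm.trans (by simp [hG0])

theorem graph_negDirichletLaplacian :
    (negDirichletLaplacian D).graph = dirichletGraph D := by
  refine Submodule.toLinearPMap_graph_eq _ fun x hx hx0 => ?_
  obtain ⟨u, f⟩ := x
  obtain rfl : u = 0 := hx0
  exact dirichletGraph_functional f hx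

theorem dirichletGraph_symmetric (u f v g : L2 (D : Set (Eucl d)))
    (hu : (u, f) ∈ (negDirichletLaplacian D).graph)
    (hv : (v, g) ∈ (negDirichletLaplacian D).graph) : inner ℂ f v = inner ℂ u g := by
  rw [graph_negDirichletLaplacian] at hu hv
  obtain ⟨G, hG, hu⟩ := hu
  obtain ⟨K, hK, hv⟩ := hv
  have h1 := hu _ _ hK
  have h2 := hv _ _ hG
  simp only at h1 h2
  rw [← h2, ← inner_conj_symm, ← h1, map_sum]
  exact Finset.sum_congr rfl fun i _ => inner_conj_symm _ _

/-- Symmetry together with the bounded inverse provided by `h0` is enough; selfadjointness of the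
operator need not be established separately. -/
theorem isInverseAbove_dirichlet (h0 : 0 < bottomSpectrum (negDirichletLaplacian D)) :
    IsInverseAbove (boundedInverse (negDirichletLaplacian D))
      (bottomSpectrum (negDirichletLaplacian D)) :=
  (boundedInverse_spec h0).isInverseAbove h0 dirichletGraph_symmetric

end DirichletForm

end Torsion

/-! ### A smooth convex substitute for the positive part. -/

namespace Torsion

section Ramp

open Real (smoothTransition)

/-- A smooth convex approximation of the positive part. -/
noncomputable def ramp (x : ℝ) : ℝ := ∫ y in (0 : ℝ)..x, smoothTransition y

theorem hasDerivAt_ramp (x : ℝ) : HasDerivAt ramp (smoothTransition x) x :=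
  Real.smoothTransition.continuous.integral_hasStrictDerivAt 0 x |>.hasDerivAt

theorem differentiable_ramp : Differentiable ℝ ramp := fun x => (hasDerivAt_ramp x).differentiableAt

theorem deriv_ramp : deriv ramp = smoothTransition := funext fun x => (hasDerivAt_ramp x).deriv

theorem contDiff_ramp : ContDiff ℝ (⊤ : ℕ∞) ramp :=
  contDiff_infty_iff_deriv.2 ⟨differentiable_ramp, by
    rw [deriv_ramp]; exact Real.smoothTransition.contDiff⟩

@[simp]
theorem ramp_zero : ramp 0 = 0 := by simp [ramp]

/-- Convexity: the graph of `ramp` lies above its tangent at `v`. -/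
theorem ramp_sub_le (u v : ℝ) : ramp v - ramp u ≤ smoothTransition v * (v - u) := by
  rcases lt_trichotomy u v with h | rfl | h
  · obtain ⟨ξ, hξ, he⟩ := exists_hasDerivAt_eq_slope ramp smoothTransition h
      differentiable_ramp.continuous.continuousOn fun x _ => hasDerivAt_ramp x
    rw [eq_div_iff (by linarith)] at he
    rw [← he]
    exact mul_le_mul_of_nonneg_right (Real.smoothTransition.monotone hξ.2.le) (by linarith)
  · simp
  · obtain ⟨ξ, hξ, he⟩ := exists_hasDerivAt_eq_slope ramp smoothTransition h
      differentiable_ramp.continuous.continuousOn fun x _ => hasDerivAt_ramp x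
    rw [eq_div_iff (by linarith)] at he
    have := mul_le_mul_of_nonneg_right (Real.smoothTransition.monotone hξ.1.le)
      (sub_nonneg.2 h.le)
    linarith

theorem ramp_nonneg (x : ℝ) : 0 ≤ ramp x := by
  have h := ramp_sub_le x 0
  simp only [Real.smoothTransition.zero, zero_mul, ramp_zero] at h
  linarith

theorem abs_ramp_sub_le (u v : ℝ) : |ramp u - ramp v| ≤ |u - v| := by
  have key : ∀ u v : ℝ, ramp v - ramp u ≤ |v - u| := fun u v => by
    refine (ramp_sub_le u v).trans ((le_abs_self _).trans ?_)
    rw [abs_mul, abs_of_nonneg (Real.smoothTransition.nonneg v)]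
    exact mul_le_of_le_one_left (abs_nonneg _) (Real.smoothTransition.le_one v)
  rw [abs_le]
  have h1 := key u v
  have h2 := key v u
  rw [abs_sub_comm] at h1
  constructor <;> linarith

theorem ramp_le_abs (x : ℝ) : ramp x ≤ |x| := by
  have := abs_ramp_sub_le x 0
  rw [ramp_zero, sub_zero, sub_zero] at this
  exact (le_abs_self _).trans this

theorem sub_one_le_ramp (x : ℝ) : x - 1 ≤ ramp x := by
  have h := ramp_sub_le x 1
  rw [Real.smoothTransition.one, one_mul] at h
  have := ramp_nonneg 1
  linarith

/-- The derivative is continuous and vanishes outside `[0, 1]`. The Lipschitz bound makes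
composition with the step a continuous map of `L_2`. -/
theorem exists_lipschitzWith_smoothTransition : ∃ K : ℝ≥0, LipschitzWith K smoothTransition := by
  have hc : Continuous (deriv smoothTransition) :=
    Real.smoothTransition.contDiff (n := 1).continuous_deriv le_rfl
  obtain ⟨C, hC⟩ := isCompact_Icc.exists_bound_of_continuousOn (s := Set.Icc (0 : ℝ) 1)
    hc.continuousOn
  have hC0 : 0 ≤ C := (norm_nonneg _).trans (hC 0 ⟨le_rfl, zero_le_one⟩)
  refine ⟨C.toNNReal, lipschitzWith_of_nnnorm_deriv_le
    (Real.smoothTransition.contDiff (n := 1).differentiable (by simp)) fun x => ?_⟩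
  rw [← NNReal.coe_le_coe, coe_nnnorm, Real.coe_toNNReal _ hC0]
  rcases lt_or_ge x 0 with h | h
  · have : smoothTransition =ᶠ[𝓝 x] fun _ => 0 := by
      filter_upwards [Iio_mem_nhds h] with y hy
      exact Real.smoothTransition.zero_of_nonpos (le_of_lt hy)
    rw [this.deriv_eq]; simpa using hC0
  rcases lt_or_ge 1 x with h' | h'
  · have : smoothTransition =ᶠ[𝓝 x] fun _ => 1 := by
      filter_upwards [Ioi_mem_nhds h'] with y hy
      exact Real.smoothTransition.one_of_one_le (le_of_lt hy)
    rw [this.deriv_eq]; simpa using hC0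
  exact hC x ⟨h, h'⟩

/-- `ramp (Re z)`. -/
noncomputable def rampRe (z : ℂ) : ℂ := (ramp z.re : ℝ)

/-- The derivative of `ramp` at `Re z`. -/
noncomputable def stepRe (z : ℂ) : ℂ := (smoothTransition z.re : ℝ)

theorem rampRe_zero : rampRe 0 = 0 := by simp [rampRe]

theorem stepRe_zero : stepRe 0 = 0 := by simp [stepRe]

theorem lipschitzWith_rampRe : LipschitzWith 1 rampRe := by
  refine LipschitzWith.of_dist_le_mul fun z w => ?_
  rw [dist_eq_norm, dist_eq_norm, rampRe, rampRe, ← Complex.ofReal_sub, Complex.norm_real,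
    Real.norm_eq_abs, NNReal.coe_one, one_mul]
  refine (abs_ramp_sub_le _ _).trans ?_
  rw [← Complex.sub_re]
  exact Complex.abs_re_le_norm _

/-- A Lipschitz constant of the smooth step. -/
noncomputable def stepLip : ℝ≥0 := exists_lipschitzWith_smoothTransition.choose

theorem lipschitzWith_smoothTransition : LipschitzWith stepLip smoothTransition :=
  exists_lipschitzWith_smoothTransition.choose_spec

theorem lipschitzWith_stepRe : LipschitzWith stepLip stepRe := by
  refine LipschitzWith.of_dist_le_mul fun z w => ?_
  have h := lipschitzWith_smoothTransition.dist_le_mul z.re w.re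
  rw [Real.dist_eq, Real.dist_eq] at h
  rw [dist_eq_norm, dist_eq_norm, stepRe, stepRe, ← Complex.ofReal_sub, Complex.norm_real,
    Real.norm_eq_abs]
  refine h.trans ?_
  rw [← Complex.sub_re]
  gcongr
  exact Complex.abs_re_le_norm _

end Ramp

/-! ### Calculus of the weighted test functions. -/

section KatoInequality

open scoped BoundedContinuousFunction

variable {d : ℕ} {D : TopologicalSpace.Opens (Eucl d)}

/-- The Laplacian `∑ ∂_i ∂_i w`. -/
noncomputable def laplace (w : Eucl d → ℝ) (x : Eucl d) : ℝ :=
  ∑ i, partialDeriv i (partialDeriv i w) x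

/-- `ramp (Re f)` in `L_2`. -/
noncomputable def rampL2 {Ω : Set (Eucl d)} (f : L2 Ω) : L2 Ω :=
  lipschitzWith_rampRe.compLp rampRe_zero f

/-- `stepRe f` in `L_2`. -/
noncomputable def stepL2 {Ω : Set (Eucl d)} (f : L2 Ω) : L2 Ω :=
  lipschitzWith_stepRe.compLp stepRe_zero f

theorem coeFn_rampL2 {Ω : Set (Eucl d)} (f : L2 Ω) :
    rampL2 f =ᵐ[volume.restrict Ω] fun x => rampRe (f x) :=
  LipschitzWith.coeFn_compLp _ _ _

theorem coeFn_stepL2 {Ω : Set (Eucl d)} (f : L2 Ω) :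
    stepL2 f =ᵐ[volume.restrict Ω] fun x => stepRe (f x) :=
  LipschitzWith.coeFn_compLp _ _ _

theorem continuous_rampL2 {Ω : Set (Eucl d)} : Continuous (rampL2 : L2 Ω → L2 Ω) :=
  lipschitzWith_rampRe.continuous_compLp rampRe_zero

theorem continuous_stepL2 {Ω : Set (Eucl d)} : Continuous (stepL2 : L2 Ω → L2 Ω) :=
  lipschitzWith_stepRe.continuous_compLp stepRe_zero

theorem partialDeriv_re (i : Fin d) {g : Eucl d → ℂ} (hg : Differentiable ℝ g) (x : Eucl d) :
    partialDeriv i (fun y => (g y).re) x = (partialDeriv i g x).re := by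
  have := (Complex.reCLM.hasFDerivAt.comp x (hg x).hasFDerivAt).fderiv
  simp only [partialDeriv]
  rw [show (fun y => (g y).re) = Complex.reCLM ∘ g from rfl, this]
  rfl

theorem partialDeriv_ofReal (i : Fin d) {g : Eucl d → ℝ} (hg : Differentiable ℝ g) (x : Eucl d) :
    partialDeriv i (fun y => (g y : ℂ)) x = (partialDeriv i g x : ℝ) := by
  have := (Complex.ofRealCLM.hasFDerivAt.comp x (hg x).hasFDerivAt).fderiv
  simp only [partialDeriv]
  rw [show (fun y => (g y : ℂ)) = Complex.ofRealCLM ∘ g from rfl, this]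
  rfl

theorem partialDeriv_mul (i : Fin d) {g h : Eucl d → ℝ} (hg : Differentiable ℝ g)
    (hh : Differentiable ℝ h) (x : Eucl d) :
    partialDeriv i (fun y => g y * h y) x = partialDeriv i g x * h x + g x * partialDeriv i h x := by
  simp only [partialDeriv]
  rw [fderiv_fun_mul (hg x) (hh x)]
  simp
  ring

theorem partialDeriv_comp (i : Fin d) {g : Eucl d → ℝ} {s : ℝ → ℝ} (hg : Differentiable ℝ g)
    (hs : Differentiable ℝ s) (x : Eucl d) :
    partialDeriv i (fun y => s (g y)) x = deriv s (g x) * partialDeriv i g x := by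
  simp only [partialDeriv]
  have := ((hs (g x)).hasDerivAt.comp_hasFDerivAt x (hg x).hasFDerivAt).fderiv
  rw [show (fun y => s (g y)) = s ∘ g from rfl, this]
  simp

theorem norm_partialDeriv_le (i : Fin d) (g : Eucl d → ℝ) (x : Eucl d) :
    ‖partialDeriv i g x‖ ≤ ‖fderiv ℝ g x‖ := by
  have := (fderiv ℝ g x).le_opNorm (EuclideanSpace.single i (1 : ℝ))
  rwa [norm_single_one, mul_one] at this

/-- For a weight `w` and a test function `φ`, the test function `w · stepRe φ`. -/
noncomputable def weightedStep {w : Eucl d → ℝ} (hw : ContDiff ℝ (⊤ : ℕ∞) w) (φ : 𝓓(D, ℂ)) :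
    𝓓(D, ℂ) :=
  have hsub : Function.support (fun x => ((w x * Real.smoothTransition (φ x).re : ℝ) : ℂ)) ⊆
      Function.support φ := fun x hx hφ => hx (by simp [hφ])
  { toFun := fun x => ((w x * Real.smoothTransition (φ x).re : ℝ) : ℂ)
    contDiff' := Complex.ofRealCLM.contDiff.comp (hw.mul (Real.smoothTransition.contDiff.comp
      (Complex.reCLM.contDiff.comp (contDiff_testFunction φ))))
    hasCompactSupport' := φ.hasCompactSupport.mono hsub
    tsupport_subset' := (closure_mono hsub).trans φ.tsupport_subset }

theorem weightedStep_apply {w : Eucl d → ℝ} (hw : ContDiff ℝ (⊤ : ℕ∞) w) (φ : 𝓓(D, ℂ))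
    (x : Eucl d) : weightedStep hw φ x = ((w x * Real.smoothTransition (φ x).re : ℝ) : ℂ) := rfl

theorem partialDeriv_weightedStep {w : Eucl d → ℝ} (hw : ContDiff ℝ (⊤ : ℕ∞) w) (φ : 𝓓(D, ℂ))
    (i : Fin d) (x : Eucl d) : partialDeriv i (weightedStep hw φ) x =
      ((partialDeriv i w x * Real.smoothTransition (φ x).re +
        w x * (deriv Real.smoothTransition (φ x).re * (partialDeriv i φ x).re) : ℝ) : ℂ) := by
  have h1 : Differentiable ℝ (fun x => (φ x).re) :=
    Complex.reCLM.differentiable.comp ((contDiff_testFunction φ).differentiable (by simp))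
  have h2 : Differentiable ℝ Real.smoothTransition :=
    (Real.smoothTransition.contDiff (n := 1)).differentiable (by simp)
  have h3 : Differentiable ℝ w := hw.differentiable (by simp)
  change partialDeriv i (fun x => ((w x * Real.smoothTransition (φ x).re : ℝ) : ℂ)) x = _
  have h4 : Differentiable ℝ fun x => Real.smoothTransition (φ x).re := h2.comp h1
  have h5 : Differentiable ℝ fun x => w x * Real.smoothTransition (φ x).re := h3.mul h4
  rw [partialDeriv_ofReal i h5, partialDeriv_mul i h3 h4,
    partialDeriv_comp i h1 h2, partialDeriv_re i ((contDiff_testFunction φ).differentiable (by simp))]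

end KatoInequality
end Torsion

/-! ### Kato's inequality. -/

namespace Torsion

section KatoLimit

open scoped BoundedContinuousFunction

variable {d : ℕ} {D : TopologicalSpace.Opens (Eucl d)}

theorem testFunction_eq_zero (φ : 𝓓(D, ℂ)) {x : Eucl d} (hx : x ∉ (D : Set (Eucl d))) : φ x = 0 :=
  image_eq_zero_of_notMem_tsupport fun h => hx (φ.tsupport_subset h)

theorem partialDeriv_testFunction_eq_zero (φ : 𝓓(D, ℂ)) (i : Fin d) {x : Eucl d}
    (hx : x ∉ (D : Set (Eucl d))) : partialDeriv i φ x = 0 := by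
  have h : fderiv ℝ φ x = 0 := image_eq_zero_of_notMem_tsupport fun h =>
    hx (φ.tsupport_subset (tsupport_fderiv_subset ℝ h))
  rw [partialDeriv, h]
  rfl

/-- With `S = ramp'` and `φ` real, `∇(w S(φ))·∇φ = ∇w·∇ramp(φ) + w S'(φ)|∇φ|²`. The last term is
nonnegative, and integration by parts moves the gradient of `ramp(φ)` onto `∇w`. -/
theorem laplace_pairing_le {w : Eucl d → ℝ} (hw : ContDiff ℝ (⊤ : ℕ∞) w) (hw0 : ∀ x, 0 ≤ w x)
    (φ : 𝓓(D, ℂ)) :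
    -∫ x, laplace w x * ramp (φ x).re ≤
      ∑ i, ∫ x, (partialDeriv i (weightedStep hw φ) x).re * (partialDeriv i φ x).re := by
  have hφd : Differentiable ℝ φ := (contDiff_testFunction φ).differentiable (by simp)
  have hψ : ContDiff ℝ (⊤ : ℕ∞) fun x => (φ x).re :=
    Complex.reCLM.contDiff.comp (contDiff_testFunction φ)
  have hg : ContDiff ℝ (⊤ : ℕ∞) fun x => ramp (φ x).re := contDiff_ramp.comp hψ
  have hgc : HasCompactSupport fun x => ramp (φ x).re :=
    φ.hasCompactSupport.mono fun x hx hφ => hx (by simp [hφ])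
  have hwi : ∀ i, ContDiff ℝ (⊤ : ℕ∞) (partialDeriv i w) := fun i => hw.partialDeriv i
  have hwii : ∀ i, ContDiff ℝ (⊤ : ℕ∞) (partialDeriv i (partialDeriv i w)) := fun i =>
    (hwi i).partialDeriv i
  have hibp : ∀ i, ∫ x, partialDeriv i w x * partialDeriv i (fun y => ramp (φ y).re) x =
      -∫ x, partialDeriv i (partialDeriv i w) x * ramp (φ x).re := fun i => by
    refine integral_mul_fderiv_eq_neg_fderiv_mul_of_integrable ?_ ?_ ?_ (fun x _ =>
      (hwi i).differentiable (by simp) x) (fun x _ => hg.differentiable (by simp) x)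
    · exact ((hwii i).continuous.mul hg.continuous).integrable_of_hasCompactSupport hgc.mul_left
    · exact ((hwi i).continuous.mul (hg.partialDeriv i).continuous).integrable_of_hasCompactSupport
        (hgc.partialDeriv i).mul_left
    · exact ((hwi i).continuous.mul hg.continuous).integrable_of_hasCompactSupport hgc.mul_left
  have hsum : ∫ x, laplace w x * ramp (φ x).re =
      ∑ i, ∫ x, partialDeriv i (partialDeriv i w) x * ramp (φ x).re := by
    rw [← integral_finsetSum]
    · simp only [laplace, Finset.sum_mul]
    · exact fun i _ => ((hwii i).continuous.mul hg.continuous).integrable_of_hasCompactSupport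
        hgc.mul_left
  rw [hsum, ← Finset.sum_neg_distrib]
  refine Finset.sum_le_sum fun i _ => ?_
  rw [← hibp i]
  have hpc : HasCompactSupport fun x => (partialDeriv i φ x).re :=
    (φ.hasCompactSupport.partialDeriv i).comp_left (g := Complex.re) rfl
  refine integral_mono ?_ ?_ fun x => ?_
  · exact ((hwi i).continuous.mul (hg.partialDeriv i).continuous).integrable_of_hasCompactSupport
      (hgc.partialDeriv i).mul_left
  · exact ((Complex.continuous_re.comp
      ((contDiff_testFunction (weightedStep hw φ)).partialDeriv i).continuous).mul
      (Complex.continuous_re.comp ((contDiff_testFunction φ).partialDeriv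
        i).continuous)).integrable_of_hasCompactSupport hpc.mul_left
  · simp only
    rw [partialDeriv_weightedStep, Complex.ofReal_re,
      partialDeriv_comp i (hψ.differentiable (by simp)) differentiable_ramp, deriv_ramp,
      partialDeriv_re i hφd]
    have h1 : 0 ≤ deriv Real.smoothTransition (φ x).re := Real.smoothTransition.monotone.deriv_nonneg
    have h2 : 0 ≤ w x * (deriv Real.smoothTransition (φ x).re * (partialDeriv i φ x).re) *
        (partialDeriv i φ x).re := by
      rw [mul_assoc, mul_assoc, ← sq]
      exact mul_nonneg (hw0 x) (mul_nonneg h1 (sq_nonneg _))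
    linarith

theorem re_inner_eq_integral {Ω : Set (Eucl d)} (f g : L2 Ω) :
    (inner ℂ f g).re = ∫ x in Ω, (inner ℂ (f x) (g x)).re := by
  rw [L2.inner_def]
  exact (integral_re (L2.integrable_inner (𝕜 := ℂ) f g)).symm

theorem coeFn_rampL2_testPair (φ : 𝓓(D, ℂ)) :
    rampL2 (testPair D φ).1 =ᵐ[volume.restrict (D : Set (Eucl d))] fun x => rampRe (φ x) := by
  filter_upwards [coeFn_rampL2 (testPair D φ).1, coeFn_testPair_fst φ] with x h1 h2
  rw [h1, h2]

theorem testPair_weightedStep_fst {w : Eucl d → ℝ} (hw : ContDiff ℝ (⊤ : ℕ∞) w)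
    {W : Eucl d →ᵇ ℂ} (hW : ∀ x, W x = w x) (φ : 𝓓(D, ℂ)) :
    (testPair D (weightedStep hw φ)).1 = mulL2 _ W (stepL2 (testPair D φ).1) := by
  refine Lp.ext ?_
  filter_upwards [coeFn_testPair_fst (weightedStep hw φ), coeFn_mulL2 W (stepL2 (testPair D φ).1),
    coeFn_stepL2 (testPair D φ).1, coeFn_testPair_fst φ] with x h1 h2 h3 h4
  rw [h1, h2, h3, h4, weightedStep_apply, hW, stepRe, Complex.ofReal_mul]

theorem neg_re_inner_laplace_le {w : Eucl d → ℝ} (hw : ContDiff ℝ (⊤ : ℕ∞) w)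
    (hw0 : ∀ x, 0 ≤ w x) {L : L2 (D : Set (Eucl d))}
    (hL : L =ᵐ[volume.restrict (D : Set (Eucl d))] fun x => (laplace w x : ℂ)) (φ : 𝓓(D, ℂ)) :
    -(inner ℂ L (rampL2 (testPair D φ).1)).re ≤
      ∑ i, (inner ℂ ((testPair D (weightedStep hw φ)).2 i) ((testPair D φ).2 i)).re := by
  have h1 : (inner ℂ L (rampL2 (testPair D φ).1)).re = ∫ x, laplace w x * ramp (φ x).re := by
    rw [re_inner_eq_integral, ← setIntegral_eq_integral_of_forall_compl_eq_zero
      (f := fun x => laplace w x * ramp (φ x).re) (s := (D : Set (Eucl d))) fun x hx => by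
        rw [testFunction_eq_zero φ hx]; simp]
    refine integral_congr_ae ?_
    filter_upwards [hL, coeFn_rampL2_testPair φ] with x h2 h3
    rw [h2, h3]
    simp [rampRe, RCLike.inner_apply, mul_comm]
  have h2 : ∀ i, (inner ℂ ((testPair D (weightedStep hw φ)).2 i) ((testPair D φ).2 i)).re =
      ∫ x, (partialDeriv i (weightedStep hw φ) x).re * (partialDeriv i φ x).re := fun i => by
    rw [re_inner_eq_integral, ← setIntegral_eq_integral_of_forall_compl_eq_zero
      (f := fun x => (partialDeriv i (weightedStep hw φ) x).re * (partialDeriv i φ x).re)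
      (s := (D : Set (Eucl d))) fun x hx => by
        rw [partialDeriv_testFunction_eq_zero φ i hx]; simp]
    refine integral_congr_ae ?_
    filter_upwards [coeFn_testPair_snd (weightedStep hw φ) i, coeFn_testPair_snd φ i] with x h2 h3
    rw [h2, h3, partialDeriv_weightedStep]
    simp only [RCLike.inner_apply, Complex.conj_ofReal, Complex.re_mul_ofReal, Complex.ofReal_re]
    ring
  rw [h1]
  simp only [h2]
  exact laplace_pairing_le hw hw0 φ

/-- In the passage to the limit the gradients of `w·stepRe φ` are paired with a null sequence, so a
bound for them suffices and their convergence is not required. -/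
theorem norm_testPair_weightedStep_le {w : Eucl d → ℝ} (hw : ContDiff ℝ (⊤ : ℕ∞) w)
    {C : ℝ} (hC : ∀ x, |w x| ≤ C) (hC' : ∀ x, ‖fderiv ℝ w x‖ ≤ C) (φ : 𝓓(D, ℂ)) (i : Fin d) :
    ‖(testPair D (weightedStep hw φ)).2 i‖ ≤
      C * stepLip * (‖(testPair D φ).1‖ + ‖(testPair D φ).2 i‖) := by
  have hC0 : 0 ≤ C := (abs_nonneg _).trans (hC 0)
  have hmem : MemLp (fun x => ‖(testPair D φ).1 x‖ + ‖(testPair D φ).2 i x‖) 2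
      (volume.restrict (D : Set (Eucl d))) := (Lp.memLp _).norm.add (Lp.memLp _).norm
  have h1 : ‖hmem.toLp‖ ≤ ‖(testPair D φ).1‖ + ‖(testPair D φ).2 i‖ := by
    have e : hmem.toLp = (Lp.memLp (testPair D φ).1).norm.toLp +
      (Lp.memLp ((testPair D φ).2 i)).norm.toLp := rfl
    rw [e]
    refine (norm_add_le _ _).trans_eq ?_
    rw [Lp.norm_toLp, Lp.norm_toLp, eLpNorm_norm, eLpNorm_norm, ← Lp.norm_def, ← Lp.norm_def]
  refine (Lp.norm_le_mul_norm_of_ae_le_mul (g := hmem.toLp) (c := C * stepLip) ?_).trans ?_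
  · filter_upwards [coeFn_testPair_snd (weightedStep hw φ) i, coeFn_testPair_snd φ i,
      coeFn_testPair_fst φ, hmem.coeFn_toLp] with x h1 h2 h3 h4
    rw [h1, h4, h2, h3, partialDeriv_weightedStep, Complex.norm_real]
    have hs : |Real.smoothTransition (φ x).re| ≤ stepLip * ‖φ x‖ := by
      have := lipschitzWith_smoothTransition.dist_le_mul (φ x).re 0
      rw [Real.dist_eq, Real.dist_eq, Real.smoothTransition.zero, sub_zero, sub_zero] at this
      exact this.trans (by gcongr; exact Complex.abs_re_le_norm _)
    have hs' : |deriv Real.smoothTransition (φ x).re| ≤ stepLip :=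
      norm_deriv_le_of_lipschitz lipschitzWith_smoothTransition
    have hre := Complex.abs_re_le_norm (partialDeriv i φ x)
    have hpw : |partialDeriv i w x| ≤ C := (norm_partialDeriv_le i w x).trans (hC' x)
    rw [Real.norm_eq_abs, Real.norm_of_nonneg (by positivity)]
    calc _ ≤ |partialDeriv i w x| * |Real.smoothTransition (φ x).re| +
          |w x| * (|deriv Real.smoothTransition (φ x).re| * |(partialDeriv i φ x).re|) := by
          rw [← abs_mul, ← abs_mul, ← abs_mul]
          exact abs_add_le _ _
      _ ≤ C * (stepLip * ‖φ x‖) + C * (stepLip * ‖partialDeriv i φ x‖) := by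
          gcongr
          exact hC x
      _ = _ := by ring
  · gcongr

/-- Kato's inequality for the Dirichlet Laplacian: `-∫ ramp (Re u) Δw ≤ ∫ w stepRe (u) Re (Hu)`. -/
theorem kato_inequality {w : Eucl d → ℝ} (hw : ContDiff ℝ (⊤ : ℕ∞) w) (hw0 : ∀ x, 0 ≤ w x)
    {C : ℝ} (hC' : ∀ x, ‖fderiv ℝ w x‖ ≤ C) {W : Eucl d →ᵇ ℂ} (hW : ∀ x, W x = w x)
    {L : L2 (D : Set (Eucl d))}
    (hL : L =ᵐ[volume.restrict (D : Set (Eucl d))] fun x => (laplace w x : ℂ))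
    {u f : L2 (D : Set (Eucl d))} (h : (u, f) ∈ dirichletGraph D) :
    -(inner ℂ L (rampL2 u)).re ≤ (inner ℂ (mulL2 _ W (stepL2 u)) f).re := by
  obtain ⟨G, hG, h⟩ := h
  obtain ⟨φ, hφ⟩ := exists_tendsto_testPair hG
  have hφ1 : Tendsto (fun n => (testPair D (φ n)).1) atTop (𝓝 u) :=
    (continuous_fst.tendsto _).comp hφ
  have hφ2 : ∀ i, Tendsto (fun n => (testPair D (φ n)).2 i) atTop (𝓝 (G i)) := fun i =>
    ((continuous_apply i).tendsto _).comp ((continuous_snd.tendsto _).comp hφ)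
  set V := fun n => testPair D (weightedStep hw (φ n)) with hV
  have hV1 : ∀ n, (V n).1 = mulL2 _ W (stepL2 (testPair D (φ n)).1) := fun n =>
    testPair_weightedStep_fst hw hW (φ n)
  have hV2 : ∀ i, ∃ M, ∀ n, ‖(V n).2 i‖ ≤ M := fun i => by
    obtain ⟨M1, hM1⟩ := (hφ1.norm.add (hφ2 i).norm).bddAbove_range
    set C' := max ‖W‖ C
    refine ⟨C' * stepLip * M1, fun n => (norm_testPair_weightedStep_le (C := C') hw (fun x => ?_)
      (fun x => (hC' x).trans (le_max_right _ _)) (φ n) i).trans ?_⟩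
    · have := W.norm_coe_le_norm x
      rw [hW, Complex.norm_real] at this
      exact this.trans (le_max_left _ _)
    · have : 0 ≤ C' := (norm_nonneg _).trans (le_max_left _ _)
      gcongr
      exact hM1 ⟨n, rfl⟩
  -- The gradient of `φ n` is written as `G` plus an error. The part with `G` is evaluated by the
  -- weak equation for `u`, tested with the weighted step of `φ n`.
  have hstep : ∀ n, -(inner ℂ L (rampL2 (testPair D (φ n)).1)).re ≤
      (inner ℂ (mulL2 _ W (stepL2 (testPair D (φ n)).1)) f).re +
        ∑ i, (inner ℂ ((V n).2 i) ((testPair D (φ n)).2 i - G i)).re := fun n => by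
    refine (neg_re_inner_laplace_le hw hw0 hL (φ n)).trans_eq ?_
    have h1 : (∑ i, inner ℂ ((V n).2 i) (G i)).re = (inner ℂ (V n).1 f).re :=
      congrArg Complex.re (h _ _ (testPair_mem (weightedStep hw (φ n))))
    rw [Complex.re_sum] at h1
    rw [← hV1]
    simp only [inner_sub_right, Complex.sub_re, Finset.sum_sub_distrib, h1]
    ring
  have hlim0 : ∀ i, Tendsto (fun n => (inner ℂ ((V n).2 i) ((testPair D (φ n)).2 i - G i)).re)
      atTop (𝓝 0) := fun i => by
    obtain ⟨M, hM⟩ := hV2 i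
    have h1 : Tendsto (fun n => M * ‖(testPair D (φ n)).2 i - G i‖) atTop (𝓝 0) := by
      have := (tendsto_iff_norm_sub_tendsto_zero.1 (hφ2 i)).const_mul M
      rwa [mul_zero] at this
    refine squeeze_zero_norm (fun n => ?_) h1
    refine (Complex.abs_re_le_norm _).trans ((norm_inner_le_norm _ _).trans ?_)
    gcongr
    exact hM n
  have hl1 : Tendsto (fun n => -(inner ℂ L (rampL2 (testPair D (φ n)).1)).re) atTop
      (𝓝 (-(inner ℂ L (rampL2 u)).re)) :=
    (((Complex.continuous_re.comp ((innerSL ℂ L).continuous.comp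
      continuous_rampL2)).tendsto u).comp hφ1).neg
  have hl2 : Tendsto (fun n => (inner ℂ (mulL2 _ W (stepL2 (testPair D (φ n)).1)) f).re) atTop
      (𝓝 (inner ℂ (mulL2 _ W (stepL2 u)) f).re) := by
    have hc : Continuous fun v => (inner ℂ (mulL2 _ W (stepL2 v)) f).re :=
      Complex.continuous_re.comp (((mulL2 _ W).continuous.comp continuous_stepL2).inner
        continuous_const)
    exact (hc.tendsto u).comp hφ1
  have hl3 := hl2.add (tendsto_finsetSum Finset.univ fun i _ => hlim0 i)
  rw [Finset.sum_const_zero, add_zero] at hl3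
  exact le_of_tendsto_of_tendsto' hl1 hl3 hstep

end KatoLimit
end Torsion

/-! ### Positivity of the inverse Dirichlet Laplacian. -/

namespace Torsion

section Positivity

variable {d : ℕ} {D : TopologicalSpace.Opens (Eucl d)}

theorem partialDeriv_const {F : Type*} [NormedAddCommGroup F] [NormedSpace ℝ F] (i : Fin d)
    (c : F) : partialDeriv i (fun _ : Eucl d => c) = fun _ => 0 := by
  funext x
  simp [partialDeriv]

theorem re_inner_step_nonneg {u f : L2 (D : Set (Eucl d))} (h : (u, f) ∈ dirichletGraph D) :
    0 ≤ (inner ℂ (stepL2 u) f).re := by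
  have h1 := kato_inequality (w := fun _ => 1) contDiff_const (fun _ => zero_le_one) (C := 0)
    (fun x => by simp) (W := 1) (fun _ => by simp) (L := 0) (by
      filter_upwards [Lp.coeFn_zero ℂ 2 (volume.restrict (D : Set (Eucl d)))] with x hx
      rw [hx]
      simp [laplace, partialDeriv_const]) h
  have h2 : mulL2 (volume.restrict (D : Set (Eucl d))) 1 (stepL2 u) = stepL2 u := by
    refine Lp.ext ?_
    filter_upwards [coeFn_mulL2 1 (stepL2 u)] with x hx
    simp [hx]
  rw [h2] at h1
  simpa using h1

/-- The inequality for `-u` says `∫ Re f · S(-Re u) ≤ 0` with nonnegative integrand, so the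
integrand vanishes. Strict positivity of `Re f` then forces `S(-Re u) = 0`, that is, `Re u ≥ 0`. -/
theorem ae_re_nonneg_of_re_pos {u f : L2 (D : Set (Eucl d))} (h : (u, f) ∈ dirichletGraph D)
    (hf : ∀ᵐ x ∂volume.restrict (D : Set (Eucl d)), 0 < (f x).re) :
    ∀ᵐ x ∂volume.restrict (D : Set (Eucl d)), 0 ≤ (u x).re := by
  have h1 := re_inner_step_nonneg ((dirichletGraph D).neg_mem h)
  change 0 ≤ (inner ℂ (stepL2 (-u)) (-f)).re at h1
  rw [inner_neg_right, Complex.neg_re, Left.nonneg_neg_iff, re_inner_eq_integral] at h1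
  have h2 : (fun x => (inner ℂ (stepL2 (-u) x) (f x)).re)
      =ᵐ[volume.restrict (D : Set (Eucl d))]
        fun x => (f x).re * Real.smoothTransition (-(u x).re) := by
    filter_upwards [coeFn_stepL2 (-u), Lp.coeFn_neg u] with x h3 h4
    rw [h3, h4, stepRe]
    simp [RCLike.inner_apply]
  have h3 : 0 ≤ᵐ[volume.restrict (D : Set (Eucl d))]
      fun x => (inner ℂ (stepL2 (-u) x) (f x)).re := by
    filter_upwards [h2, hf] with x h4 h5
    rw [h4]
    exact mul_nonneg h5.le (Real.smoothTransition.nonneg _)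
  have h4 := (integral_eq_zero_iff_of_nonneg_ae h3
    (L2.integrable_inner (𝕜 := ℂ) (stepL2 (-u)) f).re).1 (le_antisymm h1 (integral_nonneg_of_ae h3))
  filter_upwards [h2, h4, hf] with x h5 h6 h7
  rw [h5, Pi.zero_apply] at h6
  have := (mul_eq_zero.1 h6).resolve_left h7.ne'
  rw [Real.smoothTransition.zero_iff_nonpos] at this
  linarith

theorem exists_pos_L2 (Ω : Set (Eucl d)) : ∃ g : L2 Ω, ∀ᵐ x ∂volume.restrict Ω, 0 < (g x).re := by
  have h1 : MemLp (fun x : Eucl d => ((Real.exp (-1 * ‖x - 0‖ ^ 2) : ℝ) : ℂ)) 2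
      (volume.restrict Ω) := by
    refine (memLp_two_iff_integrable_sq_norm (by fun_prop)).2 ?_
    refine ((integrable_gaussian 0 (b := 2) (by norm_num)).integrableOn (s := Ω)).congr
      (Eventually.of_forall fun x => ?_)
    simp only [Complex.norm_real, Real.norm_eq_abs, Real.abs_exp]
    rw [← Real.exp_nat_mul]
    congr 1
    push_cast
    ring
  refine ⟨h1.toLp, ?_⟩
  filter_upwards [h1.coeFn_toLp] with x hx
  rw [hx, Complex.ofReal_re]
  exact Real.exp_pos _

variable {R : L2 (D : Set (Eucl d)) →L[ℂ] L2 (D : Set (Eucl d))}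

/-- Strict positivity is restored by adding a small multiple of a strictly positive `g`, which is
then sent to zero. -/
theorem ae_re_inverse_nonneg (hR : IsBoundedInverse (negDirichletLaplacian D) R)
    {f : L2 (D : Set (Eucl d))} (hf : ∀ᵐ x ∂volume.restrict (D : Set (Eucl d)), 0 ≤ (f x).re) :
    ∀ᵐ x ∂volume.restrict (D : Set (Eucl d)), 0 ≤ (R f x).re := by
  obtain ⟨g, hg⟩ := exists_pos_L2 (D : Set (Eucl d))
  have h1 : ∀ n : ℕ, ∀ᵐ x ∂volume.restrict (D : Set (Eucl d)),
      0 ≤ (R f x).re + 1 / ((n : ℝ) + 1) * (R g x).re := fun n => by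
    set c : ℂ := ((1 / ((n : ℝ) + 1) : ℝ) : ℂ) with hc
    have h2 := hR.mem_graph (f + c • g)
    rw [graph_negDirichletLaplacian] at h2
    have h3 := ae_re_nonneg_of_re_pos h2 (by
      filter_upwards [Lp.coeFn_add f (c • g), Lp.coeFn_smul c g, hf, hg] with x h4 h5 h6 h7
      rw [h4, Pi.add_apply, h5, Pi.smul_apply, Complex.add_re, smul_eq_mul, Complex.re_ofReal_mul]
      have : 0 < 1 / ((n : ℝ) + 1) * (g x).re := by positivity
      linarith)
    rw [map_add, map_smul] at h3
    filter_upwards [h3, Lp.coeFn_add (R f) (c • R g), Lp.coeFn_smul c (R g)] with x h4 h5 h6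
    rwa [h5, Pi.add_apply, h6, Pi.smul_apply, Complex.add_re, smul_eq_mul,
      Complex.re_ofReal_mul] at h4
  filter_upwards [ae_all_iff.2 h1] with x hx
  have := (tendsto_one_div_add_atTop_nhds_zero_nat (𝕜 := ℝ)).mul_const (R g x).re |>.const_add
    (R f x).re
  rw [zero_mul, add_zero] at this
  exact ge_of_tendsto' this hx

open scoped ComplexOrder in
/-- `(-Δ_D)⁻¹` is positivity preserving. -/
theorem ae_inverse_nonneg (hR : IsBoundedInverse (negDirichletLaplacian D) R)
    {f : L2 (D : Set (Eucl d))} (hf : ∀ᵐ x ∂volume.restrict (D : Set (Eucl d)), 0 ≤ f x) :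
    ∀ᵐ x ∂volume.restrict (D : Set (Eucl d)), 0 ≤ R f x := by
  have h1 : ∀ k : ℤ, ∀ᵐ x ∂volume.restrict (D : Set (Eucl d)),
      0 ≤ (R f x).re - k * (R f x).im := fun k => by
    -- For `f ≥ 0` also `Re(cf) ≥ 0`, so `Re(Rf) ≥ k Im(Rf)` for every integer `k`; this is possible
    -- only if `Im(Rf) = 0`.
    set c : ℂ := 1 + k * Complex.I with hc
    have hre : ∀ z : ℂ, (c * z).re = z.re - k * z.im := fun z => by simp [hc]
    have h3 := ae_re_inverse_nonneg hR (f := c • f) (by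
      filter_upwards [Lp.coeFn_smul c f, hf] with x h4 h5
      rw [h4, Pi.smul_apply, smul_eq_mul, hre]
      obtain ⟨h6, h7⟩ := Complex.nonneg_iff.1 h5
      rw [← h7, mul_zero, sub_zero]
      exact h6)
    rw [map_smul] at h3
    filter_upwards [h3, Lp.coeFn_smul c (R f)] with x h4 h5
    rwa [h5, Pi.smul_apply, smul_eq_mul, hre] at h4
  filter_upwards [ae_all_iff.2 h1] with x hx
  have h0 : 0 ≤ (R f x).re := by simpa using hx 0
  refine Complex.nonneg_iff.2 ⟨h0, ?_⟩
  by_contra him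
  obtain ⟨n, hn⟩ := exists_nat_gt ((R f x).re / |(R f x).im|)
  have hpos : 0 < |(R f x).im| := abs_pos.2 (Ne.symm him)
  rw [div_lt_iff₀ hpos] at hn
  rcases abs_cases (R f x).im with ⟨h, _⟩ | ⟨h, _⟩
  · have := hx n
    push_cast at this
    rw [h] at hn
    linarith
  · have := hx (-n)
    push_cast at this
    rw [h] at hn
    linarith

end Positivity

/-! ### Existence and boundedness of the torsion function. -/

section TorsionFunction

variable {d : ℕ} {D : TopologicalSpace.Opens (Eucl d)}

theorem coeFn_truncatedOne (n : ℕ) :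
    truncatedOne D n =ᵐ[volume.restrict (D : Set (Eucl d))]
      (Metric.ball (0 : Eucl d) (n : ℝ)).indicator fun _ => (1 : ℂ) :=
  indicatorConstLp_coeFn

open scoped ComplexOrder in
-- Positivity makes the approximants increase with `n`, the `L_∞` bound of the inverse keeps them
-- below `C`, and the bound passes to any a.e. limit.
theorem isTorsionFunction_bounds (hd : 1 ≤ d)
    (h0 : 0 < bottomSpectrum (negDirichletLaplacian D))
    (hdom : IsHeatDominated (boundedInverse (negDirichletLaplacian D))) :
    (∃ u : Eucl d → ℝ, IsTorsionFunction D u) ∧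
      ∀ u : Eucl d → ℝ, IsTorsionFunction D u →
        eLpNorm u ∞ (volume.restrict (D : Set (Eucl d))) ≤
          ENNReal.ofReal (torsionConst d / bottomSpectrum (negDirichletLaplacian D)) := by
  set R := boundedInverse (negDirichletLaplacian D) with hRdef
  have hR : IsBoundedInverse (negDirichletLaplacian D) R := boundedInverse_spec h0
  set C := torsionConst d / bottomSpectrum (negDirichletLaplacian D)
  have hbd : ∀ᵐ x ∂volume.restrict (D : Set (Eucl d)), ∀ n : ℕ, ‖R (truncatedOne D n) x‖ ≤ C := by
    refine ae_all_iff.2 fun n => ae_norm_inverse_le hd (isInverseAbove_dirichlet h0) hdom ?_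
    filter_upwards [coeFn_truncatedOne n] with x hx
    rw [hx]
    exact (norm_indicator_le_norm_self _ _).trans (by simp)
  have hmono : ∀ᵐ x ∂volume.restrict (D : Set (Eucl d)), ∀ n : ℕ,
      R (truncatedOne D n) x ≤ R (truncatedOne D (n + 1)) x := by
    refine ae_all_iff.2 fun n => ?_
    have h1 := ae_inverse_nonneg hR (f := truncatedOne D (n + 1) - truncatedOne D n) (by
      filter_upwards [coeFn_truncatedOne n, coeFn_truncatedOne (n + 1),
        Lp.coeFn_sub (truncatedOne D (n + 1)) (truncatedOne D n)] with x h1 h2 h3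
      rw [h3, Pi.sub_apply, h1, h2, sub_nonneg]
      exact Set.indicator_le_indicator_of_subset (Metric.ball_subset_ball (by simp))
        (fun _ => zero_le_one) x)
    rw [map_sub] at h1
    filter_upwards [h1, Lp.coeFn_sub (R (truncatedOne D (n + 1))) (R (truncatedOne D n))]
      with x h2 h3
    rwa [h3, Pi.sub_apply, sub_nonneg] at h2
  have hpos : ∀ᵐ x ∂volume.restrict (D : Set (Eucl d)), 0 ≤ R (truncatedOne D 0) x :=
    ae_inverse_nonneg hR (by
      filter_upwards [coeFn_truncatedOne 0] with x h1
      rw [h1]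
      exact Set.indicator_nonneg (fun _ _ => zero_le_one) x)
  constructor
  · refine ⟨fun x => ⨆ n : ℕ, (R (truncatedOne D n) x).re, ?_⟩
    filter_upwards [hbd, hmono, hpos] with x h1 h2 h3
    have hm := monotone_nat_of_le_succ h2
    have him : ∀ n, R (truncatedOne D n) x = ((R (truncatedOne D n) x).re : ℂ) := fun n =>
      Complex.ext rfl (by
        have := (Complex.nonneg_iff.1 (h3.trans (hm (Nat.zero_le n)))).2
        simpa using this.symm)
    have hlim := tendsto_atTop_ciSup (f := fun n : ℕ => (R (truncatedOne D n) x).re)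
      (fun m n hmn => (Complex.le_def.1 (hm hmn)).1)
      ⟨C, by rintro _ ⟨n, rfl⟩; exact (Complex.re_le_norm _).trans (h1 n)⟩
    refine ((Complex.continuous_ofReal.tendsto _).comp hlim).congr fun n => ?_
    exact (him n).symm
  · intro u hu
    rw [eLpNorm_exponent_top]
    refine eLpNormEssSup_le_of_ae_bound ?_
    filter_upwards [hbd, hu] with x h1 h2
    have := le_of_tendsto' h2.norm h1
    rwa [Complex.norm_real] at this

end TorsionFunction
end Torsion

/-! ### The Gauss–Weierstrass kernel as a smooth curve in `L_2`. -/

namespace Torsion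

section GaussianWeights

open scoped BoundedContinuousFunction

variable {d : ℕ}

/-- `∂_t` and `Δ` of the Gauss–Weierstrass kernel. -/
noncomputable def gaussLaplace (t : ℝ) (z : Eucl d) : ℝ :=
  (‖z‖ ^ 2 / (4 * t ^ 2) - d / (2 * t)) * gaussKernel t z

theorem contDiff_gaussKernel (t : ℝ) (x : Eucl d) :
    ContDiff ℝ (⊤ : ℕ∞) fun y => gaussKernel t (x - y) := by
  unfold gaussKernel
  exact contDiff_const.mul (Real.contDiff_exp.comp
    ((((contDiff_norm_sq ℝ).comp (contDiff_const.sub contDiff_id)).neg).div_const _))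

theorem gaussKernel_le {t : ℝ} (ht : 0 < t) (z : Eucl d) :
    gaussKernel t z ≤ (4 * Real.pi * t) ^ (-(d : ℝ) / 2) := by
  unfold gaussKernel
  refine mul_le_of_le_one_right (by positivity) (Real.exp_le_one_iff.2 ?_)
  rw [neg_div]
  exact neg_nonpos.2 (by positivity)

/-- The Gauss–Weierstrass kernel as a bounded continuous function. -/
noncomputable def gaussBCF (t : ℝ) (x : Eucl d) (ht : 0 < t) : Eucl d →ᵇ ℂ :=
  BoundedContinuousFunction.ofNormedAddCommGroup (fun y => ((gaussKernel t (x - y) : ℝ) : ℂ))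
    (by fun_prop) ((4 * Real.pi * t) ^ (-(d : ℝ) / 2)) (fun y => by
      rw [Complex.norm_real, Real.norm_of_nonneg (gaussKernel_nonneg ht.le _)]
      exact gaussKernel_le ht _)

theorem gaussBCF_apply {t : ℝ} (x : Eucl d) (ht : 0 < t) (y : Eucl d) :
    gaussBCF t x ht y = (gaussKernel t (x - y) : ℝ) := rfl

theorem hasFDerivAt_gaussKernel (t : ℝ) (x y : Eucl d) :
    HasFDerivAt (fun y => gaussKernel t (x - y))
      ((-(2 * t)⁻¹ * gaussKernel t (x - y)) • innerSL ℝ (y - x)) y := by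
  simp only [gaussKernel_eq]
  have h1 : HasFDerivAt (fun y : Eucl d => ‖y - x‖ ^ 2) (2 • (innerSL ℝ (y - x))) y := by
    have := ((hasFDerivAt_id y).sub_const x).norm_sq
    simpa using this
  refine (((h1.const_mul (-(4 * t)⁻¹)).exp).const_mul _).congr_fderiv ?_
  ext v
  simp only [smul_apply, smul_eq_mul, nsmul_eq_mul, innerSL_apply_apply]
  have : (4 * t)⁻¹ = 2⁻¹ * (2 * t)⁻¹ := by rw [← mul_inv]; congr 1; ring
  rw [this]
  push_cast
  ring

theorem partialDeriv_gaussKernel (t : ℝ) (x : Eucl d) (i : Fin d) :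
    partialDeriv i (fun y => gaussKernel t (x - y)) =
      fun y => (-(2 * t)⁻¹ * (y i - x i)) * gaussKernel t (x - y) := by
  funext y
  rw [partialDeriv, (hasFDerivAt_gaussKernel t x y).fderiv]
  simp only [smul_apply, smul_eq_mul, innerSL_apply_apply, EuclideanSpace.inner_single_right]
  simp
  ring

theorem partialDeriv_coord (t : ℝ) (x : Eucl d) (i : Fin d) (y : Eucl d) :
    partialDeriv i (fun y : Eucl d => -(2 * t)⁻¹ * (y i - x i)) y = -(2 * t)⁻¹ := by
  have h1 : HasFDerivAt (fun y : Eucl d => -(2 * t)⁻¹ * (y i - x i))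
      (-(2 * t)⁻¹ • (EuclideanSpace.proj i : Eucl d →L[ℝ] ℝ)) y :=
    (((EuclideanSpace.proj i : Eucl d →L[ℝ] ℝ).hasFDerivAt).sub_const (x i)).const_mul _
  rw [partialDeriv, h1.fderiv]
  simp

theorem laplace_gaussKernel {t : ℝ} (x : Eucl d) :
    laplace (fun y => gaussKernel t (x - y)) = fun y => gaussLaplace t (x - y) := by
  funext y
  have hd1 : ∀ i : Fin d, Differentiable ℝ fun y : Eucl d => -(2 * t)⁻¹ * (y i - x i) := fun i =>
    (((EuclideanSpace.proj i : Eucl d →L[ℝ] ℝ).differentiable).sub_const (x i)).const_mul _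
  have hd2 : Differentiable ℝ fun y => gaussKernel t (x - y) :=
    (contDiff_gaussKernel t x).differentiable (by simp)
  have h1 : ∀ i, partialDeriv i (partialDeriv i fun y => gaussKernel t (x - y)) y =
      -(2 * t)⁻¹ * gaussKernel t (x - y) +
        ((2 * t)⁻¹ ^ 2 * gaussKernel t (x - y)) * (y i - x i) ^ 2 := fun i => by
    rw [partialDeriv_gaussKernel, partialDeriv_mul i (hd1 i) hd2, partialDeriv_coord,
      partialDeriv_gaussKernel]
    ring
  have h2 : ‖x - y‖ ^ 2 = ∑ i, (y i - x i) ^ 2 := by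
    rw [norm_sub_rev, EuclideanSpace.norm_sq_eq]
    simp
  simp only [laplace, h1]
  rw [Finset.sum_add_distrib, Finset.sum_const, ← Finset.mul_sum, ← h2, gaussLaplace,
    Finset.card_univ, Fintype.card_fin, nsmul_eq_mul, inv_pow]
  have : (2 * t) ^ 2 = 4 * t ^ 2 := by ring
  rw [this]
  ring

theorem exists_fderiv_gaussKernel_bound {t : ℝ} (ht : 0 < t) (x : Eucl d) :
    ∃ C, ∀ y, ‖fderiv ℝ (fun y => gaussKernel t (x - y)) y‖ ≤ C := by
  refine ⟨(2 * t)⁻¹ * (4 * Real.pi * t) ^ (-(d : ℝ) / 2) * (1 + 4 * t), fun y => ?_⟩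
  rw [(hasFDerivAt_gaussKernel t x y).fderiv, norm_smul, innerSL_apply_norm, norm_mul, norm_neg,
    Real.norm_of_nonneg (by positivity), Real.norm_of_nonneg (gaussKernel_nonneg ht.le _),
    gaussKernel_eq, ← mul_assoc, mul_assoc _ (Real.exp _)]
  refine mul_le_mul_of_nonneg_left ?_ (by positivity)
  set r := ‖y - x‖
  have h1 : 1 + (4 * t)⁻¹ * r ^ 2 ≤ Real.exp ((4 * t)⁻¹ * r ^ 2) := by
    linarith [Real.add_one_le_exp ((4 * t)⁻¹ * r ^ 2)]
  have h2 : r ≤ (1 + 4 * t) * (1 + (4 * t)⁻¹ * r ^ 2) := by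
    have : (1 + 4 * t) * (1 + (4 * t)⁻¹ * r ^ 2) = 1 + 4 * t + (4 * t)⁻¹ * r ^ 2 + r ^ 2 := by
      field_simp
      ring
    rw [this]
    have : 0 ≤ (4 * t)⁻¹ * r ^ 2 := by positivity
    nlinarith [sq_nonneg (r - 1)]
  rw [neg_mul, Real.exp_neg, inv_mul_le_iff₀ (Real.exp_pos _), mul_comm]
  exact h2.trans (mul_le_mul_of_nonneg_left h1 (by positivity))

theorem hasDerivAt_gaussKernel {t : ℝ} (ht : 0 < t) (z : Eucl d) :
    HasDerivAt (fun t => gaussKernel t z) (gaussLaplace t z) t := by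
  have e : ∀ t : ℝ, -‖z‖ ^ 2 / (4 * t) = -‖z‖ ^ 2 / 4 * t⁻¹ := fun t => by
    rw [div_mul_eq_div_div, div_eq_mul_inv _ t]
  unfold gaussLaplace gaussKernel
  simp only [e]
  have h1 : HasDerivAt (fun t : ℝ => (4 * Real.pi * t) ^ (-(d : ℝ) / 2)) _ t :=
    ((hasDerivAt_id t).const_mul (4 * Real.pi)).rpow_const (Or.inl (by simp; positivity))
  have h2 : HasDerivAt (fun t : ℝ => Real.exp (-‖z‖ ^ 2 / 4 * t⁻¹)) _ t :=
    ((hasDerivAt_inv ht.ne').const_mul (-‖z‖ ^ 2 / 4)).exp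
  refine (h1.mul h2).congr_deriv ?_
  have h3 : (4 * Real.pi * t) ^ (-(d : ℝ) / 2 - 1) =
      (4 * Real.pi * t) ^ (-(d : ℝ) / 2) / (4 * Real.pi * t) := by
    rw [Real.rpow_sub_one (by positivity)]
  simp only [id_eq, mul_one, h3]
  field_simp
  ring

/-- A majorant independent of `σ` near `t`; it dominates the difference quotients when the kernel is
differentiated in `L_2`. -/
theorem abs_gaussLaplace_le {t σ : ℝ} (ht : 0 < t) (h1 : t / 2 ≤ σ) (h2 : σ ≤ 2 * t)
    (z : Eucl d) : |gaussLaplace σ z| ≤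
      (16 + d) / t * (2 * Real.pi * t) ^ (-(d : ℝ) / 2) * Real.exp (-(16 * t)⁻¹ * ‖z‖ ^ 2) := by
  have hσ : 0 < σ := by linarith
  rw [gaussLaplace, abs_mul, abs_of_nonneg (gaussKernel_nonneg hσ.le z)]
  -- The kernel is bounded by a constant times `E * E`: one factor `E` absorbs the polynomial
  -- `‖z‖²`, the other survives as the majorant.
  set E := Real.exp (-(16 * t)⁻¹ * ‖z‖ ^ 2) with hE
  have hE0 : 0 < E := Real.exp_pos _
  have hE1 : E ≤ 1 := Real.exp_le_one_iff.2 (by rw [neg_mul]; exact neg_nonpos.2 (by positivity))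
  have hk : gaussKernel σ z ≤ (2 * Real.pi * t) ^ (-(d : ℝ) / 2) * (E * E) := by
    unfold gaussKernel
    gcongr ?_ * ?_
    · rw [neg_div, Real.rpow_neg (by positivity), Real.rpow_neg (by positivity)]
      have : 2 * Real.pi * t ≤ 4 * Real.pi * σ := by nlinarith [Real.pi_pos]
      exact inv_anti₀ (by positivity) (Real.rpow_le_rpow (by positivity) this (by positivity))
    · rw [hE, ← Real.exp_add, Real.exp_le_exp, neg_div, ← sub_nonneg]
      have e : -(16 * t)⁻¹ * ‖z‖ ^ 2 + -(16 * t)⁻¹ * ‖z‖ ^ 2 = -(‖z‖ ^ 2 / (8 * t)) := by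
        field_simp; ring
      rw [e]
      have : ‖z‖ ^ 2 / (8 * t) ≤ ‖z‖ ^ 2 / (4 * σ) :=
        div_le_div_of_nonneg_left (by positivity) (by positivity) (by linarith)
      linarith
  have hz : ‖z‖ ^ 2 * E ≤ 16 * t := by
    have h3 := Real.add_one_le_exp ((16 * t)⁻¹ * ‖z‖ ^ 2)
    rw [hE, neg_mul, Real.exp_neg, ← div_eq_mul_inv, div_le_iff₀ (Real.exp_pos _)]
    calc ‖z‖ ^ 2 = 16 * t * ((16 * t)⁻¹ * ‖z‖ ^ 2) := by field_simp
      _ ≤ _ := by gcongr; linarith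
  have hc : |‖z‖ ^ 2 / (4 * σ ^ 2) - d / (2 * σ)| ≤ ‖z‖ ^ 2 / t ^ 2 + d / t := by
    refine (abs_sub _ _).trans ?_
    rw [abs_of_nonneg (by positivity), abs_of_nonneg (by positivity)]
    gcongr
    · nlinarith
    · linarith
  calc _ ≤ (‖z‖ ^ 2 / t ^ 2 + d / t) * ((2 * Real.pi * t) ^ (-(d : ℝ) / 2) * (E * E)) :=
        mul_le_mul hc hk (gaussKernel_nonneg hσ.le z) (by positivity)
    _ = (‖z‖ ^ 2 * E / t ^ 2 + d / t * E) * ((2 * Real.pi * t) ^ (-(d : ℝ) / 2) * E) := by ring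
    _ ≤ (16 * t / t ^ 2 + d / t * 1) * ((2 * Real.pi * t) ^ (-(d : ℝ) / 2) * E) := by gcongr
    _ = _ := by field_simp

variable (Ω : Set (Eucl d))

theorem memLp_gaussian (x : Eucl d) {b : ℝ} (hb : 0 < b) :
    MemLp (fun y : Eucl d => ((Real.exp (-b * ‖x - y‖ ^ 2) : ℝ) : ℂ)) 2 (volume.restrict Ω) := by
  refine (memLp_two_iff_integrable_sq_norm (by fun_prop)).2 ?_
  refine ((integrable_gaussian x (b := 2 * b) (by positivity)).integrableOn (s := Ω)).congr
    (Eventually.of_forall fun y => ?_)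
  simp only [Complex.norm_real, Real.norm_eq_abs, Real.abs_exp]
  rw [← Real.exp_nat_mul, norm_sub_rev]
  congr 1
  push_cast
  ring

theorem memLp_gaussKernel (x : Eucl d) {t : ℝ} (ht : 0 < t) :
    MemLp (fun y : Eucl d => ((gaussKernel t (x - y) : ℝ) : ℂ)) 2 (volume.restrict Ω) := by
  refine (memLp_gaussian Ω x (b := (4 * t)⁻¹) (by positivity)).of_le_mul
    (c := (4 * Real.pi * t) ^ (-(d : ℝ) / 2)) (by fun_prop) (Eventually.of_forall fun y => ?_)
  rw [Complex.norm_real, Complex.norm_real, Real.norm_of_nonneg (gaussKernel_nonneg ht.le _),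
    Real.norm_of_nonneg (Real.exp_nonneg _), gaussKernel_eq, norm_sub_rev]

theorem continuous_gaussLaplace (t : ℝ) : Continuous (gaussLaplace t : Eucl d → ℝ) := by
  unfold gaussLaplace; fun_prop

theorem memLp_gaussLaplace (x : Eucl d) {t : ℝ} (ht : 0 < t) :
    MemLp (fun y : Eucl d => ((gaussLaplace t (x - y) : ℝ) : ℂ)) 2 (volume.restrict Ω) := by
  refine (memLp_gaussian Ω x (b := (16 * t)⁻¹) (by positivity)).of_le_mul
    (c := (16 + d) / t * (2 * Real.pi * t) ^ (-(d : ℝ) / 2)) ?_ (Eventually.of_forall fun y => ?_)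
  · have := continuous_gaussLaplace (d := d) t
    exact Continuous.aestronglyMeasurable (by fun_prop)
  · rw [Complex.norm_real, Complex.norm_real, Real.norm_eq_abs, Real.norm_of_nonneg
      (Real.exp_nonneg _)]
    exact abs_gaussLaplace_le ht (by linarith) (by linarith) _

open Classical in
/-- The Gauss–Weierstrass kernel centred at `x` as an element of `L_2(Ω)`. -/
noncomputable def gaussL2 (x : Eucl d) (t : ℝ) : L2 Ω :=
  if ht : 0 < t then (memLp_gaussKernel Ω x ht).toLp else 0

/-- The Laplacian of the Gauss–Weierstrass kernel as an element of `L_2(Ω)`. -/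
noncomputable def gaussLaplaceL2 (x : Eucl d) {t : ℝ} (ht : 0 < t) : L2 Ω :=
  (memLp_gaussLaplace Ω x ht).toLp

variable {Ω}

theorem coeFn_gaussL2 (x : Eucl d) {t : ℝ} (ht : 0 < t) :
    gaussL2 Ω x t =ᵐ[volume.restrict Ω] fun y => ((gaussKernel t (x - y) : ℝ) : ℂ) := by
  rw [gaussL2, dif_pos ht]
  exact (memLp_gaussKernel Ω x ht).coeFn_toLp

theorem coeFn_gaussLaplaceL2 (x : Eucl d) {t : ℝ} (ht : 0 < t) :
    gaussLaplaceL2 Ω x ht =ᵐ[volume.restrict Ω] fun y => ((gaussLaplace t (x - y) : ℝ) : ℂ) :=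
  (memLp_gaussLaplace Ω x ht).coeFn_toLp

/-- The heat equation for the kernel, as a derivative in `L_2`: pointwise it is known, and the mean
value inequality with the uniform majorant permits dominated convergence. -/
theorem hasDerivAt_gaussL2 (x : Eucl d) {t : ℝ} (ht : 0 < t) :
    HasDerivAt (gaussL2 Ω x) (gaussLaplaceL2 Ω x ht) t := by
  rw [hasDerivAt_iff_tendsto_slope]
  refine tendsto_of_seq_tendsto fun σ hσ => ?_
  rw [tendsto_nhdsWithin_iff] at hσ
  obtain ⟨N, hN⟩ := eventually_atTop.1 ((hσ.1.eventually (Ioo_mem_nhds (a := t / 2) (b := 2 * t)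
    (by linarith) (by linarith))).and hσ.2)
  refine (tendsto_add_atTop_iff_nat N).1 ?_
  set M := (16 + d) / t * (2 * Real.pi * t) ^ (-(d : ℝ) / 2) with hM
  have hM0 : 0 ≤ M := by positivity
  set g : L2 Ω := (M : ℂ) • (memLp_gaussian Ω x (b := (16 * t)⁻¹) (by positivity)).toLp with hg
  have hgx : g =ᵐ[volume.restrict Ω] fun y => ((M * Real.exp (-(16 * t)⁻¹ * ‖x - y‖ ^ 2) : ℝ) : ℂ) := by
    filter_upwards [Lp.coeFn_smul (M : ℂ) (memLp_gaussian Ω x (b := (16 * t)⁻¹) (by positivity)).toLp,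
      (memLp_gaussian Ω x (b := (16 * t)⁻¹) (by positivity)).coeFn_toLp] with y h1 h2
    rw [hg, h1, Pi.smul_apply, h2, smul_eq_mul]
    exact (Complex.ofReal_mul M _).symm
  have hslope : ∀ n, (fun y => slope (gaussL2 Ω x) t (σ (n + N)) y) =ᵐ[volume.restrict Ω]
      fun y => ((slope (fun s => gaussKernel s (x - y)) t (σ (n + N)) : ℝ) : ℂ) := fun n => by
    have hpos : 0 < σ (n + N) := by linarith [(hN (n + N) (by omega)).1.1]
    filter_upwards [Lp.coeFn_smul (σ (n + N) - t)⁻¹ (gaussL2 Ω x (σ (n + N)) - gaussL2 Ω x t),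
      Lp.coeFn_sub (gaussL2 Ω x (σ (n + N))) (gaussL2 Ω x t), coeFn_gaussL2 x hpos,
      coeFn_gaussL2 x ht] with y h1 h2 h3 h4
    rw [slope_def_module, h1, Pi.smul_apply, h2, Pi.sub_apply, h3, h4, slope_def_module]
    simp
  refine tendsto_of_ae_tendsto (g := g) (fun n => ?_) ?_ ?_
  · filter_upwards [hslope n, hgx] with y h1 h2
    obtain ⟨⟨h3, h4⟩, h5⟩ := hN (n + N) (by omega)
    rw [Function.comp_apply, h1, h2, Complex.norm_real, Complex.norm_real,
      Real.norm_of_nonneg (r := M * _) (by positivity), slope_def_field, norm_div,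
      div_le_iff₀ (norm_pos_iff.2 (sub_ne_zero.2 h5))]
    refine (convex_Icc (t / 2) (2 * t)).norm_image_sub_le_of_norm_hasDerivWithin_le
      (f' := fun s => gaussLaplace s (x - y)) (fun s hs => (hasDerivAt_gaussKernel
        (by linarith [hs.1]) _).hasDerivWithinAt) (fun s hs => ?_) ⟨by linarith, by linarith⟩
      ⟨h3.le, h4.le⟩
    exact abs_gaussLaplace_le ht hs.1 hs.2 _
  · filter_upwards [coeFn_gaussLaplaceL2 x ht, hgx] with y h1 h2
    rw [h1, h2, Complex.norm_real, Complex.norm_real, Real.norm_of_nonneg (r := M * _)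
      (by positivity)]
    exact abs_gaussLaplace_le ht (by linarith) (by linarith) _
  · filter_upwards [ae_all_iff.2 hslope, coeFn_gaussLaplaceL2 x ht] with y h1 h2
    simp only [Function.comp_apply, h1, h2]
    refine (Complex.continuous_ofReal.tendsto _).comp ?_
    have h3 := hasDerivAt_iff_tendsto_slope.1 (hasDerivAt_gaussKernel ht (x - y))
    exact (h3.comp (tendsto_nhdsWithin_iff.2 hσ)).comp (tendsto_add_atTop_nat N)

end GaussianWeights
end Torsion

/-! ### Comparison of the Dirichlet and the free heat flow. -/

namespace Torsion

section HeatComparison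

variable {d : ℕ}

/-- Convexity of `ramp` integrated against the nonnegative kernel. It replaces a chain rule for
`rampL2`, since only upper bounds of right difference quotients are needed. -/
theorem re_inner_gaussL2_ramp_sub_le {Ω : Set (Eucl d)} (x : Eucl d) {t : ℝ} (ht : 0 < t)
    (u v : L2 Ω) : (inner ℂ (gaussL2 Ω x t) (rampL2 v - rampL2 u)).re ≤
      (inner ℂ (mulL2 _ (gaussBCF t x ht) (stepL2 v)) (v - u)).re := by
  have hint : ∀ f g : L2 Ω, Integrable (fun y => (inner ℂ (f y) (g y)).re) (volume.restrict Ω) :=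
    fun f g => (L2.integrable_inner (𝕜 := ℂ) f g).re
  rw [re_inner_eq_integral, re_inner_eq_integral]
  refine integral_mono_ae (hint _ _) (hint _ _) ?_
  filter_upwards [coeFn_gaussL2 (Ω := Ω) x ht, Lp.coeFn_sub (rampL2 v) (rampL2 u), coeFn_rampL2 v,
    coeFn_rampL2 u, coeFn_mulL2 (gaussBCF t x ht) (stepL2 v), coeFn_stepL2 v, Lp.coeFn_sub v u]
    with y h1 h2 h3 h4 h5 h6 h7
  rw [h1, h2, h5, h6, h7, Pi.sub_apply, Pi.sub_apply, h3, h4, gaussBCF_apply, stepRe, rampRe, rampRe]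
  have h8 := mul_le_mul_of_nonneg_left (ramp_sub_le (u y).re (v y).re)
    (gaussKernel_nonneg ht.le (x - y))
  simp only [RCLike.inner_apply, ← Complex.ofReal_mul, ← Complex.ofReal_sub, Complex.conj_ofReal,
    Complex.ofReal_re, Complex.re_mul_ofReal, Complex.sub_re]
  linarith

variable {D : TopologicalSpace.Opens (Eucl d)}
  {R : L2 (D : Set (Eucl d)) →L[ℂ] L2 (D : Set (Eucl d))} {e : ℝ}

theorem re_inner_gaussLaplaceL2_le (x : Eucl d) {t : ℝ} (ht : 0 < t)
    {u f : L2 (D : Set (Eucl d))} (h : (u, f) ∈ dirichletGraph D) :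
    -(inner ℂ (gaussLaplaceL2 (D : Set (Eucl d)) x ht) (rampL2 u)).re ≤
      (inner ℂ (mulL2 _ (gaussBCF t x ht) (stepL2 u)) f).re := by
  obtain ⟨C, hC⟩ := exists_fderiv_gaussKernel_bound ht x
  refine kato_inequality (contDiff_gaussKernel t x) (fun y => gaussKernel_nonneg ht.le _) hC
    (gaussBCF_apply x ht) ?_ h
  rw [laplace_gaussKernel]
  exact coeFn_gaussLaplaceL2 x ht

/-- Along `s`, the pairing of the kernel at time `t + ε - s` with `ramp(Re u(s))` is nonincreasing:
its right slopes are asymptotically at most `-⟨Δk, ramp u⟩ - Re⟨k·step u, Hu⟩`, which is `≤ 0` by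
Kato's inequality. The extra `ε` keeps the kernel time positive up to `s = t`. -/
theorem re_inner_gaussL2_heat_le_aux (hR : IsInverseAbove R e)
    (hgraph : ∀ f, (R f, f) ∈ dirichletGraph D) (g : L2 (D : Set (Eucl d))) (x : Eucl d) {s t ε : ℝ}
    (hs : 0 < s) (hst : s ≤ t) (hε : 0 < ε) :
    (inner ℂ (gaussL2 (D : Set (Eucl d)) x ε) (rampL2 (heat R t (R g)))).re ≤
      (inner ℂ (gaussL2 (D : Set (Eucl d)) x (t + ε - s)) (rampL2 (heat R s (R g)))).re := by
  set u : ℝ → L2 (D : Set (Eucl d)) := fun s : ℝ => heat R s (R g) with hu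
  set k : ℝ → L2 (D : Set (Eucl d)) := fun s => gaussL2 (D : Set (Eucl d)) x (t + ε - s) with hk
  set Φ : ℝ → ℝ := fun s => (inner ℂ (k s) (rampL2 (u s))).re with hΦ
  have hud : ∀ s : ℝ, 0 < s → HasDerivAt u (-heat R s g) s := fun s hs => hR.hasDerivAt_heat_real hs g
  have hkd : ∀ s (hs : 0 < t + ε - s),
      HasDerivAt k (-gaussLaplaceL2 (D : Set (Eucl d)) x hs) s := fun s hs =>
    (hasDerivAt_gaussL2 x hs).comp_const_sub (t + ε) s
  have hgr : ∀ s : ℝ, (u s, heat R s g) ∈ dirichletGraph D := fun s => by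
    have h1 : u s = R (heat R s g) :=
      congrArg (fun A : L2 (D : Set (Eucl d)) →L[ℂ] L2 (D : Set (Eucl d)) => A g)
        (hR.commute s).eq
    rw [h1]
    exact hgraph _
  have hcont : ContinuousOn Φ (Set.Icc s t) := fun r hr => by
    refine ContinuousAt.continuousWithinAt ?_
    exact Complex.continuous_re.continuousAt.comp
      ((hkd r (by linarith [hr.2])).continuousAt.inner
        (continuous_rampL2.continuousAt.comp (hud r (hs.trans_le hr.1)).continuousAt))
  have key := image_le_of_liminf_slope_right_le_deriv_boundary (f := Φ) (B := fun _ => Φ s)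
    (B' := fun _ => 0) hcont le_rfl continuousOn_const (fun r _ => hasDerivWithinAt_const _ _ _)
    (fun r hr b hb => ?_) (Set.right_mem_Icc.2 hst)
  · simpa [hΦ, hk] using key
  have hr0 : 0 < r := hs.trans_le hr.1
  have hτ : 0 < t + ε - r := by linarith [hr.2]
  have hks := (hasDerivAt_iff_tendsto_slope.1 (hkd r hτ)).mono_left
    (nhdsWithin_mono r fun y (hy : r < y) => hy.ne')
  have hus := (hasDerivAt_iff_tendsto_slope.1 (hud r hr0)).mono_left
    (nhdsWithin_mono r fun y (hy : r < y) => hy.ne')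
  have huc : Tendsto u (𝓝[>] r) (𝓝 (u r)) := (hud r hr0).continuousAt.mono_left nhdsWithin_le_nhds
  have hlim : Tendsto (fun y => (inner ℂ (slope k r y) (rampL2 (u y))).re +
      (inner ℂ (mulL2 _ (gaussBCF _ x hτ) (stepL2 (u y))) (slope u r y)).re) (𝓝[>] r)
      (𝓝 ((inner ℂ (-gaussLaplaceL2 (D : Set (Eucl d)) x hτ) (rampL2 (u r))).re +
        (inner ℂ (mulL2 _ (gaussBCF _ x hτ) (stepL2 (u r))) (-heat R r g)).re)) := by
    refine Tendsto.add ?_ ?_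
    · exact (Complex.continuous_re.tendsto _).comp
        (hks.inner ((continuous_rampL2.tendsto _).comp huc))
    · exact (Complex.continuous_re.tendsto _).comp
        ((((mulL2 _ (gaussBCF _ x hτ)).continuous.comp continuous_stepL2).tendsto _ |>.comp
          huc).inner hus)
  have hneg : (inner ℂ (-gaussLaplaceL2 (D : Set (Eucl d)) x hτ) (rampL2 (u r))).re +
        (inner ℂ (mulL2 _ (gaussBCF _ x hτ) (stepL2 (u r))) (-heat R r g)).re < b := by
    have := re_inner_gaussLaplaceL2_le x hτ (hgr r)
    rw [inner_neg_left, inner_neg_right, Complex.neg_re, Complex.neg_re]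
    linarith
  refine Eventually.frequently ?_
  filter_upwards [hlim.eventually_lt_const hneg, self_mem_nhdsWithin] with y hy hry
  refine lt_of_le_of_lt ?_ hy
  have hry' : 0 < y - r := sub_pos.2 hry
  have h1 := re_inner_gaussL2_ramp_sub_le x hτ (u r) (u y)
  have h2 : Φ y - Φ r = (inner ℂ (k y - k r) (rampL2 (u y))).re +
      (inner ℂ (k r) (rampL2 (u y) - rampL2 (u r))).re := by
    simp only [hΦ, inner_sub_left, inner_sub_right, Complex.sub_re]
    ring
  rw [slope_def_field, h2, slope_def_module, slope_def_module, div_eq_inv_mul, mul_add]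
  refine add_le_add (le_of_eq ?_) ?_
  · rw [inner_smul_left_eq_smul, Complex.smul_re, smul_eq_mul]
  · rw [inner_smul_right_eq_smul, Complex.smul_re, smul_eq_mul]
    exact mul_le_mul_of_nonneg_left h1 (inv_nonneg.2 hry'.le)

/-- For `v` orthogonal to the range, `‖Rv‖² = ⟨R(Rv), v⟩ = 0`, and then `v = H(Rv) = 0`. -/
theorem IsBoundedInverse.dense_range {H : L2 (D : Set (Eucl d)) →ₗ.[ℂ] L2 (D : Set (Eucl d))}
    (hRH : IsBoundedInverse H R) (hR : IsInverseAbove R e) : DenseRange R := by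
  have h1 : (LinearMap.range R.toLinearMap).topologicalClosure = ⊤ := by
    rw [Submodule.topologicalClosure_eq_top_iff, Submodule.eq_bot_iff]
    intro v hv
    rw [Submodule.mem_orthogonal] at hv
    have h2 : R v = 0 := by
      have h3 : inner ℂ (R (R v)) v = 0 := hv _ ⟨R v, rfl⟩
      have h4 : inner ℂ (R (R v)) v = inner ℂ (R v) (R v) :=
        ContinuousLinearMap.isSelfAdjoint_iff_isSymmetric.1 hR.selfAdjoint (R v) v
      rw [← inner_self_eq_zero (𝕜 := ℂ), ← h4, h3]
    have h3 := hRH.mem_graph v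
    rw [h2] at h3
    exact LinearPMap.graph_fst_eq_zero_snd H h3 rfl
  have h2 := Submodule.dense_iff_topologicalClosure_eq_top.2 h1
  exact h2

/-- Comparison of the Dirichlet heat semigroup with the free one, tested against Gaussians. -/
theorem re_inner_gaussL2_heat_le (hRH : IsBoundedInverse (negDirichletLaplacian D) R)
    (hR : IsInverseAbove R e) (f : L2 (D : Set (Eucl d))) (x : Eucl d) {t ε : ℝ} (ht : 0 < t)
    (hε : 0 < ε) :
    (inner ℂ (gaussL2 (D : Set (Eucl d)) x ε) (rampL2 (heat R t f))).re ≤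
      (inner ℂ (gaussL2 (D : Set (Eucl d)) x (t + ε)) (rampL2 f)).re := by
  have hcl : IsClosed {f : L2 (D : Set (Eucl d)) |
      (inner ℂ (gaussL2 (D : Set (Eucl d)) x ε) (rampL2 (heat R t f))).re ≤
        (inner ℂ (gaussL2 (D : Set (Eucl d)) x (t + ε)) (rampL2 f)).re} :=
    isClosed_le
      (Complex.continuous_re.comp (continuous_const.inner
        (continuous_rampL2.comp (heat R t).continuous)))
      (Complex.continuous_re.comp (continuous_const.inner continuous_rampL2))
  refine (hRH.dense_range hR).induction_on (p := fun f =>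
    (inner ℂ (gaussL2 (D : Set (Eucl d)) x ε) (rampL2 (heat R t f))).re ≤
        (inner ℂ (gaussL2 (D : Set (Eucl d)) x (t + ε)) (rampL2 f)).re) f hcl fun g => ?_
  have hgraph : ∀ f, (R f, f) ∈ dirichletGraph D := fun f => by
    rw [← graph_negDirichletLaplacian]
    exact hRH.mem_graph f
  have hlim : Tendsto (fun s : ℝ => (inner ℂ (gaussL2 (D : Set (Eucl d)) x (t + ε - s))
      (rampL2 (heat R s (R g)))).re) (𝓝[>] 0)
      (𝓝 (inner ℂ (gaussL2 (D : Set (Eucl d)) x (t + ε)) (rampL2 (R g))).re) := by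
    refine (Complex.continuous_re.tendsto _).comp (Tendsto.inner ?_
      ((continuous_rampL2.tendsto _).comp (hR.tendsto_heat_zero g)))
    have h1 : ContinuousAt (fun s => gaussL2 (D : Set (Eucl d)) x (t + ε - s)) 0 :=
      ((hasDerivAt_gaussL2 x (t := t + ε - 0) (by linarith)).comp_const_sub (t + ε) 0).continuousAt
    have h2 := h1.tendsto.mono_left (nhdsWithin_le_nhds (s := Set.Ioi 0))
    rwa [sub_zero] at h2
  refine ge_of_tendsto hlim ?_
  filter_upwards [Ioo_mem_nhdsGT ht] with s hs
  exact re_inner_gaussL2_heat_le_aux hR hgraph g x hs.1 hs.2.le hε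

end HeatComparison
end Torsion

/-! ### Recovering pointwise bounds from Gaussian averages. -/

namespace Torsion

section GaussianLimits

variable {d : ℕ} {Ω : Set (Eucl d)}

/-- `∫_Ω k_s(x - y) |f(y)| dy` for the Gauss–Weierstrass kernel `k_s`. -/
noncomputable def heatConv (f : L2 Ω) (s : ℝ) (x : Eucl d) : ℝ :=
  ∫ y in Ω, gaussKernel s (x - y) * ‖f y‖

theorem integrable_gaussKernel_mul_norm (x : Eucl d) {s : ℝ} (hs : 0 < s) (f : L2 Ω) :
    Integrable (fun y => gaussKernel s (x - y) * ‖f y‖) (volume.restrict Ω) := by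
  refine ((memLp_gaussKernel Ω x hs).norm.integrable_mul (Lp.memLp f).norm).congr
    (Eventually.of_forall fun _ => ?_)
  simp only [Pi.mul_apply]
  rw [Complex.norm_real, Real.norm_of_nonneg (gaussKernel_nonneg hs.le _)]

theorem heatConv_nonneg (f : L2 Ω) {s : ℝ} (hs : 0 < s) (x : Eucl d) : 0 ≤ heatConv f s x :=
  integral_nonneg fun _ => mul_nonneg (gaussKernel_nonneg hs.le _) (norm_nonneg _)

theorem ofReal_heatConv (f : L2 Ω) {s : ℝ} (hs : 0 < s) (x : Eucl d) :
    ENNReal.ofReal (heatConv f s x) =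
      ∫⁻ y in Ω, ENNReal.ofReal (gaussKernel s (x - y) * ‖f y‖) :=
  ofReal_integral_eq_lintegral_ofReal (integrable_gaussKernel_mul_norm x hs f)
    (Eventually.of_forall fun _ => mul_nonneg (gaussKernel_nonneg hs.le _) (norm_nonneg _))

theorem measurable_ofReal_heatConv (f : L2 Ω) {s : ℝ} (hs : 0 < s) :
    Measurable fun x => ENNReal.ofReal (heatConv f s x) := by
  simp only [ofReal_heatConv f hs]
  have hf : Measurable fun y => ‖f y‖ := (Lp.stronglyMeasurable f).measurable.norm
  have hk : Measurable (gaussKernel s : Eucl d → ℝ) := (continuous_gaussKernel s).measurable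
  refine Measurable.lintegral_prod_right'
    (f := fun p : Eucl d × Eucl d => ENNReal.ofReal (gaussKernel s (p.1 - p.2) * ‖f p.2‖)) ?_
  exact ((hk.comp (measurable_fst.sub measurable_snd)).mul
    (hf.comp measurable_snd)).ennreal_ofReal

theorem exists_heatConv_le (f : L2 Ω) {t : ℝ} (ht : 0 < t) :
    ∃ M, ∀ s, t ≤ s → s ≤ t + 1 → ∀ x, heatConv f s x ≤ M := by
  refine ⟨Real.sqrt (((4 * Real.pi * t) ^ (-(d : ℝ) / 2)) ^ 2 *
    (4 * Real.pi * (t + 1)) ^ ((d : ℝ) / 2)) * ‖f‖, fun s hts hst x => ?_⟩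
  have hs : 0 < s := ht.trans_le hts
  refine (integral_gaussKernel_mul_le x (a := (8 * s)⁻¹) (c := (8 * s)⁻¹) hs (by positivity)
    (by positivity) (by field_simp; norm_num) f).trans ?_
  have h1 : ‖mulL2 _ (gaussWeight x (8 * s)⁻¹) f‖ ≤ 1 * ‖f‖ := norm_mulL2_le (fun y => by
    rw [gaussWeight_apply x (by positivity), Complex.norm_real,
      Real.norm_of_nonneg (Real.exp_nonneg _), Real.exp_le_one_iff, neg_mul]
    exact neg_nonpos.2 (by positivity)) f
  rw [one_mul] at h1
  have h2 : Real.pi / (2 * (8 * s)⁻¹) = 4 * Real.pi * s := by field_simp; norm_num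
  have h3 : (4 * Real.pi * s) ^ (-(d : ℝ) / 2) ≤ (4 * Real.pi * t) ^ (-(d : ℝ) / 2) := by
    rw [neg_div, Real.rpow_neg (by positivity), Real.rpow_neg (by positivity)]
    gcongr
  rw [h2]
  gcongr

theorem tendsto_heatConv (f : L2 Ω) {t : ℝ} (ht : 0 < t) (x : Eucl d) :
    Tendsto (fun s => heatConv f s x) (𝓝 t) (𝓝 (heatConv f t x)) := by
  set F : L2 Ω := (Lp.memLp f).norm.ofReal.toLp with hF
  have h1 : ∀ s, 0 < s → heatConv f s x = (inner ℂ (gaussL2 Ω x s) F).re := fun s hs => by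
    rw [re_inner_eq_integral, heatConv]
    refine integral_congr_ae ?_
    filter_upwards [coeFn_gaussL2 (Ω := Ω) x hs, (Lp.memLp f).norm.ofReal (K := ℂ).coeFn_toLp]
      with y h2 h3
    rw [h2, hF, h3]
    simp [RCLike.inner_apply, mul_comm]
  have h2 : Tendsto (fun s => (inner ℂ (gaussL2 Ω x s) F).re) (𝓝 t)
      (𝓝 (inner ℂ (gaussL2 Ω x t) F).re) :=
    (Complex.continuous_re.tendsto _).comp
      ((hasDerivAt_gaussL2 x ht).continuousAt.tendsto.inner tendsto_const_nhds)
  rw [h1 t ht]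
  refine h2.congr' ?_
  filter_upwards [Ioi_mem_nhds ht] with s hs
  exact (h1 s hs).symm

theorem lintegral_gaussKernel {s : ℝ} (hs : 0 < s) (y : Eucl d) :
    ∫⁻ x, ENNReal.ofReal (gaussKernel s (x - y)) = 1 := by
  have h : ∀ x : Eucl d, gaussKernel s (x - y) = gaussKernel s (y - x) := fun x => by
    simp only [gaussKernel, norm_sub_rev]
  simp only [h]
  rw [← ofReal_integral_eq_lintegral_ofReal (integrable_gaussKernel hs y)
    (Eventually.of_forall fun x => gaussKernel_nonneg hs.le _), integral_gaussKernel hs,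
    ENNReal.ofReal_one]

/-- Half of the exponent yields the small factor, the other half is the kernel at time `2s`, whose
total mass is still one. -/
theorem gaussKernel_le_of_le_norm {s r : ℝ} (hs : 0 < s) (hr : 0 ≤ r) {z : Eucl d}
    (hz : r ≤ ‖z‖) : gaussKernel s z ≤
      2 ^ ((d : ℝ) / 2) * Real.exp (-(r ^ 2 / 8) * s⁻¹) * gaussKernel (2 * s) z := by
  unfold gaussKernel
  have e1 : (4 * Real.pi * (2 * s)) ^ (-(d : ℝ) / 2) =
      (2 ^ ((d : ℝ) / 2))⁻¹ * (4 * Real.pi * s) ^ (-(d : ℝ) / 2) := by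
    rw [show 4 * Real.pi * (2 * s) = 2 * (4 * Real.pi * s) by ring,
      Real.mul_rpow (by norm_num) (by positivity), neg_div, Real.rpow_neg (x := 2) (by norm_num)]
  have e2 : Real.exp (-‖z‖ ^ 2 / (4 * s)) ≤
      Real.exp (-(r ^ 2 / 8) * s⁻¹) * Real.exp (-‖z‖ ^ 2 / (4 * (2 * s))) := by
    rw [← Real.exp_add, Real.exp_le_exp]
    have h1 : r ^ 2 / 8 * s⁻¹ ≤ ‖z‖ ^ 2 / 8 * s⁻¹ := by gcongr
    have h2 : -‖z‖ ^ 2 / (4 * s) = -(‖z‖ ^ 2 / 8 * s⁻¹) + -‖z‖ ^ 2 / (4 * (2 * s)) := by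
      field_simp; ring
    rw [h2]
    linarith
  have h0 : (2 : ℝ) ^ ((d : ℝ) / 2) ≠ 0 := by positivity
  rw [e1]
  calc _ ≤ (4 * Real.pi * s) ^ (-(d : ℝ) / 2) * (Real.exp (-(r ^ 2 / 8) * s⁻¹) *
        Real.exp (-‖z‖ ^ 2 / (4 * (2 * s)))) := by gcongr
    _ = _ := by field_simp

/-- The Gauss–Weierstrass kernels form an approximate identity. -/
theorem tendsto_setLIntegral_gaussKernel {O : Set (Eucl d)} (hO : IsOpen O) {y : Eucl d}
    (hy : y ∈ O) : Tendsto (fun s => ∫⁻ x in O, ENNReal.ofReal (gaussKernel s (x - y))) (𝓝[>] 0)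
      (𝓝 1) := by
  obtain ⟨r, hr, hball⟩ := Metric.isOpen_iff.1 hO y hy
  set c : ℝ → ℝ≥0∞ := fun s =>
    ENNReal.ofReal (2 ^ ((d : ℝ) / 2) * Real.exp (-(r ^ 2 / 8) * s⁻¹)) with hc
  have hc0 : Tendsto c (𝓝[>] 0) (𝓝 0) := by
    have h1 : Tendsto (fun s : ℝ => -(r ^ 2 / 8) * s⁻¹) (𝓝[>] 0) atBot :=
      tendsto_inv_nhdsGT_zero.const_mul_atTop_of_neg (by nlinarith)
    have h2 := (Real.tendsto_exp_atBot.comp h1).const_mul ((2 : ℝ) ^ ((d : ℝ) / 2))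
    rw [mul_zero] at h2
    have h3 := ENNReal.tendsto_ofReal h2
    rwa [ENNReal.ofReal_zero] at h3
  have hcl : Tendsto (fun s => 1 - c s) (𝓝[>] 0) (𝓝 1) := by
    have := ENNReal.Tendsto.sub (tendsto_const_nhds (x := (1 : ℝ≥0∞))) hc0 (Or.inl ENNReal.one_ne_top)
    rwa [tsub_zero] at this
  refine tendsto_of_tendsto_of_tendsto_of_le_of_le' hcl tendsto_const_nhds ?_ ?_
  · filter_upwards [self_mem_nhdsWithin] with s hs
    have hs' : 0 < s := hs
    rw [tsub_le_iff_right, ← lintegral_gaussKernel hs' y, ← lintegral_add_compl _ hO.measurableSet]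
    gcongr
    calc ∫⁻ x in Oᶜ, ENNReal.ofReal (gaussKernel s (x - y))
        ≤ ∫⁻ x in Oᶜ, c s * ENNReal.ofReal (gaussKernel (2 * s) (x - y)) := by
          refine setLIntegral_mono' hO.measurableSet.compl fun x hx => ?_
          rw [hc, ← ENNReal.ofReal_mul (by positivity)]
          refine ENNReal.ofReal_le_ofReal (gaussKernel_le_of_le_norm hs' hr.le ?_)
          by_contra hlt
          rw [not_le] at hlt
          exact hx (hball (by rwa [Metric.mem_ball, dist_eq_norm]))
      _ ≤ ∫⁻ x, c s * ENNReal.ofReal (gaussKernel (2 * s) (x - y)) := setLIntegral_le_lintegral _ _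
      _ = c s := by
          have hm : Measurable fun x : Eucl d => ENNReal.ofReal (gaussKernel (2 * s) (x - y)) :=
            (Continuous.measurable (by fun_prop)).ennreal_ofReal
          rw [lintegral_const_mul _ hm, lintegral_gaussKernel (by positivity), mul_one]
  · filter_upwards [self_mem_nhdsWithin] with s hs
    exact (setLIntegral_le_lintegral _ _).trans_eq (lintegral_gaussKernel hs y)

/-- If the Gaussian averages of `h` are bounded by those of the function `e^{tΔ}|f|`,
then so is `h`, on open sets of finite measure. -/
theorem setLIntegral_le_of_gaussian_le {h : Eucl d → ℝ≥0∞} (hm : Measurable h) (f : L2 Ω) {t : ℝ}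
    (ht : 0 < t) (hle : ∀ ε, 0 < ε → ∀ x,
      ∫⁻ y in Ω, h y * ENNReal.ofReal (gaussKernel ε (x - y)) ≤
        ENNReal.ofReal (heatConv f (t + ε) x)) {O : Set (Eucl d)} (hO : IsOpen O)
    (hOf : volume O ≠ ∞) :
    ∫⁻ y in Ω, O.indicator h y ≤ ∫⁻ x in O, ENNReal.ofReal (heatConv f t x) := by
  set ε : ℕ → ℝ := fun n => 1 / ((n : ℝ) + 1) with hε
  have hε0 : ∀ n, 0 < ε n := fun n => by positivity
  have hε1 : ∀ n, ε n ≤ 1 := fun n => by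
    simp only [hε]
    rw [div_le_one (by positivity)]
    linarith [(Nat.cast_nonneg n : (0 : ℝ) ≤ n)]
  have hεl : Tendsto ε atTop (𝓝 0) := tendsto_one_div_add_atTop_nhds_zero_nat
  have hεl' : Tendsto ε atTop (𝓝[>] 0) :=
    tendsto_nhdsWithin_iff.2 ⟨hεl, Eventually.of_forall hε0⟩
  set m : ℕ → Eucl d → ℝ≥0∞ := fun n y => ∫⁻ x in O, ENNReal.ofReal (gaussKernel (ε n) (x - y))
    with hmdef
  have hkm : ∀ n, Measurable fun p : Eucl d × Eucl d =>
      ENNReal.ofReal (gaussKernel (ε n) (p.2 - p.1)) := fun n =>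
    (Continuous.measurable (by fun_prop)).ennreal_ofReal
  have hmm : ∀ n, Measurable (m n) := fun n => (hkm n).lintegral_prod_right'
  obtain ⟨M, hM⟩ := exists_heatConv_le f ht
  have hRHS : Tendsto (fun n => ∫⁻ x in O, ENNReal.ofReal (heatConv f (t + ε n) x)) atTop
      (𝓝 (∫⁻ x in O, ENNReal.ofReal (heatConv f t x))) := by
    refine tendsto_lintegral_of_dominated_convergence (fun _ => ENNReal.ofReal M)
      (fun n => measurable_ofReal_heatConv f (by linarith [hε0 n])) (fun n =>
        Eventually.of_forall fun x => ENNReal.ofReal_le_ofReal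
          (hM _ (by linarith [hε0 n]) (by linarith [hε1 n]) x)) ?_ ?_
    · rw [lintegral_const, Measure.restrict_apply_univ]
      exact ENNReal.mul_ne_top ENNReal.ofReal_ne_top hOf
    · refine Eventually.of_forall fun x => ENNReal.tendsto_ofReal ?_
      refine (tendsto_heatConv f ht x).comp ?_
      simpa using hεl.const_add t
  have hswap : ∀ n, ∫⁻ y in Ω, h y * m n y ≤
      ∫⁻ x in O, ENNReal.ofReal (heatConv f (t + ε n) x) := fun n => by
    have h1 : ∀ y, h y * m n y =
        ∫⁻ x in O, h y * ENNReal.ofReal (gaussKernel (ε n) (x - y)) := fun y => by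
      have : Measurable fun x : Eucl d => ENNReal.ofReal (gaussKernel (ε n) (x - y)) :=
        (Continuous.measurable (by fun_prop)).ennreal_ofReal
      rw [lintegral_const_mul _ this]
    simp only [h1]
    rw [lintegral_lintegral_swap]
    · exact lintegral_mono fun x => hle _ (hε0 n) x
    · exact ((hm.comp measurable_fst).mul (hkm n)).aemeasurable
  -- On the left the averaged indicators tend to one on `O` and Fatou's lemma applies; on the right
  -- the convolutions converge boundedly on a set of finite measure.
  calc ∫⁻ y in Ω, O.indicator h y
      ≤ ∫⁻ y in Ω, liminf (fun n => h y * m n y) atTop := by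
        refine lintegral_mono fun y => ?_
        by_cases hy : y ∈ O
        · rw [Set.indicator_of_mem hy]
          have h1 := ENNReal.Tendsto.const_mul (a := h y)
            ((tendsto_setLIntegral_gaussKernel hO hy).comp hεl') (Or.inl one_ne_zero)
          rw [mul_one] at h1
          exact h1.liminf_eq.ge
        · rw [Set.indicator_of_notMem hy]
          exact zero_le
    _ ≤ liminf (fun n => ∫⁻ y in Ω, h y * m n y) atTop :=
        lintegral_liminf_le fun n => hm.mul (hmm n)
    _ ≤ liminf (fun n => ∫⁻ x in O, ENNReal.ofReal (heatConv f (t + ε n) x)) atTop :=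
        liminf_le_liminf (Eventually.of_forall hswap)
    _ = _ := hRHS.liminf_eq

/-- Outer regularity passes from open sets to measurable ones. The open superset may leave `Ω`, so
its excess over `s ∩ Ω` is made small against the uniform bound of the convolution. -/
theorem ae_le_heatConv_of_gaussian_le (hΩ : MeasurableSet Ω) {h : Eucl d → ℝ≥0∞}
    (hm : Measurable h) (f : L2 Ω) {t : ℝ}
    (ht : 0 < t) (hle : ∀ ε, 0 < ε → ∀ x,
      ∫⁻ y in Ω, h y * ENNReal.ofReal (gaussKernel ε (x - y)) ≤
        ENNReal.ofReal (heatConv f (t + ε) x)) :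
    ∀ᵐ x ∂volume.restrict Ω, h x ≤ ENNReal.ofReal (heatConv f t x) := by
  obtain ⟨M, hM⟩ := exists_heatConv_le f ht
  refine ae_le_of_forall_setLIntegral_le_of_sigmaFinite hm fun s hs hsf => ?_
  rw [Measure.restrict_restrict hs]
  rw [Measure.restrict_apply hs] at hsf
  have hA := hs.inter hΩ
  set A := s ∩ Ω
  refine ENNReal.le_of_forall_pos_le_add fun δ hδ _ => ?_
  obtain ⟨U, hAU, hU, hUA⟩ := A.exists_isOpen_lt_add hsf.ne
    -- The `+ 1` keeps the divisor nonzero when the bound `M` contributes nothing.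
    (ε := (δ : ℝ≥0∞) / (ENNReal.ofReal M + 1)) (by
      refine (ENNReal.div_pos (by exact_mod_cast hδ.ne') ?_).ne'
      exact ENNReal.add_ne_top.2 ⟨ENNReal.ofReal_ne_top, ENNReal.one_ne_top⟩)
  have hUf : volume U ≠ ∞ := (hUA.trans_le le_top).ne
  have hdiff : volume (U \ A) ≤ (δ : ℝ≥0∞) / (ENNReal.ofReal M + 1) := by
    rw [measure_sdiff hAU hA.nullMeasurableSet hsf.ne]
    exact tsub_le_iff_left.2 hUA.le
  calc ∫⁻ y in A, h y ≤ ∫⁻ y in Ω, U.indicator h y := by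
        rw [lintegral_indicator hU.measurableSet, Measure.restrict_restrict hU.measurableSet]
        exact lintegral_mono_set fun x hx => ⟨hAU hx, hx.2⟩
    _ ≤ ∫⁻ x in U, ENNReal.ofReal (heatConv f t x) := setLIntegral_le_of_gaussian_le hm f ht hle hU hUf
    _ = (∫⁻ x in A, ENNReal.ofReal (heatConv f t x)) +
          ∫⁻ x in U \ A, ENNReal.ofReal (heatConv f t x) := by
        rw [← lintegral_inter_add_sdiff _ U hA, Set.inter_eq_right.2 hAU]
    _ ≤ (∫⁻ x in A, ENNReal.ofReal (heatConv f t x)) + δ := by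
        gcongr
        calc _ ≤ ∫⁻ _ in U \ A, (ENNReal.ofReal M + 1) := lintegral_mono fun x =>
              (ENNReal.ofReal_le_ofReal (hM t le_rfl (by linarith) x)).trans le_self_add
          _ = (ENNReal.ofReal M + 1) * volume (U \ A) := by
              rw [lintegral_const, Measure.restrict_apply_univ]
          _ ≤ (ENNReal.ofReal M + 1) * ((δ : ℝ≥0∞) / (ENNReal.ofReal M + 1)) := by gcongr
          _ ≤ δ := ENNReal.mul_div_le

end GaussianLimits
end Torsion

/-! ### Domination of the Dirichlet heat semigroup. -/

namespace Torsion

section DirichletDomination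

variable {d : ℕ}

theorem re_inner_gaussL2_rampL2 {Ω : Set (Eucl d)} (x : Eucl d) {s : ℝ} (hs : 0 < s) (n : ℝ)
    (u : L2 Ω) : (inner ℂ (gaussL2 Ω x s) (rampL2 ((n : ℂ) • u))).re =
      ∫ y in Ω, gaussKernel s (x - y) * ramp (n * (u y).re) := by
  rw [re_inner_eq_integral]
  refine integral_congr_ae ?_
  filter_upwards [coeFn_gaussL2 (Ω := Ω) x hs, coeFn_rampL2 ((n : ℂ) • u), Lp.coeFn_smul (n : ℂ) u]
    with y h1 h2 h3
  rw [h1, h2, h3, Pi.smul_apply, rampRe, smul_eq_mul, Complex.re_ofReal_mul]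
  simp [RCLike.inner_apply, mul_comm]

theorem integrable_gaussKernel_mul {Ω : Set (Eucl d)} (x : Eucl d) {s : ℝ} (hs : 0 < s) (u : L2 Ω)
    {g : Eucl d → ℝ} (hg : Measurable g) (hgu : ∀ y, |g y| ≤ ‖u y‖) :
    Integrable (fun y => gaussKernel s (x - y) * g y) (volume.restrict Ω) := by
  refine (integrable_gaussKernel_mul_norm x hs u).mono ?_ (Eventually.of_forall fun y => ?_)
  · have hk : Measurable fun y : Eucl d => gaussKernel s (x - y) :=
      Continuous.measurable (by fun_prop)
    exact (hk.mul hg).aestronglyMeasurable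
  · rw [norm_mul, norm_mul, norm_norm, Real.norm_eq_abs (g y)]
    exact mul_le_mul_of_nonneg_left (hgu y) (norm_nonneg _)

variable {D : TopologicalSpace.Opens (Eucl d)}
  {R : L2 (D : Set (Eucl d)) →L[ℂ] L2 (D : Set (Eucl d))} {e : ℝ}

/-- The comparison is applied to `n f` and divided by `n`. Since `n·max(r, 0) - 1 ≤ ramp(nr) ≤ n|r|`
and the kernel has mass at most one, the error is `1/n`. -/
theorem integral_gaussKernel_mul_posPart_le (hRH : IsBoundedInverse (negDirichletLaplacian D) R)
    (hR : IsInverseAbove R e) (f : L2 (D : Set (Eucl d))) (x : Eucl d) {t ε : ℝ} (ht : 0 < t)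
    (hε : 0 < ε) :
    ∫ y in (D : Set (Eucl d)), gaussKernel ε (x - y) * max (heat R t f y).re 0 ≤
      heatConv f (t + ε) x := by
  set F := heat R t f with hF
  set I := ∫ y in (D : Set (Eucl d)), gaussKernel ε (x - y) * max (F y).re 0 with hI
  have hFm : Measurable fun y => (F y).re :=
    Complex.measurable_re.comp (Lp.stronglyMeasurable F).measurable
  have hfm : Measurable fun y => (f y).re :=
    Complex.measurable_re.comp (Lp.stronglyMeasurable f).measurable
  have hrm : Measurable ramp := differentiable_ramp.continuous.measurable
  have hle : ∀ (n : ℝ) (z : ℂ), 0 ≤ n → |ramp (n * z.re)| ≤ ‖(n : ℂ) * z‖ := fun n z hn => by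
    rw [abs_of_nonneg (ramp_nonneg _), ← Complex.re_ofReal_mul]
    exact (ramp_le_abs _).trans (Complex.abs_re_le_norm _)
  have hramp : ∀ (s : ℝ), 0 < s → ∀ (n : ℝ), 0 ≤ n → ∀ (u : L2 (D : Set (Eucl d))),
      Integrable (fun y => gaussKernel s (x - y) * ramp (n * (u y).re))
        (volume.restrict (D : Set (Eucl d))) := fun s hs n hn u => by
    have hum : Measurable fun y => ramp (n * (u y).re) := hrm.comp (measurable_const.mul
      (Complex.measurable_re.comp (Lp.stronglyMeasurable u).measurable))
    have h1 : ∀ᵐ y ∂volume.restrict (D : Set (Eucl d)),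
      ‖gaussKernel s (x - y) * ramp (n * (u y).re)‖ ≤ ‖n * (gaussKernel s (x - y) * ‖u y‖)‖ :=
      Eventually.of_forall fun y => by
        rw [norm_mul, norm_mul, norm_mul, norm_norm]
        have := hle n (u y) hn
        rw [norm_mul, Complex.norm_real] at this
        calc _ ≤ ‖gaussKernel s (x - y)‖ * (‖n‖ * ‖u y‖) := by gcongr; exact this
          _ = _ := by ring
    refine ((integrable_gaussKernel_mul_norm x hs u).const_mul n).mono ?_ h1
    have hk : Measurable fun y : Eucl d => gaussKernel s (x - y) :=
      Continuous.measurable (by fun_prop)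
    exact (hk.mul hum).aestronglyMeasurable
  have key : ∀ n : ℕ, (n : ℝ) * I ≤ n * heatConv f (t + ε) x + 1 := fun n => by
    have h1 := re_inner_gaussL2_heat_le hRH hR (((n : ℝ) : ℂ) • f) x ht hε
    rw [map_smul, re_inner_gaussL2_rampL2 x hε, re_inner_gaussL2_rampL2 x (by linarith)] at h1
    have h2 : ∫ y in (D : Set (Eucl d)), gaussKernel (t + ε) (x - y) * ramp (n * (f y).re) ≤
        n * heatConv f (t + ε) x := by
      rw [heatConv, ← integral_const_mul]
      refine integral_mono (hramp _ (by linarith) _ (Nat.cast_nonneg n) f)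
        ((integrable_gaussKernel_mul_norm x (by linarith) f).const_mul _) fun y => ?_
      have h3 := (le_abs_self _).trans (hle n (f y) (Nat.cast_nonneg n))
      rw [norm_mul, Complex.norm_real, Real.norm_of_nonneg (Nat.cast_nonneg n)] at h3
      have h4 := mul_le_mul_of_nonneg_left h3
        (gaussKernel_nonneg (t := t + ε) (by linarith) (x - y))
      simp only
      linarith
    have h5 : ∫ y in (D : Set (Eucl d)), gaussKernel ε (x - y) ≤ 1 := by
      rw [← integral_gaussKernel hε x]
      exact setIntegral_le_integral (integrable_gaussKernel hε x)
        (Eventually.of_forall fun y => gaussKernel_nonneg hε.le _)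
    have h6 : (n : ℝ) * I ≤
        (∫ y in (D : Set (Eucl d)), gaussKernel ε (x - y) * ramp (n * (F y).re)) +
          ∫ y in (D : Set (Eucl d)), gaussKernel ε (x - y) := by
      rw [hI, ← integral_const_mul, ← integral_add (hramp ε hε n (Nat.cast_nonneg n) F)
        (integrable_gaussKernel hε x).restrict]
      refine integral_mono ((integrable_gaussKernel_mul x hε F (hFm.max measurable_const)
        fun y => ?_).const_mul _) ((hramp ε hε n (Nat.cast_nonneg n) F).add
        (integrable_gaussKernel hε x).restrict) fun y => ?_
      · rw [abs_of_nonneg (le_max_right _ _)]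
        exact max_le (Complex.re_le_norm _) (norm_nonneg _)
      · have h7 : (n : ℝ) * max (F y).re 0 ≤ ramp (n * (F y).re) + 1 := by
          rw [mul_max_of_nonneg _ _ (Nat.cast_nonneg n), mul_zero]
          refine max_le ?_ ?_
          · linarith [sub_one_le_ramp (n * (F y).re)]
          · linarith [ramp_nonneg (n * (F y).re)]
        have h8 := mul_le_mul_of_nonneg_left h7 (gaussKernel_nonneg hε.le (x - y))
        simp only
        linarith
    linarith
  by_contra hlt
  rw [not_le] at hlt
  obtain ⟨n, hn⟩ := exists_nat_gt (1 / (I - heatConv f (t + ε) x))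
  rw [div_lt_iff₀ (by linarith)] at hn
  have := key n
  linarith

theorem ae_re_heat_le (hRH : IsBoundedInverse (negDirichletLaplacian D) R)
    (hR : IsInverseAbove R e) (f : L2 (D : Set (Eucl d))) {t : ℝ} (ht : 0 < t) :
    ∀ᵐ x ∂volume.restrict (D : Set (Eucl d)), (heat R t f x).re ≤ heatConv f t x := by
  have hFm : Measurable fun y => max (heat R t f y).re 0 :=
    (Complex.measurable_re.comp (Lp.stronglyMeasurable _).measurable).max measurable_const
  have h1 := ae_le_heatConv_of_gaussian_le D.isOpen.measurableSet hFm.ennreal_ofReal f ht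
    (fun ε hε x => by
      have hint := integrable_gaussKernel_mul x hε (heat R t f) hFm fun y => by
        rw [abs_of_nonneg (le_max_right _ _)]
        exact max_le (Complex.re_le_norm _) (norm_nonneg _)
      refine le_trans (le_of_eq ?_) (ENNReal.ofReal_le_ofReal
        (integral_gaussKernel_mul_posPart_le hRH hR f x ht hε))
      rw [ofReal_integral_eq_lintegral_ofReal hint (Eventually.of_forall fun y =>
        mul_nonneg (gaussKernel_nonneg hε.le _) (le_max_right _ _))]
      refine lintegral_congr fun y => ?_
      rw [mul_comm, ENNReal.ofReal_mul (gaussKernel_nonneg hε.le _)])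
  filter_upwards [h1] with x hx
  rw [ENNReal.ofReal_le_ofReal_iff (heatConv_nonneg f ht x)] at hx
  exact (le_max_left _ _).trans hx

/-- The Dirichlet heat semigroup is dominated by the free heat semigroup. -/
theorem isHeatDominated_dirichlet (hRH : IsBoundedInverse (negDirichletLaplacian D) R)
    (hR : IsInverseAbove R e) : IsHeatDominated R := by
  intro t ht f
  have h1 : ∀ c : ℂ, ∀ᵐ x ∂volume.restrict (D : Set (Eucl d)),
      (c * heat R t f x).re ≤ ‖c‖ * heatConv f t x := fun c => by
    have h2 := ae_re_heat_le hRH hR (c • f) ht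
    rw [map_smul] at h2
    have h3 : ∀ x, heatConv (c • f) t x = ‖c‖ * heatConv f t x := fun x => by
      rw [heatConv, heatConv, ← integral_const_mul]
      refine integral_congr_ae ?_
      filter_upwards [Lp.coeFn_smul c f] with y hy
      rw [hy, Pi.smul_apply, norm_smul]
      ring
    filter_upwards [h2, Lp.coeFn_smul c (heat R t f)] with x h4 h5
    rwa [h5, Pi.smul_apply, smul_eq_mul, h3] at h4
  -- Countably many phases share one null set and density extends the bound to all `c`; the
  -- conjugate of the value itself then turns the real part into the modulus.
  filter_upwards [ae_all_iff.2 fun n => h1 (TopologicalSpace.denseSeq ℂ n)] with x hx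
  change _ ≤ heatConv f t x
  have hall : ∀ c : ℂ, (c * heat R t f x).re ≤ ‖c‖ * heatConv f t x := fun c =>
    (TopologicalSpace.denseRange_denseSeq ℂ).induction_on
      (p := fun c => (c * heat R t f x).re ≤ ‖c‖ * heatConv f t x) c
      (isClosed_le (by fun_prop) (by fun_prop)) hx
  have h2 := hall ((starRingEnd ℂ) (heat R t f x))
  rw [RCLike.norm_conj, Complex.conj_mul', ← Complex.ofReal_pow, Complex.ofReal_re, sq] at h2
  rcases eq_or_lt_of_le (norm_nonneg (heat R t f x)) with h0 | h0
  · rw [← h0]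
    exact heatConv_nonneg f ht x
  · exact le_of_mul_le_mul_left h2 h0

end DirichletDomination
end Torsion

/-! ### Assembly of the results. -/

theorem theorem1p5 (d : ℕ) (hd : 1 ≤ d) :
    (∀ (Ω : Set (Torsion.Eucl d)), NullMeasurableSet Ω volume →
      ∀ (H : Torsion.L2 Ω →ₗ.[ℂ] Torsion.L2 Ω) (T : ℝ≥0 → Torsion.L2 Ω →L[ℂ] Torsion.L2 Ω),
        IsSelfAdjoint H →
        0 < Torsion.bottomSpectrum H →
        Torsion.IsC0Semigroup T →
        Torsion.IsGenerator T (-H) →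
        Torsion.DominatedByFreeHeat T →
        1 ≤ Torsion.q H ∧ Torsion.q H ≤ ENNReal.ofReal (Torsion.torsionConst d)) ∧
    Torsion.cConst < 0.61 ∧
    (∀ D : TopologicalSpace.Opens (Torsion.Eucl d),
      0 < Torsion.bottomSpectrum (Torsion.negDirichletLaplacian D) →
      (∃ u : Torsion.Eucl d → ℝ, Torsion.IsTorsionFunction D u) ∧
      ∀ u : Torsion.Eucl d → ℝ, Torsion.IsTorsionFunction D u →
        eLpNorm u ∞ (volume.restrict (D : Set (Torsion.Eucl d))) ≤
          ENNReal.ofReal (Torsion.torsionConst d /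
            Torsion.bottomSpectrum (Torsion.negDirichletLaplacian D))) := by
  refine ⟨fun Ω hΩ H T hH h0 hT hG hdom => Torsion.q_bounds hd hΩ hH h0 hT hG hdom,
    Torsion.cConst_lt, fun D h0 => Torsion.isTorsionFunction_bounds hd h0 ?_⟩
  exact Torsion.isHeatDominated_dirichlet (Torsion.boundedInverse_spec h0)
    (Torsion.isInverseAbove_dirichlet h0)
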